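/- Let $n\ge 0$ and let $S_{n+1}$ be the symmetric group on $n+1$ letters with Coxeter generators $s_r=(r,r+1)$, $1\le r\le n$, Coxeter length $\ell$ and (strong) Bruhat order $\le$. For $0<q<1$ let $A_q(n)=C(SU_q(n+1))$ be the universal unital C*-algebra generated by $z_{i,j}$, $1\le i,j\le n+1$, such that the matrix $(z_{i,j})$ is unitary and $\sum_{k} E_{k_1\dots k_{n+1}}\,z_{j_1k_1}\cdots z_{j_{n+1}k_{n+1}}=E_{j_1\dots j_{n+1}}$ for all $j_1,\dots,j_{n+1}$, where $E_{k_1\dots k_{n+1}}$ is $(-q)^{\#\text{inversions}}$ if $k$ is a permutation and $0$ otherwise. Let $A_0(n)$ (the crystallized algebra) be the universal unital C*-algebra generated by $z_{i,j}$, $1\le i,j\le n+1$, with the relations $z_{i,j}z_{i,l}=0$ for $j<l$; $z_{i,j}z_{k,j}=0$ for $i<k$; for $i<k$ and $j<l$: $z_{i,l}z_{k,j}=z_{k,j}z_{i,l}$, and $z_{i,l}z_{k,j}=0$ if $\max(i,j)\ge\min(k,l)$, $z_{i,j}z_{k,l}-z_{k,l}z_{i,j}=z_{i,l}z_{k,j}$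 if $\max(i,j)+1=\min(k,l)$, $z_{i,j}z_{k,l}=z_{k,l}z_{i,j}$ if $\max(i,j)+1<\min(k,l)$; $z_{1,1}z_{2,2}\cdots z_{n+1,n+1}=1$; and $z_{r,s}^*=\prod_{m=1}^{n} z_{\rho_m,\sigma_m}$ (in this order), where $\rho_1<\dots<\rho_n$ are the indices other than $r$ and $\sigma_1<\dots<\sigma_n$ those other than $s$. Let $S$ be the backward shift on $\ell^2(\mathbb N)$ ($Se_m=e_{m-1}$, $Se_0=0$), $q^Ne_m=q^me_m$ and $P_0=1-S^*S$. Let $\pi^{(q)}_{s_r}(z_{i,j})$ be, for $(i,j)=(r,r),(r+1,r+1),(r,r+1),(r+1,r)$ respectively, $S\sqrt{1-q^{2N}},\ \sqrt{1-q^{2N}}S^*,\ -q^{N+1},\ q^N$ if $q\in(0,1)$, and $S,\ S^*,\ P_0,\ P_0$ if $q=0$; all other entries are $\delta_{i,j}1$. For $t=(t_1,\dots,t_n)$ in the torus $\mathbb T=U(1)^n$ put $\chi_t(z_{i,j})=\delta_{i,j}\overline{t_{i-1}}\,t_i$ with $t_0=t_{n+1}=1$. The convolution $\pi*\pi'$ is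 given on generators by $z_{i,j}\mapsto\sum_k\pi(z_{i,k})\otimes\pi'(z_{k,j})$, where for $q=0$ the sum runs only over $\min(i,j)\le k\le\max(i,j)$. For a word $a=s_{a_1}\cdots s_{a_m}$ put $\pi^{(q)}_{t,a}=\chi_t*\pi^{(q)}_{s_{a_1}}*\cdots*\pi^{(q)}_{s_{a_m}}$ on $\ell^2(\mathbb N)^{\otimes m}$. If $a$ is a reduced word of $w\in S_{n+1}$, this representation is denoted $\pi^{(q)}_{t,w}$. Let $\mathscr T=C^*(S)$ be the Toeplitz algebra and $S_k\in\mathscr T^{\otimes m}$ the shift of the $k$-th factor. **Theorem.** These formulas define representations $\pi^{(q)}_{t,a}$ of $A_q(n)$ for all words $a$, all $t\in\mathbb T$ and all $q\in[0,1)$. Let $u\le w$ in the Bruhat order of $S_{n+1}$. 1. For all reduced words $a$ of $w$ and $b$ of $u$, all $t\in\mathbb T$ and all $q\in[0,1)$, $\pi^{(q)}_{t,u}=\pi^{(q)}_{t,b}$ factors through $\pi^{(q)}_{t,w}=\pi^{(q)}_{t,a}$: there is a $*$-homomorphism $\varphi:\pi^{(q)}_{t,a}(A_q(n))\to\pi^{(q)}_{t,b}(A_q(n))$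 with $\varphi\circ\pi^{(q)}_{t,a}=\pi^{(q)}_{t,b}$. 2. For every reduced word $a$ of $w$ there are a reduced word $b$ of $u$ obtained from $a$ by deleting some letters, and a unital $*$-homomorphism $ev:\mathscr T^{\otimes\ell(w)}\to\mathscr T^{\otimes\ell(u)}$, that sends $S_k$ to $1$ for each deleted position $k$ of $a$ and to the shift of the corresponding factor for each other position, such that for all $t\in\mathbb T$ and $q\in[0,1)$ the image of $\pi^{(q)}_{t,a}$ lies in $\mathscr T^{\otimes\ell(w)}$ and $ev\circ\pi^{(q)}_{t,a}=\pi^{(q)}_{t,b}$. -/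

import Mathlib

namespace QSU

open scoped ENNReal

noncomputable section

/-! ## Words in the symmetric group and the Bruhat order -/

/-- The adjacent transposition `s_r = (r, r + 1)` in `S_{n+1}`, acting on `Fin (n + 1)`. -/
def simpleRefl {n : ℕ} (r : Fin n) : Equiv.Perm (Fin (n + 1)) :=
  Equiv.swap r.castSucc r.succ

/-- The permutation `s_{a_1} s_{a_2} ⋯ s_{a_m}` expressed by the word `a`. -/
def wordProd {n : ℕ} (a : List (Fin n)) : Equiv.Perm (Fin (n + 1)) :=
  (a.map simpleRefl).prod

/-- The Coxeter length: the least length of a word in the generators `s_r` that expresses `w`. -/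
def coxLength {n : ℕ} (w : Equiv.Perm (Fin (n + 1))) : ℕ :=
  sInf {m | ∃ a : List (Fin n), wordProd a = w ∧ a.length = m}

/-- `a` is a reduced word (reduced expression) of `w`. -/
def IsReducedWord {n : ℕ} (a : List (Fin n)) (w : Equiv.Perm (Fin (n + 1))) : Prop :=
  wordProd a = w ∧ a.length = coxLength w

/-- The (strong) Bruhat order on `S_{n+1}`: the reflexive transitive closure of the relations
`x → x * (i j)` with `ℓ(x) < ℓ(x * (i j))`, where `(i j)` runs over all transpositions. -/
def BruhatLE {n : ℕ} (u w : Equiv.Perm (Fin (n + 1))) : Prop :=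
  Relation.ReflTransGen
    (fun x y : Equiv.Perm (Fin (n + 1)) =>
      ∃ i j, i ≠ j ∧ y = x * Equiv.swap i j ∧ coxLength x < coxLength y) u w

/-! ## The C*-algebras `A_q(n) = C(SU_q(n+1))` for `0 ≤ q < 1` -/

/-- The number of inversions of a sequence of indices. -/
def inversions {N : ℕ} (j : Fin N → Fin N) : ℕ :=
  (Finset.univ.filter fun p : Fin N × Fin N => p.1 < p.2 ∧ j p.2 < j p.1).card

/-- The `q`-antisymmetric tensor: `(-q)^{ℓ(j)}` if `j` is a permutation, and `0` otherwise. -/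
def qTensor {N : ℕ} (q : ℝ) (j : Fin N → Fin N) : ℝ :=
  open Classical in if Function.Injective j then (-q) ^ inversions j else 0

/-- The relations of `C(SU_q(n+1))` for `0 < q < 1`: the matrix `(z i j)` is unitary and
`∑_k E_k z_{j_0 k_0} z_{j_1 k_1} ⋯ z_{j_n k_n} = E_j` for all `j`, where `E = qTensor q`. -/
structure QuantumRel {n : ℕ} {B : Type*} [Ring B] [StarRing B] [Algebra ℂ B] (q : ℝ)
    (z : Fin (n + 1) → Fin (n + 1) → B) : Prop where
  row : ∀ i j, ∑ k, z i k * star (z j k) = if i = j then 1 else 0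
  col : ∀ i j, ∑ k, star (z k i) * z k j = if i = j then 1 else 0
  det : ∀ j : Fin (n + 1) → Fin (n + 1),
    ∑ k : Fin (n + 1) → Fin (n + 1),
      (qTensor q k : ℂ) • (List.ofFn fun m => z (j m) (k m)).prod = (qTensor q j : ℂ) • 1

/-- The relations of the crystallized algebra `A_0(n)`. In the last one the product runs, in
increasing order, over the unique increasing matching of the rows other than `r` with the columns
other than `s`; it is `z_{0,0} ⋯ z_{r-1,r-1} z_{r+1,r} ⋯ z_{s,s-1} z_{s+1,s+1} ⋯ z_{n,n}` for
`r ≤ s` and `z_{0,0} ⋯ z_{s-1,s-1} z_{s,s+1} ⋯ z_{r-1,r} z_{r+1,r+1} ⋯ z_{n,n}` for `s ≤ r`. -/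
structure CrystalRel {n : ℕ} {B : Type*} [Ring B] [StarRing B]
    (z : Fin (n + 1) → Fin (n + 1) → B) : Prop where
  row : ∀ i j l, j < l → z i j * z i l = 0
  col : ∀ i k j, i < k → z i j * z k j = 0
  anti : ∀ i k j l, i < k → j < l → z i l * z k j = z k j * z i l
  anti_zero : ∀ i k j l, i < k → j < l → min k l ≤ max i j → z i l * z k j = 0
  diag_near : ∀ i k j l, i < k → j < l → (max i j : Fin (n + 1)).val + 1 = (min k l).val →
    z i j * z k l - z k l * z i j = z i l * z k j
  diag_far : ∀ i k j l, i < k → j < l → (max i j : Fin (n + 1)).val + 1 < (min k l).val →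
    z i j * z k l = z k l * z i j
  det : (List.ofFn fun i => z i i).prod = 1
  adj : ∀ r s, star (z r s) = (List.ofFn fun k : Fin n => z (r.succAbove k) (s.succAbove k)).prod

/-- The defining relations of `A_q(n)`, `0 ≤ q < 1`. -/
def Rel {n : ℕ} {B : Type*} [Ring B] [StarRing B] [Algebra ℂ B] (q : ℝ)
    (z : Fin (n + 1) → Fin (n + 1) → B) : Prop :=
  (q = 0 ∧ CrystalRel z) ∨ (q ≠ 0 ∧ QuantumRel q z)

section Bounded

variable {B : Type*} [CStarAlgebra B]

/-- Extension of a matrix by zero to all pairs of natural numbers. -/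
def extend {n : ℕ} (z : Fin (n + 1) → Fin (n + 1) → B) (a b : ℕ) : B :=
  if h : a < n + 1 ∧ b < n + 1 then z ⟨a, h.1⟩ ⟨b, h.2⟩ else 0

theorem extend_val {n : ℕ} (z : Fin (n + 1) → Fin (n + 1) → B) (i j : Fin (n + 1)) :
    extend z i j = z i j := by
  simp [extend, i.2, j.2]

theorem extend_mk {n : ℕ} (z : Fin (n + 1) → Fin (n + 1) → B) (a b : ℕ) (ha : a < n + 1)
    (hb : b < n + 1) : z ⟨a, ha⟩ ⟨b, hb⟩ = extend z a b := by
  simp [extend, ha, hb]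

theorem prod_ofFn_succAbove {n : ℕ} (z : Fin (n + 1) → Fin (n + 1) → B) (r s : Fin (n + 1))
    (hsr : s ≤ r) :
    (List.ofFn fun k : Fin n => z (r.succAbove k) (s.succAbove k)).prod =
      ((List.range s).map fun m => extend z m m).prod *
      (((List.range' s (r - s)).map fun m => extend z m (m + 1)).prod *
      ((List.range' r (n - r)).map fun m => extend z (m + 1) (m + 1)).prod) := by
  have h1 : (List.ofFn fun k : Fin n => z (r.succAbove k) (s.succAbove k)) =
      (List.range n).map fun m : ℕ => extend z (if m < (r : ℕ) then m else m + 1)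
        (if m < (s : ℕ) then m else m + 1) := by
    apply List.ext_getElem
    · simp
    · intro m h1 h2
      simp only [List.getElem_ofFn, List.getElem_map, List.getElem_range]
      rw [← extend_val z]
      congr 1 <;> simp only [Fin.succAbove, Fin.lt_def] <;> split_ifs <;> simp_all
  have hsr' : (s : ℕ) ≤ r := hsr
  have hr : (r : ℕ) ≤ n := by omega
  have h2 : List.range n =
      List.range s ++ (List.range' s (r - s) ++ List.range' r (n - r)) := by
    simp only [List.range_eq_range']
    have e1 : List.range' (s : ℕ) (r - s) ++ List.range' r (n - r) = List.range' s (n - s) := by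
      have := @List.range'_append_1 s (r - s) (n - r)
      rw [show (s : ℕ) + (r - s) = r by omega, show (r : ℕ) - s + (n - r) = n - s by omega] at this
      exact this
    have e2 := @List.range'_append_1 0 s (n - s)
    rw [show (0 : ℕ) + s = s by omega, show (s : ℕ) + (n - s) = n by omega] at e2
    rw [e1, e2]
  rw [h1, h2, List.map_append, List.map_append, List.prod_append, List.prod_append]
  congr 2
  · apply List.map_congr_left
    intro m hm
    have hm' := List.mem_range.1 hm
    rw [if_pos (by omega), if_pos (by omega)]
  · congr 1
    apply List.map_congr_left
    intro m hm
    have hm' := List.mem_range'_1.1 hm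
    rw [if_pos (by omega), if_neg (by omega)]
  · congr 1
    apply List.map_congr_left
    intro m hm
    have hm' := List.mem_range'_1.1 hm
    rw [if_neg (by omega), if_neg (by omega)]

theorem prod_ofFn_diag {n : ℕ} (z : Fin (n + 1) → Fin (n + 1) → B) (r : Fin (n + 1)) :
    (List.ofFn fun k : Fin (n + 1) => z k k).prod =
      ((List.range r).map fun m => extend z m m).prod * (extend z r r *
      ((List.range' r (n - r)).map fun m => extend z (m + 1) (m + 1)).prod) := by
  have h1 : (List.ofFn fun k : Fin (n + 1) => z k k) =
      (List.range (n + 1)).map fun m => extend z m m := by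
    apply List.ext_getElem
    · simp
    · intro m h1 h2
      simp only [List.getElem_ofFn, List.getElem_map, List.getElem_range]
      exact (extend_val z ⟨m, by simpa using h1⟩ ⟨m, by simpa using h1⟩).symm
  have h2 : List.range (n + 1) =
      List.range r ++ (r.val :: (List.range' r (n - r)).map (· + 1)) := by
    have e : (List.range' (r : ℕ) (n - r)).map (· + 1) = List.range' (r + 1) (n - r) := by
      rw [show (fun x : ℕ => x + 1) = (fun x => 1 + x) by ext; omega, List.map_add_range',
        Nat.add_comm]
    rw [e, ← List.range'_succ, List.range_eq_range', List.range_eq_range']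
    have e2 := @List.range'_append_1 0 r (n - r + 1)
    rw [show (0 : ℕ) + r = r by omega, show (r : ℕ) + (n - r + 1) = n + 1 by omega] at e2
    rw [e2]
  rw [h1, h2, List.map_append, List.prod_append, List.map_cons, List.prod_cons, List.map_map]
  rfl

theorem CrystalRel.sum_mul_star {n : ℕ} {z : Fin (n + 1) → Fin (n + 1) → B} (h : CrystalRel z)
    (i : Fin (n + 1)) : ∑ k ∈ Finset.Iic i, z i k * star (z i k) = 1 := by
  set Q := ((List.range' (i : ℕ) (n - i)).map fun m => extend z (m + 1) (m + 1)).prod with hQ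
  set W : ℕ → B := fun k =>
    ((List.range' k (i - k)).map fun m => extend z m (m + 1)).prod * Q with hW
  set P : ℕ → B := fun k => ((List.range k).map fun m => extend z m m).prod with hP
  have hstar : ∀ k : Fin (n + 1), k ≤ i → star (z i k) = P k * W k := fun k hk => by
    rw [h.adj, prod_ofFn_succAbove z i k hk]
  have hWs : ∀ k : ℕ, k < i → W k = extend z k (k + 1) * W (k + 1) := fun k hk => by
    simp only [hW]
    rw [show (i : ℕ) - k = (i - (k + 1)) + 1 by omega, List.range'_succ, List.map_cons,
      List.prod_cons, mul_assoc]
  have hPs : ∀ k : ℕ, P (k + 1) = P k * extend z k k := fun k => by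
    simp [hP, List.range_succ]
  have hcomm : ∀ k : ℕ, k + 1 ≤ i → extend z i (k + 1) * P k = P k * extend z i (k + 1) := by
    intro k hk
    have : ∀ m ≤ k, extend z i (k + 1) * P m = P m * extend z i (k + 1) := by
      intro m hm
      induction m with
      | zero => simp [hP]
      | succ m ih =>
        have hd := h.diag_far (⟨m, by omega⟩ : Fin (n + 1)) i ⟨m, by omega⟩ ⟨k + 1, by omega⟩
          (by rw [Fin.lt_def]; simp; omega) (by rw [Fin.lt_def]; simp; omega)
          (by
            simp only [max_self]
            rcases min_choice i (⟨k + 1, by omega⟩ : Fin (n + 1)) with e | e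
            · rw [e]; omega
            · rw [e]; change m + 1 < k + 1; omega)
        simp only [extend_mk] at hd
        rw [hPs, ← mul_assoc, ih (by omega), mul_assoc, ← hd, mul_assoc]
    exact this k le_rfl
  have key : ∀ k : ℕ, k ≤ i → ∑ m ∈ Finset.range (k + 1),
      extend z i m * star (extend z i m) = P k * (extend z i k * W k) := by
    intro k hk
    induction k with
    | zero =>
      have := hstar ⟨0, by omega⟩ (Fin.zero_le _)
      rw [← extend_val z] at this
      simp only at this
      simp [this, hP]
    | succ k ih =>
      have hs := hstar ⟨k + 1, by omega⟩ hk
      rw [← extend_val z] at hs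
      simp only at hs
      have hn := h.diag_near (⟨k, by omega⟩ : Fin (n + 1)) i ⟨k, by omega⟩ ⟨k + 1, by omega⟩
          (by rw [Fin.lt_def]; simp; omega) (by rw [Fin.lt_def]; simp)
          (by
            simp only [max_self]
            rw [min_eq_right (by exact hk)])
      have ha := h.anti (⟨k, by omega⟩ : Fin (n + 1)) i ⟨k, by omega⟩ ⟨k + 1, by omega⟩
          (by rw [Fin.lt_def]; simp; omega) (by rw [Fin.lt_def]; simp)
      simp only [extend_mk] at hn ha
      rw [Finset.sum_range_succ, ih (by omega), hs, hPs, hWs k (by omega)]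
      have : extend z i (k + 1) * (P k * extend z k k * W (k + 1)) =
          P k * (extend z i (k + 1) * extend z k k) * W (k + 1) := by
        rw [mul_assoc (P k), ← mul_assoc, hcomm k hk]
        simp only [mul_assoc]
      rw [this]
      have h3 : extend z i (k + 1) * extend z k k = extend z k k * extend z i (k + 1)
          - extend z i k * extend z k (k + 1) := by
        rw [← ha, ← hn]; abel
      rw [h3]
      noncomm_ring
  have hfin := key i le_rfl
  have hW' : W i = Q := by simp [hW]
  rw [hW', ← prod_ofFn_diag z i, h.det] at hfin
  rw [← hfin]
  refine Finset.sum_bij (fun k _ => (k : ℕ)) ?_ ?_ ?_ ?_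
  · intro k hk
    simp only [Finset.mem_Iic, Fin.le_def] at hk
    simp only [Finset.mem_range]
    omega
  · intro a _ b _ hab
    exact Fin.ext hab
  · intro m hm
    have hm' := Finset.mem_range.1 hm
    refine ⟨⟨m, by omega⟩, ?_, rfl⟩
    simp only [Finset.mem_Iic, Fin.le_def]
    omega
  · intro k _
    rw [extend_val]

variable [Nontrivial B]

theorem norm_le_one_of_sum_mul_star {ι : Type*} (s : Finset ι) (x : ι → B)
    (h : ∑ k ∈ s, x k * star (x k) = 1) {k : ι} (hk : k ∈ s) : ‖x k‖ ≤ 1 := by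
  let _ := CStarAlgebra.spectralOrder B
  let _ := CStarAlgebra.spectralOrderedRing B
  have h1 : x k * star (x k) ≤ 1 := by
    rw [← h]
    exact Finset.single_le_sum (f := fun k => x k * star (x k))
      (fun i _ => mul_star_self_nonneg (x i)) hk
  have h2 := CStarAlgebra.norm_le_norm_of_nonneg_of_le (mul_star_self_nonneg (x k)) h1
  rw [CStarRing.norm_self_mul_star, norm_one] at h2
  nlinarith [norm_nonneg (x k)]

theorem CrystalRel.norm_le_one {n : ℕ} {z : Fin (n + 1) → Fin (n + 1) → B} (h : CrystalRel z)
    (i j : Fin (n + 1)) : ‖z i j‖ ≤ 1 := by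
  have low : ∀ i j : Fin (n + 1), j ≤ i → ‖z i j‖ ≤ 1 := fun i j hij =>
    norm_le_one_of_sum_mul_star (Finset.Iic i) (fun k => z i k) (h.sum_mul_star i)
      (Finset.mem_Iic.2 hij)
  rcases le_total j i with hij | hij
  · exact low i j hij
  · rw [← norm_star, h.adj]
    have aux : ∀ l : List B, (∀ x ∈ l, ‖x‖ ≤ 1) → ‖l.prod‖ ≤ 1 := by
      intro l hl
      induction l with
      | nil => simp
      | cons x l ih =>
        rw [List.prod_cons]
        refine (norm_mul_le _ _).trans (mul_le_one₀ (hl x (by simp)) (norm_nonneg _) ?_)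
        exact ih fun y hy => hl y (by simp [hy])
    refine aux _ fun x hx => ?_
    obtain ⟨k, rfl⟩ := (List.mem_ofFn' _ _).1 hx
    refine low _ _ ?_
    simp only [Fin.succAbove, Fin.lt_def, Fin.le_def] at hij ⊢
    split_ifs
    all_goals simp at *
    all_goals omega

theorem QuantumRel.norm_le_one {n : ℕ} {q : ℝ} {z : Fin (n + 1) → Fin (n + 1) → B}
    (h : QuantumRel q z) (i j : Fin (n + 1)) : ‖z i j‖ ≤ 1 :=
  norm_le_one_of_sum_mul_star Finset.univ (fun k => z i k) (by simpa using h.row i i)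
    (Finset.mem_univ j)

/-- The relations bound the generators, so that the universal C*-algebra exists. -/
theorem Rel.norm_le_one {n : ℕ} {q : ℝ} {z : Fin (n + 1) → Fin (n + 1) → B}
    (h : Rel q z) (i j : Fin (n + 1)) : ‖z i j‖ ≤ 1 :=
  h.elim (fun h => h.2.norm_le_one i j) (fun h => h.2.norm_le_one i j)

end Bounded

/-- A nonzero unital C*-algebra with a matrix of elements that satisfies the relations. -/
structure Model (q : ℝ) (n : ℕ) where
  carrier : Type
  [cstar : CStarAlgebra carrier]
  [nontrivial : Nontrivial carrier]
  gen : Fin (n + 1) → Fin (n + 1) → carrier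
  rel : Rel q gen

attribute [instance] Model.cstar Model.nontrivial

/-- The C*-algebra of bounded families `(x_M)_M`, `x_M ∈ M`, indexed by all models `M`. -/
abbrev ModelProd (q : ℝ) (n : ℕ) : Type 1 := lp (fun M : Model q n => M.carrier) ∞

instance (q : ℝ) (n : ℕ) : CStarAlgebra (ModelProd q n) where

/-- The bounded family formed by the `(i, j)` entries of all models. -/
def univGen (q : ℝ) (n : ℕ) (i j : Fin (n + 1)) : ModelProd q n :=
  ⟨fun M => M.gen i j, memℓp_infty ⟨1, by rintro _ ⟨M, rfl⟩; exact M.rel.norm_le_one i j⟩⟩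

/-- `A_q(n)`, the universal unital C*-algebra with generators `z_{i,j}`, `0 ≤ i, j ≤ n`, and the
relations `Rel q`: the C*-algebra generated by the universal family. -/
abbrev Aq (q : ℝ) (n : ℕ) : Type 1 :=
  (StarAlgebra.adjoin ℂ
    (Set.range fun p : Fin (n + 1) × Fin (n + 1) => univGen q n p.1 p.2)).topologicalClosure

instance (q : ℝ) (n : ℕ) : CStarAlgebra (Aq q n) :=
  StarSubalgebra.cstarAlgebra _ (h_closed := StarSubalgebra.isClosed_topologicalClosure _)

/-- The generator `z_{i,j}` of `A_q(n)`. -/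
def Aq.z (q : ℝ) (n : ℕ) (i j : Fin (n + 1)) : Aq q n :=
  ⟨univGen q n i j, StarSubalgebra.le_topologicalClosure _
    (StarAlgebra.subset_adjoin ℂ _ ⟨(i, j), rfl⟩)⟩

/-- Evaluation of `A_q(n)` at a model. -/
def Aq.eval {q : ℝ} {n : ℕ} (M : Model q n) : Aq q n →⋆ₐ[ℂ] M.carrier where
  toFun x := (x : ModelProd q n) M
  map_one' := rfl
  map_mul' _ _ := rfl
  map_zero' := rfl
  map_add' _ _ := rfl
  commutes' _ := rfl
  map_star' _ := rfl

/-- The universal property of `A_q(n)`. -/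
theorem Aq.existsUnique_lift {q : ℝ} {n : ℕ} {B : Type} [CStarAlgebra B] [Nontrivial B]
    {T : Fin (n + 1) → Fin (n + 1) → B} (hT : Rel q T) :
    ∃! φ : Aq q n →⋆ₐ[ℂ] B, ∀ i j, φ (Aq.z q n i j) = T i j := by
  refine ⟨Aq.eval ⟨B, T, hT⟩, fun i j => rfl, fun ψ hψ => ?_⟩
  have hc : ∀ χ : Aq q n →⋆ₐ[ℂ] B, Continuous χ := fun χ =>
    AddMonoidHomClass.continuous_of_bound χ 1 fun x => by
      rw [one_mul]; exact NonUnitalStarAlgHom.norm_apply_le χ x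
  refine StarAlgHom.ext_topologicalClosure (hc _) (hc _) (StarAlgHom.ext_adjoin ?_)
  rintro x ⟨p, hp⟩
  have : (StarSubalgebra.inclusion (StarSubalgebra.le_topologicalClosure _)) x =
      Aq.z q n p.1 p.2 := Subtype.ext hp.symm
  simp only [StarAlgHom.comp_apply]
  rw [this, hψ]
  rfl

theorem Aq.ext_eval {q : ℝ} {n : ℕ} {x y : Aq q n} (h : ∀ M : Model q n, eval M x = eval M y) :
    x = y :=
  Subtype.ext (lp.ext (funext h))

/-- The generators of `A_q(n)` satisfy the relations. -/
theorem Aq.rel (q : ℝ) (n : ℕ) : Rel q (Aq.z q n) := by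
  have hz : ∀ (M : Model q n) i j, eval M (Aq.z q n i j) = M.gen i j := fun _ _ _ => rfl
  have hl : ∀ (M : Model q n) (N : ℕ) (r s : Fin N → Fin (n + 1)),
      eval M (List.ofFn fun m => Aq.z q n (r m) (s m)).prod =
        (List.ofFn fun m => M.gen (r m) (s m)).prod := fun M N r s => by
    rw [map_list_prod, List.map_ofFn]; rfl
  by_cases h0 : q = 0
  · have hM : ∀ M : Model q n, CrystalRel M.gen := fun M =>
      M.rel.elim (fun h => h.2) (fun h => absurd h0 h.1)
    refine Or.inl ⟨h0, ⟨?_, ?_, ?_, ?_, ?_, ?_, ?_, ?_⟩⟩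
    · intro i j l h
      exact ext_eval fun M => by simpa [hz] using (hM M).row i j l h
    · intro i k j h
      exact ext_eval fun M => by simpa [hz] using (hM M).col i k j h
    · intro i k j l h h'
      exact ext_eval fun M => by simpa [hz] using (hM M).anti i k j l h h'
    · intro i k j l h h' h''
      refine ext_eval fun M => ?_
      have := (hM M).anti_zero i k j l h h' h''
      simpa only [map_mul, hz, map_zero] using this
    · intro i k j l h h' h''
      refine ext_eval fun M => ?_
      have := (hM M).diag_near i k j l h h' h''
      simpa only [map_mul, map_sub, hz] using this
    · intro i k j l h h' h''
      refine ext_eval fun M => ?_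
      have := (hM M).diag_far i k j l h h' h''
      simpa only [map_mul, hz] using this
    · exact ext_eval fun M => by simpa only [hl, map_one] using (hM M).det
    · intro r s
      exact ext_eval fun M => by simpa only [map_star, hl, hz] using (hM M).adj r s
  · have hM : ∀ M : Model q n, QuantumRel q M.gen := fun M =>
      M.rel.elim (fun h => absurd h.1 h0) (fun h => h.2)
    refine Or.inr ⟨h0, ⟨?_, ?_, ?_⟩⟩
    · intro i j
      exact ext_eval fun M => by
        rw [map_sum, apply_ite (eval M), map_one, map_zero]
        simpa only [map_mul, map_star, hz] using (hM M).row i j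
    · intro i j
      exact ext_eval fun M => by
        rw [map_sum, apply_ite (eval M), map_one, map_zero]
        simpa only [map_mul, map_star, hz] using (hM M).col i j
    · intro j
      exact ext_eval fun M => by
        rw [map_sum, map_smul, map_one]
        simpa only [map_smul, hl] using (hM M).det j

/-! ## Operators on `ℓ²(ℕ)^{⊗ m} = ℓ²(ℕ^m)` -/

/-- The Hilbert space `ℓ²(ℕ)^{⊗ m}`, realised as `ℓ²(ℕ^m)`; the vector
`e_{x_0} ⊗ ⋯ ⊗ e_{x_{m-1}}` is the basis vector at `x`. -/
abbrev H (m : ℕ) : Type := lp (fun _ : Fin m → ℕ => ℂ) 2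

/-- The bounded operators on `ℓ²(ℕ)^{⊗ m}`. -/
abbrev Op (m : ℕ) : Type := H m →L[ℂ] H m

theorem memℓp_weightedComp {ι : Type*} {f : ι → ℝ} (hf : ∀ x, |f x| ≤ 1) {g : ι → ι}
    (hg : Function.Injective g) (ξ : lp (fun _ : ι => ℂ) 2) :
    Memℓp (fun x => (f x : ℂ) * ξ (g x)) 2 := by
  have h0 : 0 < (2 : ℝ≥0∞).toReal := by simp
  refine memℓp_gen (Summable.of_nonneg_of_le (fun x => by positivity) (fun x => ?_)
    (((lp.memℓp ξ).summable h0).comp_injective hg))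
  refine Real.rpow_le_rpow (norm_nonneg _) ?_ h0.le
  rw [norm_mul, Complex.norm_real, Real.norm_eq_abs]
  exact mul_le_of_le_one_left (norm_nonneg _) (hf x)

/-- The contraction `ξ ↦ (x ↦ f x * ξ (g x))` of `ℓ²(ι)`, for `|f| ≤ 1` and `g` injective. -/
def weightedComp {ι : Type*} (f : ι → ℝ) (hf : ∀ x, |f x| ≤ 1) (g : ι → ι)
    (hg : Function.Injective g) :
    lp (fun _ : ι => ℂ) 2 →L[ℂ] lp (fun _ : ι => ℂ) 2 :=
  LinearMap.mkContinuous
    { toFun := fun ξ => ⟨fun x => (f x : ℂ) * ξ (g x), memℓp_weightedComp hf hg ξ⟩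
      map_add' := fun ξ η => by ext x; exact mul_add _ _ _
      map_smul' := fun c ξ => by ext x; exact mul_left_comm _ _ _ }
    1 (fun ξ => by
      have h0 : 0 < (2 : ℝ≥0∞).toReal := by simp
      rw [one_mul]
      refine lp.norm_le_of_tsum_le h0 (norm_nonneg _) ?_
      rw [lp.norm_rpow_eq_tsum h0 ξ]
      refine ((memℓp_weightedComp hf hg ξ).summable h0).tsum_le_tsum_of_inj g hg
        (fun _ _ => by positivity) (fun x => ?_) ((lp.memℓp ξ).summable h0)
      refine Real.rpow_le_rpow (norm_nonneg _) ?_ h0.le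
      change ‖(f x : ℂ) * ξ (g x)‖ ≤ _
      rw [norm_mul, Complex.norm_real, Real.norm_eq_abs]
      exact mul_le_of_le_one_left (norm_nonneg _) (hf x))

/-- The left (backward) shift `S` on the `k`-th tensor factor: `(S_k ξ)(x) = ξ(x + e_k)`, that is,
`S e_m = e_{m-1}` and `S e_0 = 0` on that factor. -/
def shift {m : ℕ} (k : Fin m) : Op m :=
  weightedComp (fun _ => 1) (by simp) (fun x => x + Pi.single k 1) (add_left_injective _)

/-- The operator `q^N` on the `k`-th tensor factor: `e_m ↦ q^m e_m`. -/
def qPow (q : Set.Ico (0 : ℝ) 1) {m : ℕ} (k : Fin m) : Op m :=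
  weightedComp (fun x => (q : ℝ) ^ x k) (fun x => by
    rw [abs_of_nonneg (pow_nonneg q.2.1 _)]
    exact pow_le_one₀ q.2.1 q.2.2.le) id Function.injective_id

/-- The operator `√(1 - q^{2N})` on the `k`-th tensor factor. -/
def sqrtOp (q : Set.Ico (0 : ℝ) 1) {m : ℕ} (k : Fin m) : Op m :=
  weightedComp (fun x => √(1 - (q : ℝ) ^ (2 * x k))) (fun x => by
    rw [abs_of_nonneg (Real.sqrt_nonneg _), Real.sqrt_le_one]
    linarith [pow_nonneg q.2.1 (2 * x k)]) id Function.injective_id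

/-! ## The representations `π_{t,w}` -/

/-- The matrix `(π_{s_r}(z_{i,j}))` of operators on the `k`-th tensor factor. For `q > 0` the
four special entries are `S √(1 - q^{2N})`, `√(1 - q^{2N}) S*`, `-q^{N+1}` and `q^N`; for `q = 0`
they are `S`, `S*`, `P_0` and `P_0`, where `P_0 = 1 - S* S` is the projection onto `e_0`. -/
def simpleEntry (q : Set.Ico (0 : ℝ) 1) {n m : ℕ} (r : Fin n) (k : Fin m)
    (i j : Fin (n + 1)) : Op m :=
  if i = r.castSucc ∧ j = r.castSucc then
    if (q : ℝ) = 0 then shift k else shift k * sqrtOp q k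
  else if i = r.succ ∧ j = r.succ then
    if (q : ℝ) = 0 then star (shift k) else sqrtOp q k * star (shift k)
  else if i = r.castSucc ∧ j = r.succ then
    if (q : ℝ) = 0 then 1 - star (shift k) * shift k else -((q : ℝ) : ℂ) • qPow q k
  else if i = r.succ ∧ j = r.castSucc then
    if (q : ℝ) = 0 then 1 - star (shift k) * shift k else qPow q k
  else if i = j then 1 else 0

/-- The convolution product on the level of generators, from
`Δ(z_{i,j}) = ∑_k z_{i,k} ⊗ z_{k,j}`, where for `q = 0` the sum is only over the `k` with
`min i j ≤ k ≤ max i j`. -/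
def conv {n : ℕ} {B : Type*} [Ring B] (q : ℝ) (X Y : Fin (n + 1) → Fin (n + 1) → B)
    (i j : Fin (n + 1)) : B :=
  if q = 0 then ∑ k ∈ Finset.Icc (min i j) (max i j), X i k * Y k j
  else ∑ k, X i k * Y k j

/-- The matrix of the counit, the neutral element of the convolution. -/
def counitMat {n : ℕ} {B : Type*} [Ring B] (i j : Fin (n + 1)) : B :=
  if i = j then 1 else 0

/-- The matrix of `π_a = π_{s_{a_0}} * ⋯ * π_{s_{a_{m-1}}}`, for a word `a` of length `m`; the
`k`-th representation acts on the `k`-th factor of `ℓ²(ℕ)^{⊗ m}`. -/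
def wordEntry (q : Set.Ico (0 : ℝ) 1) {n : ℕ} (a : List (Fin n)) :
    Fin (n + 1) → Fin (n + 1) → Op a.length :=
  (List.ofFn fun k : Fin a.length => simpleEntry q (a.get k) k).foldr (conv q) counitMat

/-- The diagonal entries of a point `t = (t_1, …, t_n)` of the maximal torus of `SU(n+1)`:
`t_1, conj t_1 * t_2, …, conj t_{n-1} * t_n, conj t_n`. -/
def torusEntry {n : ℕ} (t : Fin n → Circle) (i : Fin (n + 1)) : ℂ :=
  (if h : 0 < (i : ℕ) then star (t ⟨i - 1, by omega⟩ : ℂ) else 1) *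
    (if h : (i : ℕ) < n then (t ⟨i, h⟩ : ℂ) else 1)

/-- The matrix of the one-dimensional representation `χ_t`, with values in the scalars of `B`. -/
def charEntry {n : ℕ} (B : Type*) [Ring B] [Algebra ℂ B] (t : Fin n → Circle)
    (i j : Fin (n + 1)) : B :=
  if i = j then algebraMap ℂ B (torusEntry t i) else 0

/-- The operators `π_{t,a}(z_{i,j})`, where `π_{t,a} = χ_t * π_a`. -/
def repEntry (q : Set.Ico (0 : ℝ) 1) {n : ℕ} (t : Fin n → Circle) (a : List (Fin n)) :
    Fin (n + 1) → Fin (n + 1) → Op a.length :=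
  conv q (charEntry _ t) (wordEntry q a)

/-- `ρ₁` factors through `ρ₂`: there is a *-homomorphism `φ` from the image of `ρ₂` onto the image
of `ρ₁` with `φ ∘ ρ₂ = ρ₁`. -/
def FactorsThrough {A B₁ B₂ : Type*} [Ring A] [StarRing A] [Algebra ℂ A]
    [CStarAlgebra B₁] [CStarAlgebra B₂] (ρ₁ : A →⋆ₐ[ℂ] B₁) (ρ₂ : A →⋆ₐ[ℂ] B₂) : Prop :=
  ∃ φ : ρ₂.range →⋆ₐ[ℂ] ρ₁.range, ∀ x, φ (ρ₂.rangeRestrict x) = ρ₁.rangeRestrict x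

/-- The tensor power `𝒯^{⊗ m}` of the Toeplitz algebra `𝒯 = C*(S)`: the C*-algebra of operators on
`ℓ²(ℕ)^{⊗ m}` generated by the shifts of the individual factors. -/
def toeplitzPow (m : ℕ) : StarSubalgebra ℂ (Op m) :=
  (StarAlgebra.adjoin ℂ (Set.range (shift (m := m)))).topologicalClosure

/-- The shift of the `k`-th factor as an element of `𝒯^{⊗ m}`. -/
def toeplitzShift {m : ℕ} (k : Fin m) : toeplitzPow m :=
  ⟨shift k, StarSubalgebra.le_topologicalClosure _ (StarAlgebra.subset_adjoin ℂ _ ⟨k, rfl⟩)⟩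

end

end QSU

open QSU

/-!
The matrices `π_{t,a}(z_{i,j})` are products of elementary matrices whose entries act on different
tensor factors. For `q ≠ 0` the elementary matrices satisfy the defining relations of `A_q(n)` and
the quadratic relations of quantum matrices (`FRT`), and both are stable under such products
(`QuantumRel.mul`, `FRT.mul`). For `q = 0` no computation with the crystal relations is needed: after
division by powers of `-q` above the diagonal, the matrices converge in norm as `q → 0` to those for
`q = 0` (`crystalLimit_repMat`), and the normalised quadratic, determinant and adjoint relations
converge to the relations of the crystallized algebra (`CrystalLimit.crystalRel`). This gives the
representations `rep q t a`.

By the exchange property every reduced word `a` of `w` contains a reduced word `b` of each `u ≤ w`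
(`BruhatLE.exists_sublist`). Replacing the shift of a tensor factor by `1` is a homomorphism of the
Toeplitz algebra; as the tensor product is here an algebra of operators on `ℓ²(ℕ^m)`, its existence
is shown spatially, by compression to the vectors that are coherent in this factor,
`v ⊗ ξ` with `v = √(1 - r²) ∑ r^j e_j`, in the limit `r → 1` (`exists_eval`). The entries of
`π_{t,a}` lie in the Toeplitz algebra because `q^N` and `√(1 - q^{2N})` are norm limits of
polynomials in the shift and its adjoint, and the homomorphism turns the elementary matrices of the
deleted letters into identity matrices (`EvTo.repEntry`).

It remains to compare different reduced words of the same permutation (`norm_rep_eq`). By Matsumoto's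
theorem (`matsumoto`) it suffices to treat single moves, and it is enough to find, for `q ≠ 0`, an
isometry in each direction that intertwines the matrices of operators: such an isometry gives an
inequality of norms, since the adjoints of the generators are polynomials in the generators. A
commutation move is implemented by the flip of two tensor factors. For a braid move the operators
`z_{3,3}`, `z_{3,2}` and `z_{2,3}` of the word `s_2 s_1 s_2`, applied to the vacuum, generate, up to scalars, an
orthonormal family, on which they act by the same formulas as the operators of `s_1 s_2 s_1` act on
the standard basis (`BraidRel.inner_fockBasis`, `exists_isometry`). The isometry between the two
intertwines the last rows and columns of the matrices, and then, by unitarity and the adjoint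
relations, all entries (`inter_of_corner`). The opposite direction follows by symmetry, so that no
completeness of the orthonormal family has to be shown. For `q = 0` the isometries for small `q`
intertwine the two representations asymptotically (`AsympInter`), which again is enough for an
inequality of norms.
-/


namespace QSU

/-! ### Reduced words and the Bruhat order -/

section Words

variable {n : ℕ}

@[simp] theorem wordProd_nil : wordProd ([] : List (Fin n)) = 1 := rfl

theorem wordProd_append (a b : List (Fin n)) : wordProd (a ++ b) = wordProd a * wordProd b := by
  simp [wordProd]

theorem wordProd_concat (a : List (Fin n)) (s : Fin n) :
    wordProd (a ++ [s]) = wordProd a * simpleRefl s := by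
  simp [wordProd]

@[simp] theorem simpleRefl_mul_self (s : Fin n) : simpleRefl s * simpleRefl s = 1 :=
  Equiv.swap_mul_self _ _

theorem mul_simpleRefl_mul_simpleRefl (x : Equiv.Perm (Fin (n + 1))) (s : Fin n) :
    x * simpleRefl s * simpleRefl s = x := by
  rw [mul_assoc, simpleRefl_mul_self, mul_one]

/-- An adjacent transposition only reverses the order of the pair that it interchanges. -/
theorem simpleRefl_lt_of_lt {s : Fin n} {i j : Fin (n + 1)} (hij : i < j)
    (h : ¬(i = s.castSucc ∧ j = s.succ)) : simpleRefl s i < simpleRefl s j := by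
  simp only [simpleRefl, Equiv.swap_apply_def, Fin.ext_iff, Fin.lt_def, Fin.val_castSucc,
    Fin.val_succ] at *
  split_ifs <;> (try simp only [Fin.val_castSucc, Fin.val_succ] at *) <;> omega

/-- The strong exchange property. If the transposition `(i j)`, `i < j`, is an inversion of the
permutation expressed by `a`, then multiplication by it amounts to deleting a letter of `a`. -/
theorem exists_erase_of_inversion (a : List (Fin n)) {i j : Fin (n + 1)} (hij : i < j)
    (h : wordProd a j < wordProd a i) :
    ∃ b, b.Sublist a ∧ b.length < a.length ∧ wordProd b = wordProd a * Equiv.swap i j := by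
  induction a using List.reverseRecOn generalizing i j with
  | nil => exact absurd h (by simpa using hij.le)
  | append_singleton a s ih =>
    rw [wordProd_concat] at h ⊢
    by_cases hs : i = s.castSucc ∧ j = s.succ
    · refine ⟨a, List.sublist_append_left _ _, by simp, ?_⟩
      rw [hs.1, hs.2]
      exact (mul_simpleRefl_mul_simpleRefl _ s).symm
    · obtain ⟨b, hb, hl, hw⟩ := ih (simpleRefl_lt_of_lt hij hs) h
      refine ⟨b ++ [s], hb.append_right _, by simpa using hl, ?_⟩
      rw [wordProd_concat, hw, mul_assoc, mul_assoc]
      congr 1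
      have := Equiv.swap_apply_apply (simpleRefl s) i j
      rw [this, mul_assoc, inv_mul_cancel, mul_one]

/-- The adjacent transpositions generate the symmetric group. -/
theorem exists_wordProd_eq (w : Equiv.Perm (Fin (n + 1))) :
    ∃ a : List (Fin n), wordProd a = w := by
  have hm : w ∈ Submonoid.closure (Set.range fun i : Fin n => Equiv.swap i.castSucc i.succ) := by
    rw [Equiv.Perm.mclosure_swap_castSucc_succ]; trivial
  induction hm using Submonoid.closure_induction with
  | mem x hx =>
    obtain ⟨s, rfl⟩ := hx
    exact ⟨[s], by simp [wordProd, simpleRefl]⟩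
  | one => exact ⟨[], rfl⟩
  | mul x y _ _ hx hy =>
    obtain ⟨a, rfl⟩ := hx
    obtain ⟨b, rfl⟩ := hy
    exact ⟨a ++ b, wordProd_append a b⟩

theorem coxLength_le (a : List (Fin n)) : coxLength (wordProd a) ≤ a.length :=
  Nat.sInf_le ⟨a, rfl, rfl⟩

theorem exists_isReducedWord (w : Equiv.Perm (Fin (n + 1))) : ∃ a, IsReducedWord a w := by
  obtain ⟨a, ha⟩ := exists_wordProd_eq w
  exact Nat.sInf_mem (s := {m | ∃ a : List (Fin n), wordProd a = w ∧ a.length = m}) ⟨_, a, ha, rfl⟩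

theorem coxLength_mul_swap_lt {w : Equiv.Perm (Fin (n + 1))} {i j : Fin (n + 1)} (hij : i < j)
    (h : w j < w i) : coxLength (w * Equiv.swap i j) < coxLength w := by
  obtain ⟨a, rfl, ha⟩ := exists_isReducedWord w
  obtain ⟨b, -, hl, hb⟩ := exists_erase_of_inversion a hij h
  rw [← hb, ← ha]
  exact (coxLength_le b).trans_lt hl

theorem lt_coxLength_mul_swap {w : Equiv.Perm (Fin (n + 1))} {i j : Fin (n + 1)} (hij : i < j)
    (h : w i < w j) : coxLength w < coxLength (w * Equiv.swap i j) := by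
  have := coxLength_mul_swap_lt (w := w * Equiv.swap i j) hij (by simpa using h)
  rwa [mul_assoc, Equiv.swap_mul_self, mul_one] at this

theorem lt_of_coxLength_mul_swap_lt {w : Equiv.Perm (Fin (n + 1))} {i j : Fin (n + 1)}
    (hij : i < j) (h : coxLength (w * Equiv.swap i j) < coxLength w) : w j < w i := by
  by_contra hn
  have hne : w i ≠ w j := fun e => hij.ne (w.injective e)
  exact (lt_coxLength_mul_swap hij (lt_of_le_of_ne (not_lt.1 hn) hne)).not_gt h

theorem coxLength_mul_simpleRefl_le (w : Equiv.Perm (Fin (n + 1))) (s : Fin n) :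
    coxLength (w * simpleRefl s) ≤ coxLength w + 1 := by
  obtain ⟨a, rfl, ha⟩ := exists_isReducedWord w
  rw [← wordProd_concat, ← ha]
  simpa using coxLength_le (a ++ [s])

/-- The deletion property: a word contains a reduced word of the same permutation. -/
theorem exists_reduced_sublist (a : List (Fin n)) :
    ∃ b, b.Sublist a ∧ IsReducedWord b (wordProd a) := by
  induction a using List.reverseRecOn with
  | nil => exact ⟨[], List.Sublist.refl _, rfl, (Nat.le_zero.1 (coxLength_le [])).symm⟩
  | append_singleton a s ih =>
    obtain ⟨b, hb, hw, hl⟩ := ih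
    have hlt : s.castSucc < s.succ := Fin.castSucc_lt_succ
    rw [wordProd_concat, ← hw] at *
    rcases lt_or_gt_of_ne (fun e => hlt.ne ((wordProd b).injective e)) with h | h
    · refine ⟨b ++ [s], hb.append_right _, wordProd_concat b s, ?_⟩
      refine le_antisymm ?_ ?_
      · have := lt_coxLength_mul_swap hlt h
        simp only [List.length_append, List.length_singleton, hl]
        exact this
      · simpa [hl] using coxLength_mul_simpleRefl_le (wordProd b) s
    · obtain ⟨c, hc, hcl, hcw⟩ := exists_erase_of_inversion b hlt h
      refine ⟨c, (hc.trans hb).trans (List.sublist_append_left _ _), hcw, ?_⟩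
      have h1 := coxLength_mul_simpleRefl_le (wordProd b * simpleRefl s) s
      rw [mul_simpleRefl_mul_simpleRefl, ← hl] at h1
      have h2 := coxLength_le c
      rw [hcw] at h2
      change c.length = coxLength (wordProd b * simpleRefl s)
      change coxLength (wordProd b * simpleRefl s) ≤ _ at h2
      omega

/-- The subword property of the Bruhat order. -/
theorem BruhatLE.exists_sublist {u w : Equiv.Perm (Fin (n + 1))} (h : BruhatLE u w)
    (a : List (Fin n)) (ha : IsReducedWord a w) : ∃ b, b.Sublist a ∧ IsReducedWord b u := by
  induction h generalizing a with
  | refl => exact ⟨a, List.Sublist.refl _, ha⟩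
  | @tail x y _ hxy ih =>
    obtain ⟨i, j, hij, hy, hl⟩ := hxy
    have key : ∃ i j, i < j ∧ y = x * Equiv.swap i j := by
      rcases lt_or_gt_of_ne hij with h | h
      · exact ⟨i, j, h, hy⟩
      · exact ⟨j, i, h, by rw [hy, Equiv.swap_comm]⟩
    obtain ⟨i, j, hij, hy⟩ := key
    have hx : x = y * Equiv.swap i j := by rw [hy, mul_assoc, Equiv.swap_mul_self, mul_one]
    have hd := lt_of_coxLength_mul_swap_lt hij (hx ▸ hl)
    rw [← ha.1] at hd
    obtain ⟨b, hb, -, hbw⟩ := exists_erase_of_inversion a hij hd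
    rw [ha.1, ← hx] at hbw
    obtain ⟨c, hc, hcw⟩ := exists_reduced_sublist b
    obtain ⟨d, hdc, hd⟩ := ih c (hbw ▸ hcw)
    exact ⟨d, hdc.trans (hc.trans hb), hd⟩

theorem isReducedWord_concat {a : List (Fin n)} {w : Equiv.Perm (Fin (n + 1))} {s : Fin n}
    (ha : IsReducedWord a (w * simpleRefl s)) (h : w s.succ < w s.castSucc) :
    IsReducedWord (a ++ [s]) w := by
  refine ⟨by rw [wordProd_concat, ha.1, mul_simpleRefl_mul_simpleRefl], ?_⟩
  have h1 : coxLength (w * simpleRefl s) < coxLength w :=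
    coxLength_mul_swap_lt Fin.castSucc_lt_succ h
  have h2 := coxLength_mul_simpleRefl_le (w * simpleRefl s) s
  rw [mul_simpleRefl_mul_simpleRefl] at h2
  rw [List.length_append, List.length_singleton, ha.2]
  omega

theorem IsReducedWord.of_concat {a : List (Fin n)} {w : Equiv.Perm (Fin (n + 1))} {s : Fin n}
    (h : IsReducedWord (a ++ [s]) w) :
    IsReducedWord a (w * simpleRefl s) ∧ w s.succ < w s.castSucc := by
  have hw : wordProd a = w * simpleRefl s := by
    rw [← h.1, wordProd_concat, mul_simpleRefl_mul_simpleRefl]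
  have h1 := coxLength_le a
  rw [hw] at h1
  have h2 := coxLength_mul_simpleRefl_le (w * simpleRefl s) s
  rw [mul_simpleRefl_mul_simpleRefl] at h2
  have h3 := h.2
  rw [List.length_append, List.length_singleton] at h3
  refine ⟨⟨hw, by omega⟩, lt_of_coxLength_mul_swap_lt Fin.castSucc_lt_succ ?_⟩
  change coxLength (w * simpleRefl s) < _
  omega

theorem simpleRefl_apply_of_ne {s : Fin n} {i : Fin (n + 1)} (h1 : i ≠ s.castSucc)
    (h2 : i ≠ s.succ) : simpleRefl s i = i :=
  Equiv.swap_apply_of_ne_of_ne h1 h2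

/-- Matsumoto's theorem for the symmetric group: a relation on words that is an equivalence,
compatible with appending a letter, and contains the commutation and braid moves at the end of a
word relates any two reduced words of the same permutation. -/
theorem matsumoto (R : List (Fin n) → List (Fin n) → Prop) (hrefl : ∀ a, R a a)
    (hsymm : ∀ a b, R a b → R b a) (htrans : ∀ a b c, R a b → R b c → R a c)
    (hconcat : ∀ a b s, R a b → R (a ++ [s]) (b ++ [s]))
    (hcomm : ∀ (c : List (Fin n)) (s t : Fin n), (s : ℕ) + 1 < t → R (c ++ [s, t]) (c ++ [t, s]))
    (hbraid : ∀ (c : List (Fin n)) (s t : Fin n), (s : ℕ) + 1 = t →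
      R (c ++ [s, t, s]) (c ++ [t, s, t]))
    {a b : List (Fin n)} {w : Equiv.Perm (Fin (n + 1))} (ha : IsReducedWord a w)
    (hb : IsReducedWord b w) : R a b := by
  induction hN : coxLength w generalizing a b w with
  | zero =>
    have h1 := ha.2
    have h2 := hb.2
    rw [hN, List.length_eq_zero_iff] at h1 h2
    rw [h1, h2]
    exact hrefl _
  | succ N ih =>
    have h1 := ha.2
    have h2 := hb.2
    have eqN : ∀ (w : Equiv.Perm (Fin (n + 1))) (c : List (Fin n)) (s : Fin n),
        coxLength w = N + 1 → IsReducedWord (c ++ [s]) w → coxLength (w * simpleRefl s) = N := by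
      intro w c s hN h
      have e1 := h.2
      have e2 := h.of_concat.1.2
      rw [List.length_append, List.length_singleton] at e1
      omega
    obtain rfl | ⟨a', s, rfl⟩ := a.eq_nil_or_concat'
    · simp at h1; omega
    obtain rfl | ⟨b', t, rfl⟩ := b.eq_nil_or_concat'
    · simp at h2; omega
    -- The case `s < t` suffices, by symmetry.
    have main : ∀ (a' b' : List (Fin n)) (s t : Fin n), s < t → IsReducedWord (a' ++ [s]) w →
        IsReducedWord (b' ++ [t]) w → R (a' ++ [s]) (b' ++ [t]) := by
      intro a' b' s t hst ha hb
      obtain ⟨ha1, ha2⟩ := ha.of_concat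
      obtain ⟨hb1, hb2⟩ := hb.of_concat
      rcases (Nat.succ_le_of_lt (Fin.lt_def.1 hst)).lt_or_eq with hfar | hnear
      -- If `s` and `t` are not adjacent, `w` has reduced words `c s t` and `c t s`.
      · have hfar' : (s : ℕ) + 1 < t := hfar
        have e : simpleRefl s * simpleRefl t = simpleRefl t * simpleRefl s := by
          apply Equiv.Perm.Disjoint.commute
          rw [Equiv.Perm.disjoint_iff_disjoint_support]
          simp only [simpleRefl]
          rw [Equiv.Perm.support_swap Fin.castSucc_lt_succ.ne,
            Equiv.Perm.support_swap Fin.castSucc_lt_succ.ne]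
          simp [Fin.ext_iff]
          omega
        obtain ⟨c, hc⟩ := exists_isReducedWord (w * simpleRefl s * simpleRefl t)
        have d1 : (w * simpleRefl s) t.succ < (w * simpleRefl s) t.castSucc := by
          rw [Equiv.Perm.mul_apply, Equiv.Perm.mul_apply, simpleRefl_apply_of_ne,
            simpleRefl_apply_of_ne]
          · exact hb2
          all_goals simp [Fin.ext_iff]; omega
        have d2 : (w * simpleRefl t) s.succ < (w * simpleRefl t) s.castSucc := by
          rw [Equiv.Perm.mul_apply, Equiv.Perm.mul_apply, simpleRefl_apply_of_ne,
            simpleRefl_apply_of_ne]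
          · exact ha2
          all_goals simp [Fin.ext_iff]; omega
        have hc1 := isReducedWord_concat hc d1
        have hc2 : IsReducedWord (c ++ [s]) (w * simpleRefl t) :=
          isReducedWord_concat (by rwa [mul_assoc, ← e, ← mul_assoc]) d2
        have r1 := hconcat _ _ s (ih ha1 hc1 (eqN w a' s hN ha))
        have r2 := hconcat _ _ t (ih hc2 hb1 (eqN w b' t hN hb))
        refine htrans _ _ _ r1 (htrans _ _ _ (hsymm _ _ ?_) r2)
        simpa using hcomm c s t hfar'
      -- Otherwise `w` has reduced words `c s t s` and `c t s t`.
      · have hnear' : (s : ℕ) + 1 = t := hnear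
        have hts : t.castSucc = s.succ := by simp [Fin.ext_iff, hnear']
        have hs1 : simpleRefl s s.castSucc = s.succ := Equiv.swap_apply_left _ _
        have hs2 : simpleRefl s s.succ = s.castSucc := Equiv.swap_apply_right _ _
        have hs3 : simpleRefl s t.succ = t.succ :=
          simpleRefl_apply_of_ne (by simp [Fin.ext_iff]; omega) (by simp [Fin.ext_iff]; omega)
        have ht1 : simpleRefl t s.succ = t.succ := hts ▸ Equiv.swap_apply_left _ _
        have ht2 : simpleRefl t t.succ = s.succ := hts ▸ Equiv.swap_apply_right _ _
        have ht3 : simpleRefl t s.castSucc = s.castSucc :=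
          simpleRefl_apply_of_ne (by simp [Fin.ext_iff]; omega) (by simp [Fin.ext_iff]; omega)
        have e : simpleRefl s * simpleRefl t * simpleRefl s =
            simpleRefl t * simpleRefl s * simpleRefl t := by
          have e1 : simpleRefl s * simpleRefl t * simpleRefl s = Equiv.swap s.castSucc t.succ := by
            have := Equiv.swap_apply_apply (simpleRefl s) s.succ t.succ
            rw [hs2, hs3] at this
            rw [this]
            simp only [simpleRefl, Equiv.swap_inv, hts]
          have e2 : simpleRefl t * simpleRefl s * simpleRefl t = Equiv.swap s.castSucc t.succ := by
            have := Equiv.swap_apply_apply (simpleRefl t) s.castSucc s.succ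
            rw [ht1, ht3] at this
            rw [this]
            simp only [simpleRefl, Equiv.swap_inv]
          rw [e1, e2]
        rw [hts] at hb2
        obtain ⟨c, hc⟩ := exists_isReducedWord (w * simpleRefl s * simpleRefl t * simpleRefl s)
        have hc' : IsReducedWord c (w * simpleRefl t * simpleRefl s * simpleRefl t) := by
          convert hc using 1
          simpa only [mul_assoc] using congrArg (w * ·) e.symm
        have d1 : (w * simpleRefl s * simpleRefl t) s.succ <
            (w * simpleRefl s * simpleRefl t) s.castSucc := by
          simpa only [Equiv.Perm.mul_apply, ht1, ht3, hs1, hs3] using hb2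
        have d2 : (w * simpleRefl s) t.succ < (w * simpleRefl s) t.castSucc := by
          simpa only [Equiv.Perm.mul_apply, hts, hs2, hs3] using hb2.trans ha2
        have d3 : (w * simpleRefl t * simpleRefl s) t.succ <
            (w * simpleRefl t * simpleRefl s) t.castSucc := by
          simpa only [Equiv.Perm.mul_apply, hts, hs2, hs3, ht2, ht3] using ha2
        have d4 : (w * simpleRefl t) s.succ < (w * simpleRefl t) s.castSucc := by
          simpa only [Equiv.Perm.mul_apply, ht1, ht3] using hb2.trans ha2
        have hc1 := isReducedWord_concat (isReducedWord_concat hc d1) d2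
        have hc2 := isReducedWord_concat (isReducedWord_concat hc' d3) d4
        have r1 := hconcat _ _ s (ih ha1 hc1 (eqN w a' s hN ha))
        have r2 := hconcat _ _ t (ih hc2 hb1 (eqN w b' t hN hb))
        refine htrans _ _ _ r1 (htrans _ _ _ ?_ r2)
        simpa using hbraid c s t hnear'
    rcases lt_trichotomy s t with h | rfl | h
    · exact main _ _ _ _ h ha hb
    · exact hconcat _ _ s (ih ha.of_concat.1 hb.of_concat.1 (eqN w a' s hN ha))
    · exact hsymm _ _ (main _ _ _ _ h hb ha)

end Words

end QSU

namespace QSU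

open scoped ENNReal

/-! ### Operators on the Hilbert space of the lattice -/

section Operators

variable {m : ℕ}

@[simp] theorem weightedComp_apply {ι : Type*} (f : ι → ℝ) (hf : ∀ x, |f x| ≤ 1) (g : ι → ι)
    (hg : Function.Injective g) (ξ : lp (fun _ : ι => ℂ) 2) (x : ι) :
    weightedComp f hf g hg ξ x = (f x : ℂ) * ξ (g x) := rfl

theorem Op.ext_apply {A B : Op m} (h : ∀ ξ x, A ξ x = B ξ x) : A = B :=
  ContinuousLinearMap.ext fun ξ => lp.ext (funext (h ξ))

/-- The basis vector at the lattice point `x`. -/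
noncomputable def ket {ι : Type*} [DecidableEq ι] (x : ι) : lp (fun _ : ι => ℂ) 2 :=
  lp.single 2 x 1

theorem ket_apply {ι : Type*} [DecidableEq ι] (x y : ι) :
    (ket x) y = if y = x then (1 : ℂ) else 0 := by
  rw [ket, lp.single_apply]
  simp [Pi.single_apply]

theorem inner_ket {ι : Type*} [DecidableEq ι] (x : ι) (ξ : lp (fun _ : ι => ℂ) 2) :
    inner ℂ (ket x) ξ = ξ x := by
  rw [ket, lp.inner_single_left]
  simp

theorem hasSum_ket {ι : Type*} [DecidableEq ι] (ξ : lp (fun _ : ι => ℂ) 2) :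
    HasSum (fun x => ξ x • ket x) ξ := by
  have := lp.hasSum_single (p := 2) (by simp) ξ
  convert this using 2 with x
  rw [ket, ← lp.single_smul]
  simp

/-- Continuous linear maps that agree on the basis vectors are equal. -/
theorem ext_ket {ι : Type*} [DecidableEq ι] {E : Type*} [NormedAddCommGroup E] [NormedSpace ℂ E]
    {A B : lp (fun _ : ι => ℂ) 2 →L[ℂ] E} (h : ∀ x, A (ket x) = B (ket x)) : A = B := by
  ext1 ξ
  have h1 := (hasSum_ket ξ).mapL A
  have h2 := (hasSum_ket ξ).mapL B
  simp only [map_smul, h] at h1 h2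
  exact h1.unique h2

theorem adjoint_apply_eq_inner {ι κ : Type*} [DecidableEq κ]
    (A : lp (fun _ : κ => ℂ) 2 →L[ℂ] lp (fun _ : ι => ℂ) 2) (ξ : lp (fun _ : ι => ℂ) 2) (x : κ) :
    (ContinuousLinearMap.adjoint A ξ) x = inner ℂ (A (ket x)) ξ := by
  rw [← inner_ket, ContinuousLinearMap.adjoint_inner_right]

theorem star_apply_eq_inner (A : Op m) (ξ : H m) (x : Fin m → ℕ) :
    (star A ξ) x = inner ℂ (A (ket x)) ξ := by
  rw [ContinuousLinearMap.star_eq_adjoint, adjoint_apply_eq_inner]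

/-- A weighted composition operator with an injective substitution is bounded by its weights. -/
theorem norm_le_of_apply_eq {A : Op m} {d : (Fin m → ℕ) → ℂ} {g : (Fin m → ℕ) → Fin m → ℕ}
    (hg : Function.Injective g) (hA : ∀ ξ x, A ξ x = d x * ξ (g x)) {C : ℝ} (hC : 0 ≤ C)
    (hd : ∀ x, ‖d x‖ ≤ C) : ‖A‖ ≤ C := by
  refine ContinuousLinearMap.opNorm_le_bound _ hC fun ξ => ?_
  have h0 : 0 < (2 : ℝ≥0∞).toReal := by simp
  refine lp.norm_le_of_tsum_le h0 (by positivity) ?_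
  have h2 : (2 : ℝ≥0∞).toReal = 2 := by simp
  have hs := (lp.memℓp ξ).summable h0
  rw [h2] at *
  have e : ∀ x, ‖A ξ x‖ ^ (2 : ℝ) ≤ C ^ (2 : ℝ) * ‖ξ (g x)‖ ^ (2 : ℝ) := fun x => by
    rw [hA, norm_mul, Real.mul_rpow (norm_nonneg _) (norm_nonneg _)]
    gcongr
    exact hd x
  have hs' : Summable fun x => C ^ (2 : ℝ) * ‖ξ (g x)‖ ^ (2 : ℝ) :=
    (hs.comp_injective hg).mul_left _
  calc ∑' x, ‖A ξ x‖ ^ (2 : ℝ) ≤ ∑' x, C ^ (2 : ℝ) * ‖ξ (g x)‖ ^ (2 : ℝ) :=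
        (Summable.of_nonneg_of_le (fun x => by positivity) e hs').tsum_le_tsum e hs'
    _ = C ^ (2 : ℝ) * ∑' x, ‖ξ (g x)‖ ^ (2 : ℝ) := tsum_mul_left
    _ ≤ C ^ (2 : ℝ) * ∑' x, ‖ξ x‖ ^ (2 : ℝ) := by
        refine mul_le_mul_of_nonneg_left ?_ (by positivity)
        exact (hs.comp_injective hg).tsum_le_tsum_of_inj g hg (fun _ _ => by positivity)
          (fun x => le_rfl) hs
    _ = (C * ‖ξ‖) ^ (2 : ℝ) := by
        rw [Real.mul_rpow hC (norm_nonneg _)]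
        congr 1
        have := lp.norm_rpow_eq_tsum h0 ξ
        simp only [ENNReal.toReal_ofNat] at this
        exact this.symm

theorem shift_apply (k : Fin m) (ξ : H m) (x : Fin m → ℕ) :
    shift k ξ x = ξ (x + Pi.single k 1) := by
  simp [shift]

theorem qPow_apply (q : Set.Ico (0 : ℝ) 1) (k : Fin m) (ξ : H m) (x : Fin m → ℕ) :
    qPow q k ξ x = ((q : ℝ) : ℂ) ^ x k * ξ x := by
  simp [qPow]

theorem sqrtOp_apply (q : Set.Ico (0 : ℝ) 1) (k : Fin m) (ξ : H m) (x : Fin m → ℕ) :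
    sqrtOp q k ξ x = (√(1 - (q : ℝ) ^ (2 * x k)) : ℂ) * ξ x := by
  simp [sqrtOp]

theorem sub_single_add_single {x : Fin m → ℕ} {k : Fin m} (h : x k ≠ 0) :
    x - Pi.single k 1 + Pi.single k 1 = x := by
  funext l
  by_cases hl : l = k
  · subst hl; simp; omega
  · simp [hl]

theorem shift_ket (k : Fin m) (x : Fin m → ℕ) :
    shift k (ket x) = if x k = 0 then 0 else ket (x - Pi.single k 1) := by
  refine lp.ext (funext fun y => ?_)
  rw [shift_apply, ket_apply]
  split_ifs with h1 h2 h3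
  · exfalso
    rw [← h1] at h2
    simp at h2
  · rw [ket_apply, if_pos]
    rw [← h1]
    simp
  · rfl
  · rw [ket_apply, if_neg]
    rintro rfl
    exact h1 (sub_single_add_single h3)

theorem star_shift_apply (k : Fin m) (ξ : H m) (x : Fin m → ℕ) :
    star (shift k) ξ x = if x k = 0 then 0 else ξ (x - Pi.single k 1) := by
  rw [star_apply_eq_inner, shift_ket]
  split_ifs
  · exact inner_zero_left _
  · exact inner_ket _ _

theorem star_shift_ket (k : Fin m) (x : Fin m → ℕ) :
    star (shift k) (ket x) = ket (x + Pi.single k 1) := by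
  refine lp.ext (funext fun y => ?_)
  rw [star_shift_apply, ket_apply, ket_apply]
  by_cases h : y k = 0
  · rw [if_pos h, if_neg]
    rintro rfl
    simp at h
  · rw [if_neg h]
    refine if_congr ⟨fun e => ?_, fun e => ?_⟩ rfl rfl
    · rw [← e, sub_single_add_single h]
    · rw [e, add_tsub_cancel_right]

theorem star_eq_self_of_diagonal {A : Op m} {d : (Fin m → ℕ) → ℝ}
    (hA : ∀ ξ x, A ξ x = (d x : ℂ) * ξ x) : star A = A := by
  refine Op.ext_apply fun ξ x => ?_
  have : A (ket x) = (d x : ℂ) • ket x := lp.ext (funext fun y => by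
    rw [hA, lp.coeFn_smul, Pi.smul_apply, ket_apply]
    split_ifs with h <;> simp [h])
  rw [star_apply_eq_inner, this, inner_smul_left, inner_ket, hA]
  simp

theorem star_qPow (q : Set.Ico (0 : ℝ) 1) (k : Fin m) : star (qPow q k) = qPow q k :=
  star_eq_self_of_diagonal (d := fun x => (q : ℝ) ^ x k) fun ξ x => by
    rw [qPow_apply]; push_cast; rfl

theorem star_sqrtOp (q : Set.Ico (0 : ℝ) 1) (k : Fin m) : star (sqrtOp q k) = sqrtOp q k :=
  star_eq_self_of_diagonal (sqrtOp_apply q k)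

theorem shift_mul_star_shift (k : Fin m) : shift k * star (shift k) = 1 := by
  refine Op.ext_apply fun ξ x => ?_
  rw [mul_apply_eq_comp, shift_apply, star_shift_apply]
  simp

/-- The annihilation operator `S √(1 - q^{2N})` on the `k`-th tensor factor. -/
noncomputable def ann (q : Set.Ico (0 : ℝ) 1) (k : Fin m) : Op m := shift k * sqrtOp q k

theorem star_ann (q : Set.Ico (0 : ℝ) 1) (k : Fin m) :
    star (ann q k) = sqrtOp q k * star (shift k) := by
  rw [ann, star_mul, star_sqrtOp]

theorem ann_apply (q : Set.Ico (0 : ℝ) 1) (k : Fin m) (ξ : H m) (x : Fin m → ℕ) :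
    ann q k ξ x = (√(1 - (q : ℝ) ^ (2 * (x k + 1))) : ℂ) * ξ (x + Pi.single k 1) := by
  rw [ann, mul_apply_eq_comp, shift_apply, sqrtOp_apply]
  simp

theorem star_ann_apply (q : Set.Ico (0 : ℝ) 1) (k : Fin m) (ξ : H m) (x : Fin m → ℕ) :
    star (ann q k) ξ x =
      if x k = 0 then 0 else (√(1 - (q : ℝ) ^ (2 * x k)) : ℂ) * ξ (x - Pi.single k 1) := by
  rw [star_ann, mul_apply_eq_comp, sqrtOp_apply, star_shift_apply]
  split_ifs <;> simp

theorem ofReal_sqrt_mul_self {q : ℝ} (hq : q ∈ Set.Ico (0 : ℝ) 1) (j : ℕ) :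
    (√(1 - q ^ j) : ℂ) * √(1 - q ^ j) = 1 - (q : ℂ) ^ j := by
  rw [← Complex.ofReal_mul, Real.mul_self_sqrt]
  · push_cast; rfl
  · linarith [pow_le_one₀ (n := j) hq.1 hq.2.le]

theorem ann_mul_star_ann (q : Set.Ico (0 : ℝ) 1) (k : Fin m) :
    ann q k * star (ann q k) = 1 - (((q : ℝ) : ℂ) ^ 2) • (qPow q k * qPow q k) := by
  refine Op.ext_apply fun ξ x => ?_
  simp only [mul_apply_eq_comp, ann_apply, star_ann_apply, sub_apply,
    smul_apply, lp.coeFn_sub, lp.coeFn_smul, Pi.sub_apply, Pi.smul_apply,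
    qPow_apply, one_apply_eq_self, smul_eq_mul]
  simp only [Pi.add_apply, Pi.single_eq_same, Nat.add_eq_zero_iff, one_ne_zero, and_false,
    if_false, add_tsub_cancel_right]
  rw [← mul_assoc, ofReal_sqrt_mul_self q.2]
  ring

theorem star_ann_mul_ann (q : Set.Ico (0 : ℝ) 1) (k : Fin m) :
    star (ann q k) * ann q k = 1 - qPow q k * qPow q k := by
  refine Op.ext_apply fun ξ x => ?_
  simp only [mul_apply_eq_comp, ann_apply, star_ann_apply, sub_apply,
    lp.coeFn_sub, Pi.sub_apply, qPow_apply, one_apply_eq_self]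
  split_ifs with h
  · simp [h]
  · have e : x k - (Pi.single k 1 : Fin m → ℕ) k + 1 = x k := by simp; omega
    rw [sub_single_add_single h, e, ← mul_assoc, ofReal_sqrt_mul_self q.2]
    ring

theorem ann_mul_qPow (q : Set.Ico (0 : ℝ) 1) (k : Fin m) :
    ann q k * qPow q k = ((q : ℝ) : ℂ) • (qPow q k * ann q k) := by
  refine Op.ext_apply fun ξ x => ?_
  simp only [mul_apply_eq_comp, ann_apply, smul_apply,
    lp.coeFn_smul, Pi.smul_apply, qPow_apply, smul_eq_mul, Pi.add_apply, Pi.single_eq_same]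
  ring

theorem qPow_mul_star_ann (q : Set.Ico (0 : ℝ) 1) (k : Fin m) :
    qPow q k * star (ann q k) = ((q : ℝ) : ℂ) • (star (ann q k) * qPow q k) := by
  have := congrArg star (ann_mul_qPow q k)
  simpa [star_smul, star_mul, star_qPow] using this

section Commute

variable {k l : Fin m}

theorem add_single_sub_single (h : k ≠ l) (x : Fin m → ℕ) :
    x + Pi.single k 1 - Pi.single l 1 = x - Pi.single l 1 + Pi.single k 1 := by
  funext i
  by_cases hk : i = k
  · subst hk; simp [h]
  · simp [hk]

theorem commute_shift_shift : Commute (shift k) (shift l) :=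
  Op.ext_apply fun ξ x => by
    simp only [mul_apply_eq_comp, shift_apply]
    rw [add_right_comm]

theorem commute_shift_star_shift (h : k ≠ l) : Commute (shift k) (star (shift l)) :=
  Op.ext_apply fun ξ x => by
    simp only [mul_apply_eq_comp, shift_apply, star_shift_apply, Pi.add_apply,
      Pi.single_eq_of_ne h.symm, add_zero, add_single_sub_single h]

/-- A diagonal operator whose entries do not depend on the `k`-th coordinate commutes with the
shift of the `k`-th factor. -/
theorem commute_shift_of_diagonal {A : Op m} {d : (Fin m → ℕ) → ℂ}
    (hA : ∀ ξ x, A ξ x = d x * ξ x) (hd : ∀ x, d (x + Pi.single k 1) = d x) :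
    Commute (shift k) A :=
  Op.ext_apply fun ξ x => by
    simp only [mul_apply_eq_comp, shift_apply, hA, hd]

theorem commute_of_diagonal {A B : Op m} {d e : (Fin m → ℕ) → ℂ}
    (hA : ∀ ξ x, A ξ x = d x * ξ x) (hB : ∀ ξ x, B ξ x = e x * ξ x) : Commute A B :=
  Op.ext_apply fun ξ x => by
    simp only [mul_apply_eq_comp, hA, hB]
    ring

theorem commute_shift_qPow (q : Set.Ico (0 : ℝ) 1) (h : k ≠ l) : Commute (shift k) (qPow q l) :=
  commute_shift_of_diagonal (qPow_apply q l) fun x => by simp [h.symm]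

theorem commute_shift_sqrtOp (q : Set.Ico (0 : ℝ) 1) (h : k ≠ l) :
    Commute (shift k) (sqrtOp q l) :=
  commute_shift_of_diagonal (sqrtOp_apply q l) fun x => by simp [h.symm]

/-- An operator that commutes with the shift of the `k`-th factor, its adjoint, and the two diagonal
operators on the `k`-th factor. -/
structure CommuteFactor (q : Set.Ico (0 : ℝ) 1) (k : Fin m) (A : Op m) : Prop where
  shift : Commute (shift k) A
  star_shift : Commute (star (QSU.shift k)) A
  sqrtOp : Commute (sqrtOp q k) A
  qPow : Commute (qPow q k) A

theorem commuteFactor_shift (q : Set.Ico (0 : ℝ) 1) (h : k ≠ l) :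
    CommuteFactor q k (shift l) where
  shift := commute_shift_shift
  star_shift := (commute_shift_star_shift h.symm).symm
  sqrtOp := (commute_shift_sqrtOp q h.symm).symm
  qPow := (commute_shift_qPow q h.symm).symm

theorem CommuteFactor.star {q : Set.Ico (0 : ℝ) 1} {A : Op m} (h : CommuteFactor q k A) :
    CommuteFactor q k (star A) where
  shift := by simpa using h.star_shift.star_star
  star_shift := h.shift.star_star
  sqrtOp := by simpa [star_sqrtOp] using h.sqrtOp.star_star
  qPow := by simpa [star_qPow] using h.qPow.star_star

theorem commuteFactor_sqrtOp (q : Set.Ico (0 : ℝ) 1) (h : k ≠ l) :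
    CommuteFactor q k (sqrtOp q l) where
  shift := commute_shift_sqrtOp q h
  star_shift := by simpa [star_sqrtOp] using (commute_shift_sqrtOp q h).star_star
  sqrtOp := commute_of_diagonal (sqrtOp_apply q k) (sqrtOp_apply q l)
  qPow := commute_of_diagonal (qPow_apply q k) (sqrtOp_apply q l)

theorem commuteFactor_qPow (q : Set.Ico (0 : ℝ) 1) (h : k ≠ l) :
    CommuteFactor q k (qPow q l) where
  shift := commute_shift_qPow q h
  star_shift := by simpa [star_qPow] using (commute_shift_qPow q h).star_star
  sqrtOp := commute_of_diagonal (sqrtOp_apply q k) (qPow_apply q l)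
  qPow := commute_of_diagonal (qPow_apply q k) (qPow_apply q l)

theorem CommuteFactor.simpleEntry {n : ℕ} {q : Set.Ico (0 : ℝ) 1} {A : Op m}
    (h : CommuteFactor q k A) (r : Fin n) (i j : Fin (n + 1)) :
    Commute (simpleEntry q r k i j) A := by
  unfold QSU.simpleEntry
  have h1 := h.shift
  have h2 := h.star_shift
  have h3 := h.sqrtOp
  have h4 := h.qPow
  split_ifs
  · exact h1
  · exact h1.mul_left h3
  · exact h2
  · exact h3.mul_left h2
  · exact (Commute.one_left A).sub_left (h2.mul_left h1)
  · exact h4.smul_left _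
  · exact (Commute.one_left A).sub_left (h2.mul_left h1)
  · exact h4
  · exact Commute.one_left A
  · exact Commute.zero_left A

theorem commuteFactor_simpleEntry {n : ℕ} (q : Set.Ico (0 : ℝ) 1) (h : k ≠ l) (r : Fin n)
    (i j : Fin (n + 1)) : CommuteFactor q k (simpleEntry q r l i j) where
  shift := ((commuteFactor_shift q h.symm).simpleEntry r i j).symm
  star_shift := ((commuteFactor_shift q h.symm).star.simpleEntry r i j).symm
  sqrtOp := ((commuteFactor_sqrtOp q h.symm).simpleEntry r i j).symm
  qPow := ((commuteFactor_qPow q h.symm).simpleEntry r i j).symm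

end Commute

end Operators

end QSU

namespace QSU

/-! ### The quantum matrix relations -/

section Relations

variable {B : Type*} [Ring B] [Algebra ℂ B]

/-- The commutation relations of quantum matrices, written uniformly as `R̂ (z ⊗ z) = (z ⊗ z) R̂` for
the Hecke form `R̂` of the `R`-matrix of type `A`; the entry at rows `i, k` and columns `j, l`. -/
def FRT {N : ℕ} (q : ℂ) (z : Matrix (Fin N) (Fin N) B) : Prop :=
  ∀ i k j l,
    (if i = k then q else 1) • (z k j * z i l) + (if i < k then q - q⁻¹ else 0) • (z i j * z k l) =
    (if j = l then q else 1) • (z i l * z k j) + (if j < l then q - q⁻¹ else 0) • (z i j * z k l)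

/-- The relations are preserved by the convolution product, since `R̂` acts on the middle index. -/
theorem FRT.mul {N : ℕ} {q : ℂ} {x y : Matrix (Fin N) (Fin N) B} (hx : FRT q x) (hy : FRT q y)
    (hc : ∀ i j k l, Commute (x i j) (y k l)) : FRT q (x * y) := by
  intro i k j l
  have e : ∀ i k j l, (x * y) i j * (x * y) k l =
      ∑ a, ∑ b, x i a * x k b * (y a j * y b l) := by
    intro i k j l
    rw [Matrix.mul_apply, Matrix.mul_apply, Finset.sum_mul_sum]
    refine Finset.sum_congr rfl fun a _ => Finset.sum_congr rfl fun b _ => ?_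
    rw [mul_assoc, mul_assoc, ← mul_assoc (y a j), ← (hc k b a j).eq, mul_assoc]
  calc _ = ∑ a, ∑ b, ((if i = k then q else 1) • (x k a * x i b) +
        (if i < k then q - q⁻¹ else 0) • (x i a * x k b)) * (y a j * y b l) := by
        rw [e k i j l, e i k j l]
        simp only [Finset.smul_sum, ← Finset.sum_add_distrib, add_mul, smul_mul_assoc]
    _ = ∑ a, ∑ b, ((if a = b then q else 1) • (x i b * x k a) +
        (if a < b then q - q⁻¹ else 0) • (x i a * x k b)) * (y a j * y b l) :=
        Finset.sum_congr rfl fun a _ => Finset.sum_congr rfl fun b _ => by rw [hx i k a b]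
    _ = ∑ a, ∑ b, x i a * x k b * ((if a = b then q else 1) • (y b j * y a l) +
        (if a < b then q - q⁻¹ else 0) • (y a j * y b l)) := by
        simp only [add_mul, mul_add, Finset.sum_add_distrib]
        congr 1
        · rw [Finset.sum_comm]
          refine Finset.sum_congr rfl fun a _ => Finset.sum_congr rfl fun b _ => ?_
          simp only [smul_mul_assoc, mul_smul_comm, eq_comm]
        · simp only [smul_mul_assoc, mul_smul_comm]
    _ = ∑ a, ∑ b, x i a * x k b * ((if j = l then q else 1) • (y a l * y b j) +
        (if j < l then q - q⁻¹ else 0) • (y a j * y b l)) :=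
        Finset.sum_congr rfl fun a _ => Finset.sum_congr rfl fun b _ => by rw [hy a b j l]
    _ = _ := by
        rw [e i k l j, e i k j l]
        simp only [Finset.smul_sum, ← Finset.sum_add_distrib, mul_add, mul_smul_comm]

theorem FRT.row {N : ℕ} {q : ℂ} {z : Matrix (Fin N) (Fin N) B} (h : FRT q z)
    (i : Fin N) {j l : Fin N} (hjl : j < l) : z i j * z i l = q • (z i l * z i j) := by
  have := h i i l j
  simp only [if_true, lt_irrefl, if_false, hjl.ne', hjl.not_gt, zero_smul, add_zero,
    one_smul] at this
  exact this.symm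

theorem FRT.col {N : ℕ} {q : ℂ} {z : Matrix (Fin N) (Fin N) B} (h : FRT q z)
    {i k : Fin N} (hik : i < k) (j : Fin N) : z i j * z k j = q • (z k j * z i j) := by
  have := h k i j j
  simp only [if_true, lt_irrefl, if_false, hik.ne', hik.not_gt, zero_smul, add_zero,
    one_smul] at this
  exact this

theorem FRT.anti {N : ℕ} {q : ℂ} {z : Matrix (Fin N) (Fin N) B} (h : FRT q z)
    {i k j l : Fin N} (hik : i < k) (hjl : j < l) : z i l * z k j = z k j * z i l := by
  have := h i k j l
  simp only [hik, hjl, hik.ne, hjl.ne, if_true, if_false, one_smul] at this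
  exact (add_right_cancel this).symm

theorem FRT.diag {N : ℕ} {q : ℂ} {z : Matrix (Fin N) (Fin N) B} (h : FRT q z)
    {i k j l : Fin N} (hik : i < k) (hjl : j < l) :
    z i j * z k l - z k l * z i j = (q - q⁻¹) • (z i l * z k j) := by
  have := h i k l j
  simp only [hik, hjl.not_gt, hik.ne, hjl.ne', if_true, if_false, one_smul, zero_smul,
    add_zero] at this
  rw [← this]
  abel

/-- The number of inversions of a sequence. -/
def invCount {p N : ℕ} (f : Fin p → Fin N) : ℕ :=
  (Finset.univ.filter fun x : Fin p × Fin p => x.1 < x.2 ∧ f x.2 < f x.1).card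

theorem sum_cons {p : ℕ} {ι M : Type*} [Fintype ι] [AddCommMonoid M] (f : (Fin (p + 1) → ι) → M) :
    ∑ k, f k = ∑ a, ∑ k : Fin p → ι, f (Fin.cons a k) := by
  rw [← (Fin.consEquiv fun _ => ι).sum_comp, Fintype.sum_prod_type]
  rfl

omit [Algebra ℂ B] in
theorem commute_prod_ofFn {p : ℕ} {a : B} {y : Fin p → B} (h : ∀ m, Commute a (y m)) :
    Commute a (List.ofFn y).prod :=
  Commute.list_prod_right _ _ fun b hb => by
    obtain ⟨m, rfl⟩ := (List.mem_ofFn' _ _).1 hb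
    exact h m

omit [Algebra ℂ B] in
theorem prod_ofFn_matrix_mul {p N : ℕ} {x y : Matrix (Fin N) (Fin N) B}
    (hc : ∀ i j k l, Commute (x i j) (y k l)) (j k : Fin p → Fin N) :
    (List.ofFn fun m => (x * y) (j m) (k m)).prod =
      ∑ l : Fin p → Fin N,
        (List.ofFn fun m => x (j m) (l m)).prod * (List.ofFn fun m => y (l m) (k m)).prod := by
  induction p with
  | zero => simp
  | succ p ih =>
    rw [List.ofFn_succ, List.prod_cons, ih, sum_cons, Matrix.mul_apply, Finset.sum_mul_sum]
    refine Finset.sum_congr rfl fun a _ => Finset.sum_congr rfl fun l _ => ?_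
    simp only [List.ofFn_succ, List.prod_cons, Fin.cons_zero, Fin.cons_succ]
    have : Commute (y a (k 0)) (List.ofFn fun m : Fin p => x (j m.succ) (l m)).prod :=
      commute_prod_ofFn fun m => (hc _ _ _ _).symm
    simp only [mul_assoc]
    rw [← mul_assoc (y a (k 0)), this.eq, mul_assoc]

omit [Algebra ℂ B] in
open Matrix in
theorem row_iff [StarRing B] {N : ℕ} {z : Matrix (Fin N) (Fin N) B} :
    (∀ i j, ∑ k, z i k * star (z j k) = if i = j then 1 else 0) ↔ z * zᴴ = 1 := by
  simp [← Matrix.ext_iff, Matrix.mul_apply, Matrix.one_apply]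

omit [Algebra ℂ B] in
open Matrix in
theorem col_iff [StarRing B] {N : ℕ} {z : Matrix (Fin N) (Fin N) B} :
    (∀ i j, ∑ k, star (z k i) * z k j = if i = j then 1 else 0) ↔ zᴴ * z = 1 := by
  simp [← Matrix.ext_iff, Matrix.mul_apply, Matrix.one_apply]

open Matrix in
/-- The convolution product of two representations with commuting images is a representation. -/
theorem QuantumRel.mul [StarRing B] {n : ℕ} {q : ℝ}
    {x y : Matrix (Fin (n + 1)) (Fin (n + 1)) B} (hx : QuantumRel q x) (hy : QuantumRel q y)
    (hc : ∀ i j k l, Commute (x i j) (y k l)) : QuantumRel q (x * y : Matrix _ _ B) where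
  row := row_iff.2 (by
    rw [Matrix.conjTranspose_mul, Matrix.mul_assoc, ← Matrix.mul_assoc y, row_iff.1 hy.row,
      Matrix.one_mul, row_iff.1 hx.row])
  col := col_iff.2 (by
    rw [Matrix.conjTranspose_mul, Matrix.mul_assoc, ← Matrix.mul_assoc xᴴ, col_iff.1 hx.col,
      Matrix.one_mul, col_iff.1 hy.col])
  det j := by
    simp only [prod_ofFn_matrix_mul hc, Finset.smul_sum]
    rw [Finset.sum_comm, ← hx.det j]
    refine Finset.sum_congr rfl fun l _ => ?_
    have := congrArg (fun t => (List.ofFn fun m => x (j m) (l m)).prod * t) (hy.det l)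
    simp only [Finset.mul_sum, mul_smul_comm, mul_one] at this
    rw [← this]

end Relations

end QSU

namespace QSU

section Adjoint

variable {B : Type*} [Ring B] [Algebra ℂ B]

theorem invCount_eq_sum {p N : ℕ} (f : Fin p → Fin N) :
    invCount f = ∑ x, ∑ y, if x < y ∧ f y < f x then 1 else 0 := by
  rw [invCount, Finset.card_filter, Fintype.sum_prod_type]

theorem invCount_cons {p N : ℕ} (a : Fin N) (f : Fin p → Fin N) :
    invCount (Fin.cons a f : Fin (p + 1) → Fin N) =
      (Finset.univ.filter fun m => f m < a).card + invCount f := by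
  rw [invCount_eq_sum, invCount_eq_sum, Fin.sum_univ_succ, Finset.card_filter]
  congr 1
  · rw [Fin.sum_univ_succ]
    simp
  · refine Finset.sum_congr rfl fun x _ => ?_
    rw [Fin.sum_univ_succ]
    simp

theorem invCount_strictMono_comp {p N M : ℕ} {g : Fin N → Fin M} (hg : StrictMono g)
    (f : Fin p → Fin N) : invCount (g ∘ f) = invCount f := by
  simp only [invCount, Function.comp_apply, hg.lt_iff_lt]

theorem invCount_strictMono {p N : ℕ} {f : Fin p → Fin N} (hf : StrictMono f) :
    invCount f = 0 := by
  rw [invCount, Finset.card_eq_zero, Finset.filter_eq_empty_iff]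
  rintro ⟨x, y⟩ - ⟨h1, h2⟩
  exact (hf h1).not_gt h2

theorem strictMono_of_invCount_eq_zero {p N : ℕ} {f : Fin p → Fin N}
    (hf : Function.Injective f) (h : invCount f = 0) : StrictMono f := by
  intro x y hxy
  rw [invCount, Finset.card_eq_zero, Finset.filter_eq_empty_iff] at h
  have := @h (x, y) (Finset.mem_univ _)
  simp only [not_and, not_lt] at this
  exact lt_of_le_of_ne (this hxy) (fun e => hxy.ne (hf e))

theorem invCount_cons_succAbove {n : ℕ} (s : Fin (n + 1)) (σ : Equiv.Perm (Fin n)) :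
    invCount (Fin.cons s (s.succAbove ∘ σ) : Fin (n + 1) → Fin (n + 1)) =
      s + invCount σ := by
  rw [invCount_cons, invCount_strictMono_comp (Fin.strictMono_succAbove s)]
  congr 1
  have h1 : ∀ m : Fin n, (s.succAbove m < s) ↔ (m : ℕ) < s := fun m => by
    rw [Fin.succAbove_lt_iff_castSucc_lt, Fin.lt_def]; rfl
  simp only [Function.comp_apply, h1]
  rw [Finset.card_filter, Equiv.sum_comp σ fun m => if (m : ℕ) < s then 1 else 0,
    ← Finset.card_filter, Fin.card_filter_val_lt]
  omega

theorem qTensor_of_injective {N : ℕ} (q : ℝ) {j : Fin N → Fin N} (h : Function.Injective j) :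
    qTensor q j = (-q) ^ invCount j := if_pos h

theorem qTensor_of_not_injective {N : ℕ} (q : ℝ) {j : Fin N → Fin N}
    (h : ¬Function.Injective j) : qTensor q j = 0 := if_neg h

theorem cons_succAbove_injective {n : ℕ} (s : Fin (n + 1)) (σ : Equiv.Perm (Fin n)) :
    Function.Injective (Fin.cons s (s.succAbove ∘ σ) : Fin (n + 1) → Fin (n + 1)) := by
  rw [Fin.cons_injective_iff]
  refine ⟨?_, (Fin.succAbove_right_injective).comp σ.injective⟩
  rintro ⟨m, hm⟩
  exact Fin.succAbove_ne s _ hm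

theorem exists_eq_succAbove_comp {n : ℕ} {s : Fin (n + 1)} {k : Fin n → Fin (n + 1)}
    (h : Function.Injective (Fin.cons s k : Fin (n + 1) → Fin (n + 1))) :
    ∃ σ : Equiv.Perm (Fin n), s.succAbove ∘ σ = k := by
  rw [Fin.cons_injective_iff] at h
  have : ∀ m, ∃ y, s.succAbove y = k m := fun m =>
    Fin.exists_succAbove_eq fun e => h.1 ⟨m, e⟩
  choose f hf using this
  have hinj : Function.Injective f := fun a b e => h.2 (by rw [← hf, ← hf, e])
  exact ⟨Equiv.ofBijective f (Finite.injective_iff_bijective.1 hinj), funext hf⟩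

/-- In `A_q(n)`, `q ≠ 0`, the adjoint of a generator is, up to a power of `-q`, a quantum minor.
This results from the determinant relation at `(a, ρ_1, …, ρ_n)` after multiplication by
`(z_{a,s})^*` and summation over `a`. -/
theorem QuantumRel.adj [StarRing B] {n : ℕ} {q : ℝ} {z : Fin (n + 1) → Fin (n + 1) → B}
    (h : QuantumRel q z) (r s : Fin (n + 1)) :
    (-(q : ℂ)) ^ (r : ℕ) • star (z r s) = (-(q : ℂ)) ^ (s : ℕ) •
      ∑ σ : Equiv.Perm (Fin n), (-(q : ℂ)) ^ invCount σ •
        (List.ofFn fun m => z (r.succAbove m) (s.succAbove (σ m))).prod := by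
  -- The determinant relation for the rows `a, r.succAbove 0, …` is multiplied by `star (z a s)` and
  -- summed over `a`: on the right only `a = r` survives, on the left unitarity leaves the terms
  -- whose first column is `s`.
  have h1 : ∑ a, star (z a s) * ∑ k : Fin (n + 1) → Fin (n + 1), (qTensor q k : ℂ) •
      (List.ofFn fun m => z ((Fin.cons a r.succAbove : Fin (n + 1) → Fin (n + 1)) m) (k m)).prod =
      ∑ a, star (z a s) *
        ((qTensor q (Fin.cons a r.succAbove : Fin (n + 1) → Fin (n + 1)) : ℂ) • 1) :=
    Finset.sum_congr rfl fun a _ => by rw [h.det]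
  have h2 : ∑ a, star (z a s) *
        ((qTensor q (Fin.cons a r.succAbove : Fin (n + 1) → Fin (n + 1)) : ℂ) • (1 : B)) =
      (-(q : ℂ)) ^ (r : ℕ) • star (z r s) := by
    rw [Finset.sum_eq_single r]
    · have h3 := cons_succAbove_injective r 1
      have h4 := invCount_cons_succAbove r 1
      rw [Equiv.Perm.coe_one, Function.comp_id] at h3 h4
      rw [qTensor_of_injective q h3, h4, mul_smul_comm, mul_one,
        invCount_strictMono (f := id) strictMono_id]
      push_cast
      rfl
    · intro a _ ha
      obtain ⟨m, rfl⟩ := Fin.exists_succAbove_eq ha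
      rw [qTensor_of_not_injective]
      · simp
      · rw [Fin.cons_injective_iff]
        exact fun e => e.1 ⟨m, rfl⟩
    · simp
  rw [← h2, ← h1]
  have h3 : ∀ (b : Fin (n + 1)) (k : Fin n → Fin (n + 1)), ∑ a, star (z a s) *
      ((qTensor q (Fin.cons b k : Fin (n + 1) → Fin (n + 1)) : ℂ) • (z a b *
        (List.ofFn fun m => z (r.succAbove m) (k m)).prod)) =
      (qTensor q (Fin.cons b k : Fin (n + 1) → Fin (n + 1)) : ℂ) • ((if s = b then 1 else 0) *
        (List.ofFn fun m => z (r.succAbove m) (k m)).prod) := fun b k => by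
    rw [← h.col, Finset.sum_mul, Finset.smul_sum]
    refine Finset.sum_congr rfl fun a _ => ?_
    rw [mul_smul_comm, mul_assoc]
  simp only [Finset.mul_sum]
  rw [Finset.sum_comm, sum_cons]
  simp only [List.ofFn_succ, List.prod_cons, Fin.cons_zero, Fin.cons_succ, h3]
  rw [Finset.sum_eq_single s (fun b _ hb => by simp [hb.symm]) (by simp), Finset.smul_sum]
  refine (Fintype.sum_of_injective (fun σ : Equiv.Perm (Fin n) => s.succAbove ∘ σ)
    ?_ _ _ ?_ ?_).symm
  · intro σ τ e
    exact Equiv.ext fun m => Fin.succAbove_right_injective (congrFun e m)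
  · intro k hk
    rw [qTensor_of_not_injective, Complex.ofReal_zero, zero_smul]
    exact fun e => hk (exists_eq_succAbove_comp e)
  · intro σ
    rw [qTensor_of_injective q (cons_succAbove_injective s σ), invCount_cons_succAbove, smul_smul,
      ← pow_add, if_pos rfl, one_mul]
    push_cast
    rfl

end Adjoint

/-! ### The elementary representations for nonzero `q` -/

section Block

variable {B : Type*} [Ring B] [Algebra ℂ B] {n : ℕ}

/-- The matrix that is the identity apart from the block `!![a, b; c, d]` in the rows and columns
`r, r + 1`. -/
def blockMat (r : Fin n) (a b c d : B) : Matrix (Fin (n + 1)) (Fin (n + 1)) B := fun i j =>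
  if i = r.castSucc ∧ j = r.castSucc then a
  else if i = r.succ ∧ j = r.succ then d
  else if i = r.castSucc ∧ j = r.succ then b
  else if i = r.succ ∧ j = r.castSucc then c
  else if i = j then 1 else 0

variable {r : Fin n} {a b c d : B}

theorem castSucc_ne_succ (r : Fin n) : r.castSucc ≠ r.succ := Fin.castSucc_lt_succ.ne

omit [Algebra ℂ B] in
theorem blockMat_00 : blockMat r a b c d r.castSucc r.castSucc = a := by simp [blockMat]
omit [Algebra ℂ B] in
theorem blockMat_11 : blockMat r a b c d r.succ r.succ = d := by
  simp [blockMat, (castSucc_ne_succ r).symm]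
omit [Algebra ℂ B] in
theorem blockMat_01 : blockMat r a b c d r.castSucc r.succ = b := by
  simp [blockMat, castSucc_ne_succ r, (castSucc_ne_succ r).symm]
omit [Algebra ℂ B] in
theorem blockMat_10 : blockMat r a b c d r.succ r.castSucc = c := by
  simp [blockMat, castSucc_ne_succ r, (castSucc_ne_succ r).symm]

omit [Algebra ℂ B] in
theorem blockMat_left {i : Fin (n + 1)} (h0 : i ≠ r.castSucc) (h1 : i ≠ r.succ)
    (j : Fin (n + 1)) : blockMat r a b c d i j = if i = j then 1 else 0 := by
  simp [blockMat, h0, h1]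

omit [Algebra ℂ B] in
theorem blockMat_right {j : Fin (n + 1)} (h0 : j ≠ r.castSucc) (h1 : j ≠ r.succ)
    (i : Fin (n + 1)) : blockMat r a b c d i j = if i = j then 1 else 0 := by
  simp [blockMat, h0, h1]

omit [Algebra ℂ B] in
/-- A nonzero off-diagonal entry of `blockMat` has both indices in the block. -/
theorem blockMat_eq_zero_or {k j : Fin (n + 1)} : blockMat r a b c d k j = 0 ∨ k = j ∨
    ((k = r.castSucc ∨ k = r.succ) ∧ (j = r.castSucc ∨ j = r.succ)) := by
  by_cases h : k = j
  · exact Or.inr (Or.inl h)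
  by_cases hk0 : k = r.castSucc
  · by_cases hj : j = r.castSucc ∨ j = r.succ
    · exact Or.inr (Or.inr ⟨Or.inl hk0, hj⟩)
    · push Not at hj
      exact Or.inl (by rw [blockMat_right hj.1 hj.2, if_neg h])
  by_cases hk1 : k = r.succ
  · by_cases hj : j = r.castSucc ∨ j = r.succ
    · exact Or.inr (Or.inr ⟨Or.inr hk1, hj⟩)
    · push Not at hj
      exact Or.inl (by rw [blockMat_right hj.1 hj.2, if_neg h])
  exact Or.inl (by rw [blockMat_left hk0 hk1, if_neg h])

omit [Algebra ℂ B] in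
/-- Indices outside of the block do not separate the two indices of the block. -/
theorem blockMat_separate {i k j : Fin (n + 1)} (h0 : i ≠ r.castSucc) (h1 : i ≠ r.succ) :
    blockMat r a b c d k j = 0 ∨ ((i = k ↔ i = j) ∧ (i < k ↔ i < j) ∧ (k < i ↔ j < i)) := by
  rcases blockMat_eq_zero_or (r := r) (a := a) (b := b) (c := c) (d := d) (k := k) (j := j) with
    h | h | ⟨hk, hj⟩
  · exact Or.inl h
  · subst h; exact Or.inr ⟨Iff.rfl, Iff.rfl, Iff.rfl⟩
  · right
    simp only [Fin.ext_iff, Fin.lt_def, Fin.val_castSucc, Fin.val_succ, ne_eq] at *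
    omega

theorem blockMat_sep_eq {x k j : Fin (n + 1)} (h : x ≠ r.castSucc ∧ x ≠ r.succ) (q : ℂ) :
    (if x = k then q else 1) • blockMat r a b c d k j =
      (if x = j then q else 1) • blockMat r a b c d k j := by
  rcases blockMat_separate (a := a) (b := b) (c := c) (d := d) (k := k) (j := j) h.1 h.2 with
    e | e
  · rw [e, smul_zero, smul_zero]
  · rw [if_congr e.1 rfl rfl]

theorem blockMat_sep_lt {x k j : Fin (n + 1)} (h : x ≠ r.castSucc ∧ x ≠ r.succ) (q : ℂ) :
    (if x < k then q else 0) • blockMat r a b c d k j =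
      (if x < j then q else 0) • blockMat r a b c d k j := by
  rcases blockMat_separate (a := a) (b := b) (c := c) (d := d) (k := k) (j := j) h.1 h.2 with
    e | e
  · rw [e, smul_zero, smul_zero]
  · rw [if_congr e.2.1 rfl rfl]

theorem blockMat_sep_gt {x k j : Fin (n + 1)} (h : x ≠ r.castSucc ∧ x ≠ r.succ) (q : ℂ) :
    (if k < x then q else 0) • blockMat r a b c d k j =
      (if j < x then q else 0) • blockMat r a b c d k j := by
  rcases blockMat_separate (a := a) (b := b) (c := c) (d := d) (k := k) (j := j) h.1 h.2 with
    e | e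
  · rw [e, smul_zero, smul_zero]
  · rw [if_congr e.2.2 rfl rfl]

/-- The entries in a `2 × 2` block have to satisfy the relations of quantum `2 × 2` matrices;
all relations that involve an index outside of the block hold trivially. -/
theorem FRT.blockMat {q : ℂ} (hq : q ≠ 0) (hab : a * b = q • (b * a)) (hac : a * c = q • (c * a))
    (hbc : b * c = c * b) (hbd : b * d = q • (d * b)) (hcd : c * d = q • (d * c))
    (had : a * d - d * a = (q - q⁻¹) • (b * c)) : FRT q (blockMat r a b c d) := by
  intro i k j l
  -- If one of the four indices lies outside of the block, both sides agree term by term.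
  by_cases hi : i ≠ r.castSucc ∧ i ≠ r.succ
  · rw [blockMat_left hi.1 hi.2 l, blockMat_left hi.1 hi.2 j]
    congr 1
    · by_cases h : i = l
      · rw [if_pos h, mul_one, one_mul, blockMat_sep_eq hi, ← h, if_congr (eq_comm) rfl rfl]
      · rw [if_neg h, mul_zero, zero_mul, smul_zero, smul_zero]
    · by_cases h : i = j
      · rw [if_pos h, one_mul, blockMat_sep_lt hi, ← h]
      · rw [if_neg h, zero_mul, smul_zero, smul_zero]
  by_cases hk : k ≠ r.castSucc ∧ k ≠ r.succ
  · rw [blockMat_left hk.1 hk.2 l, blockMat_left hk.1 hk.2 j]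
    congr 1
    · by_cases h : k = j
      · rw [if_pos h, mul_one, one_mul, if_congr (eq_comm) rfl rfl, blockMat_sep_eq hk, ← h]
      · rw [if_neg h, mul_zero, zero_mul, smul_zero, smul_zero]
    · by_cases h : k = l
      · rw [if_pos h, mul_one, blockMat_sep_gt hk, ← h]
      · rw [if_neg h, mul_zero, smul_zero, smul_zero]
  by_cases hj : j ≠ r.castSucc ∧ j ≠ r.succ
  · rw [blockMat_right hj.1 hj.2 i, blockMat_right hj.1 hj.2 k]
    congr 1
    · by_cases h : k = j
      · rw [if_pos h, mul_one, one_mul, h, if_congr (eq_comm) rfl rfl, blockMat_sep_eq hj]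
      · rw [if_neg h, mul_zero, zero_mul, smul_zero, smul_zero]
    · by_cases h : i = j
      · rw [if_pos h, one_mul, h, blockMat_sep_lt hj]
      · rw [if_neg h, zero_mul, smul_zero, smul_zero]
  by_cases hl : l ≠ r.castSucc ∧ l ≠ r.succ
  · rw [blockMat_right hl.1 hl.2 i, blockMat_right hl.1 hl.2 k]
    congr 1
    · by_cases h : i = l
      · rw [if_pos h, mul_one, one_mul, h, blockMat_sep_eq hl, if_congr (eq_comm) rfl rfl]
      · rw [if_neg h, mul_zero, zero_mul, smul_zero, smul_zero]
    · by_cases h : k = l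
      · rw [if_pos h, mul_one, h, blockMat_sep_gt hl]
      · rw [if_neg h, mul_zero, smul_zero, smul_zero]
  have h01 := castSucc_ne_succ r
  have hlt : r.castSucc < r.succ := Fin.castSucc_lt_succ
  have had' : d * a + (q - q⁻¹) • (c * b) = a * d := by rw [← hbc, ← had]; abel
  have hinv : ∀ {s t : B}, s = q • t → t + (q - q⁻¹) • s = q • s := by
    intro s t h
    rw [h, smul_smul, smul_smul, sub_mul, inv_mul_cancel₀ hq, sub_smul, one_smul]
    abel
  have key : ∀ x : Fin (n + 1), ¬(x ≠ r.castSucc ∧ x ≠ r.succ) → x = r.castSucc ∨ x = r.succ :=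
    fun x h => by tauto
  rcases key i hi with rfl | rfl <;> rcases key k hk with rfl | rfl <;>
  rcases key j hj with rfl | rfl <;> rcases key l hl with rfl | rfl <;>
  simp only [blockMat_00, blockMat_01, blockMat_10, blockMat_11, h01, h01.symm, hlt, hlt.not_gt,
    lt_irrefl, if_true, if_false, one_smul, zero_smul, add_zero, hbc]
  all_goals first
    | exact hab.symm
    | exact hab
    | exact hac
    | exact hac.symm
    | exact hbd
    | exact hbd.symm
    | exact hcd
    | exact hcd.symm
    | exact hinv hac
    | exact (hinv hab).symm
    | exact hinv hbd
    | exact (hinv hcd).symm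
    | exact had'
    | exact had'.symm

omit [Algebra ℂ B] in
theorem sum_blockMat_mul_castSucc (w : Fin (n + 1) → B) :
    ∑ k, blockMat r a b c d r.castSucc k * w k = a * w r.castSucc + b * w r.succ := by
  rw [Fintype.sum_eq_add _ _ (castSucc_ne_succ r), blockMat_00, blockMat_01]
  rintro k ⟨h0, h1⟩
  rw [blockMat_right h0 h1, if_neg h0.symm, zero_mul]

omit [Algebra ℂ B] in
theorem sum_blockMat_mul_succ (w : Fin (n + 1) → B) :
    ∑ k, blockMat r a b c d r.succ k * w k = c * w r.castSucc + d * w r.succ := by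
  rw [Fintype.sum_eq_add _ _ (castSucc_ne_succ r), blockMat_10, blockMat_11]
  rintro k ⟨h0, h1⟩
  rw [blockMat_right h0 h1, if_neg h1.symm, zero_mul]

omit [Algebra ℂ B] in
theorem sum_blockMat_mul_other {i : Fin (n + 1)} (h0 : i ≠ r.castSucc) (h1 : i ≠ r.succ)
    (w : Fin (n + 1) → B) : ∑ k, blockMat r a b c d i k * w k = w i := by
  simp [blockMat_left h0 h1]

omit [Algebra ℂ B] in
theorem blockMat_mul {a' b' c' d' : B} :
    blockMat r a b c d * blockMat r a' b' c' d' =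
      blockMat r (a * a' + b * c') (a * b' + b * d') (c * a' + d * c') (c * b' + d * d') := by
  ext i j
  rw [Matrix.mul_apply]
  by_cases hi0 : i = r.castSucc
  · rw [hi0, sum_blockMat_mul_castSucc]
    by_cases hj0 : j = r.castSucc
    · rw [hj0, blockMat_00, blockMat_00, blockMat_10]
    by_cases hj1 : j = r.succ
    · rw [hj1, blockMat_01, blockMat_01, blockMat_11]
    · rw [blockMat_right hj0 hj1, blockMat_right hj0 hj1, blockMat_right hj0 hj1,
        if_neg (Ne.symm hj0), if_neg (Ne.symm hj1), mul_zero, mul_zero, zero_add]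
  by_cases hi1 : i = r.succ
  · rw [hi1, sum_blockMat_mul_succ]
    by_cases hj0 : j = r.castSucc
    · rw [hj0, blockMat_00, blockMat_10, blockMat_10]
    by_cases hj1 : j = r.succ
    · rw [hj1, blockMat_01, blockMat_11, blockMat_11]
    · rw [blockMat_right hj0 hj1, blockMat_right hj0 hj1, blockMat_right hj0 hj1,
        if_neg (Ne.symm hj0), if_neg (Ne.symm hj1), mul_zero, mul_zero, zero_add]
  rw [sum_blockMat_mul_other hi0 hi1, blockMat_left hi0 hi1, blockMat_left hi0 hi1]

omit [Algebra ℂ B] in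
theorem blockMat_one : blockMat r (1 : B) 0 0 1 = 1 := by
  ext i j
  unfold blockMat
  split_ifs with h1 h2 h3 h4 h5
  · rw [h1.1, h1.2, Matrix.one_apply_eq]
  · rw [h2.1, h2.2, Matrix.one_apply_eq]
  · rw [h3.1, h3.2, Matrix.one_apply_ne (castSucc_ne_succ r)]
  · rw [h4.1, h4.2, Matrix.one_apply_ne (castSucc_ne_succ r).symm]
  · rw [h5, Matrix.one_apply_eq]
  · rw [Matrix.one_apply_ne h5]

omit [Algebra ℂ B] in
open Matrix in
theorem blockMat_conjTranspose [StarRing B] :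
    (blockMat r a b c d)ᴴ = blockMat r (star a) (star c) (star b) (star d) := by
  have h01 := castSucc_ne_succ r
  ext i j
  rw [conjTranspose_apply]
  by_cases hj : j ≠ r.castSucc ∧ j ≠ r.succ
  · rw [blockMat_left hj.1 hj.2, blockMat_right hj.1 hj.2, apply_ite star, star_one, star_zero,
      if_congr eq_comm rfl rfl]
  by_cases hi : i ≠ r.castSucc ∧ i ≠ r.succ
  · rw [blockMat_left hi.1 hi.2, blockMat_right hi.1 hi.2, apply_ite star, star_one, star_zero,
      if_congr eq_comm rfl rfl]
  have key : ∀ x : Fin (n + 1), ¬(x ≠ r.castSucc ∧ x ≠ r.succ) → x = r.castSucc ∨ x = r.succ :=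
    fun x h => by tauto
  rcases key i hi with rfl | rfl <;> rcases key j hj with rfl | rfl <;>
    simp only [blockMat_00, blockMat_01, blockMat_10, blockMat_11]

omit [Algebra ℂ B] in
theorem prod_ofFn_eq_of_one {p : ℕ} {f : Fin p → B} {x : Fin p}
    (h : ∀ m, m ≠ x → f m = 1) : (List.ofFn f).prod = f x := by
  induction p with
  | zero => exact x.elim0
  | succ p ih =>
    rw [List.ofFn_succ, List.prod_cons]
    rcases Fin.eq_zero_or_eq_succ x with rfl | ⟨x, rfl⟩
    · rw [List.prod_eq_one, mul_one]
      intro b hb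
      obtain ⟨m, rfl⟩ := (List.mem_ofFn' _ _).1 hb
      exact h _ (Fin.succ_ne_zero m)
    · rw [h 0 (Fin.succ_ne_zero x).symm, one_mul, ih (x := x)]
      exact fun m hm => h _ fun e => hm (Fin.succ_injective _ e)

omit [Algebra ℂ B] in
/-- A product in which only the factors at the places `x < y` differ from `1`. -/
theorem prod_ofFn_eq_mul {p : ℕ} {f : Fin p → B} {x y : Fin p} (hxy : x < y)
    (h : ∀ m, m ≠ x → m ≠ y → f m = 1) : (List.ofFn f).prod = f x * f y := by
  induction p with
  | zero => exact x.elim0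
  | succ p ih =>
    obtain ⟨y, rfl⟩ := Fin.exists_succ_eq.2 ((Fin.zero_le x).trans_lt hxy).ne'
    rw [List.ofFn_succ, List.prod_cons]
    rcases Fin.eq_zero_or_eq_succ x with rfl | ⟨x, rfl⟩
    · rw [prod_ofFn_eq_of_one (x := y)]
      exact fun m hm => h _ (Fin.succ_ne_zero m) fun e => hm (Fin.succ_injective _ e)
    · rw [h 0 (Fin.succ_ne_zero x).symm (Fin.succ_ne_zero y).symm, one_mul,
        ih (Fin.succ_lt_succ_iff.1 hxy)]
      exact fun m hx hy => h _ (fun e => hx (Fin.succ_injective _ e))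
        fun e => hy (Fin.succ_injective _ e)

/-- Interchanging the adjacent values `r, r + 1` of an injective sequence, the first of which stands
to the left of the second, creates one inversion. -/
theorem invCount_swap_adjacent {p : ℕ} {k k' : Fin p → Fin (n + 1)} (hk : Function.Injective k)
    {x y : Fin p} (hxy : x < y) (hx : k x = r.castSucc) (hy : k y = r.succ)
    (hx' : k' x = r.succ) (hy' : k' y = r.castSucc) (hne : ∀ m, m ≠ x → m ≠ y → k' m = k m) :
    invCount k' = invCount k + 1 := by
  have h01 : r.castSucc < r.succ := Fin.castSucc_lt_succ
  rw [invCount, invCount, ← Finset.card_insert_of_notMem (a := (x, y))]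
  · congr 1
    ext ⟨u, v⟩
    simp only [Finset.mem_filter, Finset.mem_univ, true_and, Finset.mem_insert, Prod.mk.injEq]
    have hsep : ∀ m, m ≠ x → m ≠ y → ((k m : ℕ) ≠ r ∧ (k m : ℕ) ≠ r + 1) := fun m h1 h2 =>
      ⟨fun e => h1 (hk (by rw [hx]; exact Fin.ext e)),
        fun e => h2 (hk (by rw [hy]; exact Fin.ext e))⟩
    have e1 : (k x : ℕ) = r := by rw [hx]; rfl
    have e2 : (k y : ℕ) = r + 1 := by rw [hy]; rfl
    have e3 : (k' x : ℕ) = r + 1 := by rw [hx']; rfl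
    have e4 : (k' y : ℕ) = r := by rw [hy']; rfl
    have hu : u = x ∨ u = y ∨ ((u : ℕ) ≠ x ∧ (u : ℕ) ≠ y ∧ (k' u : ℕ) = k u ∧
        (k u : ℕ) ≠ r ∧ (k u : ℕ) ≠ r + 1) := by
      by_cases h1 : u = x
      · exact Or.inl h1
      by_cases h2 : u = y
      · exact Or.inr (Or.inl h2)
      exact Or.inr (Or.inr ⟨fun e => h1 (Fin.ext e), fun e => h2 (Fin.ext e),
        by rw [hne u h1 h2], hsep u h1 h2⟩)
    have hv : v = x ∨ v = y ∨ ((v : ℕ) ≠ x ∧ (v : ℕ) ≠ y ∧ (k' v : ℕ) = k v ∧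
        (k v : ℕ) ≠ r ∧ (k v : ℕ) ≠ r + 1) := by
      by_cases h1 : v = x
      · exact Or.inl h1
      by_cases h2 : v = y
      · exact Or.inr (Or.inl h2)
      exact Or.inr (Or.inr ⟨fun e => h1 (Fin.ext e), fun e => h2 (Fin.ext e),
        by rw [hne v h1 h2], hsep v h1 h2⟩)
    simp only [Fin.lt_def, Fin.ext_iff] at hxy ⊢
    rcases hu with rfl | rfl | hu <;> rcases hv with rfl | rfl | hv <;> omega
  · simp only [Finset.mem_filter, Finset.mem_univ, true_and, not_and, not_lt, hx, hy]
    exact fun _ => h01.le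

/-- The determinant relations of a block matrix. In the sum over `k` only the two sequences remain
that arise from `j` by writing `r, r + 1`, in either order, in the two places where `j` has values in
the block. -/
theorem blockMat_det {q : ℝ} (hab : a * b = (q : ℂ) • (b * a))
    (hcd : c * d = (q : ℂ) • (d * c)) (had : a * d - (q : ℂ) • (b * c) = 1)
    (hda : (q : ℂ) • (d * a) - c * b = (q : ℂ) • 1) (j : Fin (n + 1) → Fin (n + 1)) :
    ∑ k : Fin (n + 1) → Fin (n + 1), (qTensor q k : ℂ) •
      (List.ofFn fun m => blockMat r a b c d (j m) (k m)).prod = (qTensor q j : ℂ) • 1 := by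
  have h01 := castSucc_ne_succ r
  set M := blockMat r a b c d with hM
  -- A term that does not vanish agrees with `j` outside of the block and stays in the block.
  have hterm : ∀ k : Fin (n + 1) → Fin (n + 1), (List.ofFn fun m => M (j m) (k m)).prod ≠ 0 →
      ∀ m, (j m = k m ∨ ((j m = r.castSucc ∨ j m = r.succ) ∧ (k m = r.castSucc ∨ k m = r.succ))) := by
    intro k hk m
    refine (blockMat_eq_zero_or (r := r) (a := a) (b := b) (c := c) (d := d)).resolve_left
      fun e => ?_
    exact hk (List.prod_eq_zero ((List.mem_ofFn' _ _).2 ⟨m, e⟩))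
  have hzero : (∀ k : Fin (n + 1) → Fin (n + 1), (∀ m, (j m = k m ∨
      ((j m = r.castSucc ∨ j m = r.succ) ∧ (k m = r.castSucc ∨ k m = r.succ)))) → ¬Function.Injective k) →
      ∑ k : Fin (n + 1) → Fin (n + 1), (qTensor q k : ℂ) •
      (List.ofFn fun m => M (j m) (k m)).prod = (qTensor q j : ℂ) • 1 := by
    intro h
    rw [qTensor_of_not_injective q (h j fun m => Or.inl rfl), Complex.ofReal_zero, zero_smul]
    refine Finset.sum_eq_zero fun k _ => ?_
    by_cases hk : (List.ofFn fun m => M (j m) (k m)).prod = 0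
    · rw [hk, smul_zero]
    · rw [qTensor_of_not_injective q (h k (hterm k hk)), Complex.ofReal_zero, zero_smul]
  by_cases hinj : ∃ k : Fin (n + 1) → Fin (n + 1), (∀ m, (j m = k m ∨
      ((j m = r.castSucc ∨ j m = r.succ) ∧ (k m = r.castSucc ∨ k m = r.succ)))) ∧
      Function.Injective k
  swap
  · push Not at hinj
    exact hzero hinj
  obtain ⟨k₀, hjk, hk⟩ := hinj
  obtain ⟨x, hx⟩ := (Finite.injective_iff_surjective.1 hk) r.castSucc
  obtain ⟨y, hy⟩ := (Finite.injective_iff_surjective.1 hk) r.succ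
  have hxy : x ≠ y := fun e => h01 (by rw [← hx, ← hy, e])
  -- The places `x < y` where a nonvanishing `k` has values in the block.
  obtain ⟨x, y, hxy, k₀, hjk, hk, hx, hy⟩ : ∃ x y, x < y ∧ ∃ k : Fin (n + 1) → Fin (n + 1),
      (∀ m, (j m = k m ∨ ((j m = r.castSucc ∨ j m = r.succ) ∧
      (k m = r.castSucc ∨ k m = r.succ)))) ∧ Function.Injective k ∧
      k x = r.castSucc ∧ k y = r.succ := by
    rcases lt_or_gt_of_ne hxy with h | h
    · exact ⟨x, y, h, k₀, hjk, hk, hx, hy⟩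
    · refine ⟨y, x, h, k₀ ∘ Equiv.swap x y, fun m => ?_, hk.comp (Equiv.injective _), ?_, ?_⟩
      · have := hjk m
        rcases eq_or_ne m x with rfl | hmx
        · simp only [Function.comp_apply, Equiv.swap_apply_left, hy]
          rw [hx] at this
          tauto
        rcases eq_or_ne m y with rfl | hmy
        · simp only [Function.comp_apply, Equiv.swap_apply_right, hx]
          rw [hy] at this
          tauto
        · rwa [Function.comp_apply, Equiv.swap_apply_of_ne_of_ne hmx hmy]
      · simp [hx]
      · simp [hy]
  have hne : ∀ m, m ≠ x → m ≠ y → j m = k₀ m ∧ k₀ m ≠ r.castSucc ∧ k₀ m ≠ r.succ := by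
    intro m h1 h2
    have e1 : k₀ m ≠ r.castSucc := fun e => h1 (hk (by rw [hx, e]))
    have e2 : k₀ m ≠ r.succ := fun e => h2 (hk (by rw [hy, e]))
    have := hjk m
    tauto
  have hjx : j x = r.castSucc ∨ j x = r.succ := by
    have := hjk x
    rw [hx] at this
    tauto
  have hjy : j y = r.castSucc ∨ j y = r.succ := by
    have := hjk y
    rw [hy] at this
    tauto
  -- The other sequence that contributes to the sum.
  set k₁ := k₀ ∘ Equiv.swap x y with hk₁
  have hx₁ : k₁ x = r.succ := by simp [hk₁, hy]
  have hy₁ : k₁ y = r.castSucc := by simp [hk₁, hx]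
  have hne₁ : ∀ m, m ≠ x → m ≠ y → k₁ m = k₀ m := fun m h1 h2 => by
    rw [hk₁, Function.comp_apply, Equiv.swap_apply_of_ne_of_ne h1 h2]
  have hk₁i : Function.Injective k₁ := hk.comp (Equiv.injective _)
  have hinv := invCount_swap_adjacent hk hxy hx hy hx₁ hy₁ hne₁
  have hE : (qTensor q k₁ : ℂ) = -(q : ℂ) * qTensor q k₀ := by
    rw [qTensor_of_injective q hk, qTensor_of_injective q hk₁i, hinv]
    push_cast
    ring
  have huniq : ∀ k : Fin (n + 1) → Fin (n + 1), Function.Injective k →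
      (∀ m, m ≠ x → m ≠ y → k m = k₀ m) → (k x = r.castSucc ∨ k x = r.succ) →
      (k y = r.castSucc ∨ k y = r.succ) → k = k₀ ∨ k = k₁ := by
    intro k hki hkm hkx hky
    have hkxy : k x ≠ k y := fun e => hxy.ne (hki e)
    rcases hkx with h1 | h1 <;> rcases hky with h2 | h2
    · exact absurd (h1.trans h2.symm) hkxy
    · left; funext m
      rcases eq_or_ne m x with rfl | hmx
      · rw [h1, hx]
      rcases eq_or_ne m y with rfl | hmy
      · rw [h2, hy]
      exact hkm m hmx hmy
    · right; funext m
      rcases eq_or_ne m x with rfl | hmx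
      · rw [h1, hx₁]
      rcases eq_or_ne m y with rfl | hmy
      · rw [h2, hy₁]
      rw [hkm m hmx hmy, hne₁ m hmx hmy]
    · exact absurd (h1.trans h2.symm) hkxy
  have hprod : ∀ k : Fin (n + 1) → Fin (n + 1), (∀ m, m ≠ x → m ≠ y → k m = k₀ m) →
      (List.ofFn fun m => M (j m) (k m)).prod = M (j x) (k x) * M (j y) (k y) := by
    intro k hkm
    refine prod_ofFn_eq_mul hxy fun m h1 h2 => ?_
    obtain ⟨e1, e2, e3⟩ := hne m h1 h2
    rw [e1, hkm m h1 h2, hM, blockMat_left e2 e3, if_pos rfl]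
  -- The four possible values of `j` at the places `x` and `y` are the four hypotheses on the block.
  rw [Fintype.sum_eq_add k₀ k₁, hprod k₀ fun _ _ _ => rfl, hprod k₁ hne₁, hx, hy, hx₁, hy₁, hE,
    mul_comm, mul_smul, ← smul_add, hM]
  · rcases hjx with h1 | h1 <;> rcases hjy with h2 | h2 <;>
      simp only [h1, h2, blockMat_00, blockMat_01, blockMat_10, blockMat_11]
    · rw [qTensor_of_not_injective q fun e => hxy.ne (e (h1.trans h2.symm)), hab, neg_smul,
        add_neg_cancel, smul_zero, Complex.ofReal_zero, zero_smul]
    · rw [neg_smul, ← sub_eq_add_neg, had]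
      congr 3
      funext m
      rcases eq_or_ne m x with rfl | hmx
      · rw [h1, hx]
      rcases eq_or_ne m y with rfl | hmy
      · rw [h2, hy]
      exact (hne m hmx hmy).1.symm
    · have : j = k₁ := by
        funext m
        rcases eq_or_ne m x with rfl | hmx
        · rw [h1, hx₁]
        rcases eq_or_ne m y with rfl | hmy
        · rw [h2, hy₁]
        rw [(hne m hmx hmy).1, hne₁ m hmx hmy]
      rw [this, hE, mul_comm, mul_smul, neg_smul, neg_smul, ← sub_eq_add_neg, ← neg_sub, hda]
    · rw [qTensor_of_not_injective q fun e => hxy.ne (e (h1.trans h2.symm)), hcd, neg_smul,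
        add_neg_cancel, smul_zero, Complex.ofReal_zero, zero_smul]
  · intro e
    have := congrFun e x
    rw [hx, hx₁] at this
    exact h01 this
  · rintro k ⟨hk0, hk1⟩
    by_cases hp : (List.ofFn fun m => M (j m) (k m)).prod = 0
    · rw [hp, smul_zero]
    by_cases hki : Function.Injective k
    · have h := hterm k hp
      refine absurd (huniq k hki (fun m h1 h2 => ?_) ?_ ?_) (by tauto)
      · have e := hne m h1 h2
        rcases h m with e1 | e1
        · rw [← e1, e.1]
        · rw [e.1] at e1
          tauto
      · rcases h x with e1 | e1
        · rwa [← e1]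
        · exact e1.2
      · rcases h y with e1 | e1
        · rwa [← e1]
        · exact e1.2
    · rw [qTensor_of_not_injective q hki, Complex.ofReal_zero, zero_smul]

end Block

end QSU

namespace QSU

/-! ### The representations for nonzero `q` -/

section Simple

variable {m n : ℕ}

theorem conv_of_ne_zero {B : Type*} [Ring B] {q : ℝ} (hq : q ≠ 0)
    (X Y : Matrix (Fin (n + 1)) (Fin (n + 1)) B) : conv q X Y = X * Y := by
  funext i j
  rw [Matrix.mul_apply]
  exact if_neg hq

/-- The matrix of operators `π_{s_r}(z_{i,j})` on the `k`-th tensor factor. -/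
noncomputable abbrev simpleMat (q : Set.Ico (0 : ℝ) 1) (r : Fin n) (k : Fin m) :
    Matrix (Fin (n + 1)) (Fin (n + 1)) (Op m) := simpleEntry q r k

/-- The diagonal matrix of the scalars `χ_t(z_{i,j})`. -/
noncomputable abbrev charMat (B : Type*) [Ring B] [Algebra ℂ B] (t : Fin n → Circle) :
    Matrix (Fin (n + 1)) (Fin (n + 1)) B := charEntry B t

theorem simpleEntry_eq_blockMat {q : Set.Ico (0 : ℝ) 1} (hq : (q : ℝ) ≠ 0) (r : Fin n)
    (k : Fin m) : simpleMat q r k =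
      blockMat r (ann q k) (-((q : ℝ) : ℂ) • qPow q k) (qPow q k) (star (ann q k)) := by
  funext i j
  simp only [simpleEntry, blockMat, if_neg hq, star_ann]
  rfl

variable {q : Set.Ico (0 : ℝ) 1}

theorem quantumRel_simpleEntry (hq : (q : ℝ) ≠ 0) (r : Fin n) (k : Fin m) :
    QuantumRel q (simpleMat q r k) := by
  have h1 := ann_mul_star_ann q k
  have h2 := star_ann_mul_ann q k
  have h3 := ann_mul_qPow q k
  have h4 := qPow_mul_star_ann q k
  have h5 := star_qPow q k
  have hs : star (((q : ℝ) : ℂ)) = ((q : ℝ) : ℂ) := Complex.conj_ofReal _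
  rw [simpleEntry_eq_blockMat hq]
  refine ⟨row_iff.2 ?_, col_iff.2 ?_, blockMat_det ?_ ?_ ?_ ?_⟩
  · rw [blockMat_conjTranspose, blockMat_mul, ← blockMat_one (r := r)]
    simp only [star_smul, star_star, h5, h1, h2, h3, h4, star_neg, hs, mul_smul_comm,
      smul_mul_assoc, smul_smul]
    congr 1
    · rw [neg_mul_neg, pow_two, sub_add_cancel]
    · rw [neg_smul, add_neg_cancel]
    · rw [neg_smul, add_neg_cancel]
    · abel
  · rw [blockMat_conjTranspose, blockMat_mul, ← blockMat_one (r := r)]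
    simp only [star_smul, star_star, h5, h1, h2, h3, h4, star_neg, hs, mul_smul_comm,
      smul_mul_assoc, smul_smul]
    congr 1
    · abel
    · rw [neg_smul, neg_add_cancel]
    · rw [neg_smul, neg_add_cancel]
    · rw [neg_mul_neg, pow_two, add_sub_cancel]
  · simp only [mul_smul_comm, h3, smul_mul_assoc, smul_smul]
    rw [mul_comm]
  · exact h4
  · rw [h1]
    simp only [neg_smul, neg_mul, smul_neg, smul_mul_assoc, smul_smul, sub_neg_eq_add, pow_two,
      sub_add_cancel]
  · rw [h2]
    simp only [mul_smul_comm, smul_sub, neg_smul, mul_neg, sub_neg_eq_add, sub_add_cancel]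

theorem frt_simpleEntry (hq : (q : ℝ) ≠ 0) (r : Fin n) (k : Fin m) :
    FRT ((q : ℝ) : ℂ) (simpleMat q r k) := by
  have hq' : ((q : ℝ) : ℂ) ≠ 0 := by exact_mod_cast hq
  have h1 := ann_mul_star_ann q k
  have h2 := star_ann_mul_ann q k
  have h3 := ann_mul_qPow q k
  have h4 := qPow_mul_star_ann q k
  rw [simpleEntry_eq_blockMat hq]
  refine FRT.blockMat hq' ?_ h3 ?_ ?_ h4 ?_
  · simp only [mul_smul_comm, h3, smul_mul_assoc, smul_smul]
    rw [mul_comm]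
  · simp only [mul_smul_comm, smul_mul_assoc]
  · simp only [mul_smul_comm, h4, smul_mul_assoc, smul_smul]
    rw [mul_comm]
  · rw [h1, h2]
    simp only [smul_mul_assoc, smul_smul]
    rw [sub_mul, mul_neg, mul_neg, inv_mul_cancel₀ hq', sub_smul, neg_smul, neg_smul, one_smul,
      pow_two]
    abel

/-- The diagonal entries of a point of the maximal torus of `SU(n+1)` have product `1`. -/
theorem prod_torusEntry (t : Fin n → Circle) : ∏ i, torusEntry t i = 1 := by
  have h1 : ∏ i : Fin (n + 1), (if h : 0 < (i : ℕ) then star (t ⟨i - 1, by omega⟩ : ℂ) else 1) =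
      ∏ k, star (t k : ℂ) := by
    rw [Fin.prod_univ_succ]
    simp
  have h2 : ∏ i : Fin (n + 1), (if h : (i : ℕ) < n then (t ⟨i, h⟩ : ℂ) else 1) =
      ∏ k, (t k : ℂ) := by
    rw [Fin.prod_univ_castSucc]
    simp
  simp only [torusEntry]
  rw [Finset.prod_mul_distrib, h1, h2, ← Finset.prod_mul_distrib]
  refine Finset.prod_eq_one fun k _ => ?_
  rw [← starRingEnd_apply, ← Circle.coe_inv_eq_conj, ← Circle.coe_mul, inv_mul_cancel,
    Circle.coe_one]

theorem star_mul_torusEntry (t : Fin n → Circle) (i : Fin (n + 1)) :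
    torusEntry t i * star (torusEntry t i) = 1 := by
  have h : ∀ z : Circle, (z : ℂ) * star (z : ℂ) = 1 := fun z => by
    rw [← starRingEnd_apply, ← Circle.coe_inv_eq_conj, ← Circle.coe_mul, mul_inv_cancel,
      Circle.coe_one]
  have h' : ∀ z : Circle, star (z : ℂ) * (z : ℂ) = 1 := fun z => by rw [mul_comm, h]
  rw [torusEntry, star_mul', mul_mul_mul_comm]
  split_ifs <;> simp only [star_star, star_one, h, h', mul_one]

theorem charEntry_eq {B : Type*} [Ring B] [Algebra ℂ B] (t : Fin n → Circle) :
    charMat B t = Matrix.diagonal fun i => algebraMap ℂ B (torusEntry t i) := by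
  funext i j
  rw [Matrix.diagonal_apply]
  rfl

theorem commute_charEntry {B : Type*} [Ring B] [Algebra ℂ B] (t : Fin n → Circle)
    (i j : Fin (n + 1)) (b : B) : Commute (charEntry B t i j) b := by
  rw [charEntry]
  split_ifs
  · exact Algebra.commutes _ _
  · exact Commute.zero_left _

theorem frt_charEntry (q : ℂ) (B : Type*) [Ring B] [Algebra ℂ B] (t : Fin n → Circle) :
    FRT q (charMat B t) := by
  intro i k j l
  rw [(commute_charEntry t k j _).eq]
  simp only [charEntry]
  congr 1
  · by_cases h1 : i = l
    · by_cases h2 : k = j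
      · rw [h1, h2, if_congr eq_comm rfl rfl]
      · simp [h2]
    · simp [h1]
  · by_cases h1 : i = j
    · by_cases h2 : k = l
      · rw [h1, h2]
      · simp [h2]
    · simp [h1]

theorem quantumRel_charEntry (q : ℝ) (B : Type*) [Ring B] [StarRing B] [Algebra ℂ B]
    [StarModule ℂ B] (t : Fin n → Circle) :
    QuantumRel q (charMat B t) where
  row := row_iff.2 <| by
    rw [charEntry_eq, Matrix.diagonal_conjTranspose, Matrix.diagonal_mul_diagonal,
      ← Matrix.diagonal_one]
    congr 1
    funext i
    rw [Pi.star_apply, ← algebraMap_star_comm, ← map_mul, star_mul_torusEntry, map_one]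
  col := col_iff.2 <| by
    rw [charEntry_eq, Matrix.diagonal_conjTranspose, Matrix.diagonal_mul_diagonal,
      ← Matrix.diagonal_one]
    congr 1
    funext i
    rw [Pi.star_apply, ← algebraMap_star_comm, ← map_mul, mul_comm, star_mul_torusEntry, map_one]
  det j := by
    rw [Finset.sum_eq_single j]
    · simp only [charEntry, if_true]
      by_cases hj : Function.Injective j
      · congr 1
        have e : (List.ofFn fun m => algebraMap ℂ B (torusEntry t (j m))) =
            (List.ofFn fun m => torusEntry t (j m)).map (algebraMap ℂ B) := by
          rw [List.map_ofFn]; rfl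
        rw [e, ← map_list_prod, List.prod_ofFn, (Finite.injective_iff_bijective.1 hj).prod_comp
          (torusEntry t), prod_torusEntry, map_one]
      · rw [qTensor_of_not_injective q hj, Complex.ofReal_zero, zero_smul, zero_smul]
    · intro k _ hk
      obtain ⟨m, hm⟩ := Function.ne_iff.1 hk
      rw [List.prod_eq_zero, smul_zero]
      refine (List.mem_ofFn' _ _).2 ⟨m, ?_⟩
      simp only [charEntry]
      rw [if_neg hm.symm]
    · simp

/-- The matrix of the convolution of the representations `π_{s_r}`, acting on the `k`-th tensor
factor, over the pairs `(r, k)` of a list. -/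
noncomputable def posEntry (q : Set.Ico (0 : ℝ) 1) (L : List (Fin n × Fin m)) :
    Matrix (Fin (n + 1)) (Fin (n + 1)) (Op m) :=
  L.foldr (fun p => conv q (simpleEntry q p.1 p.2)) counitMat

theorem wordEntry_eq_posEntry (q : Set.Ico (0 : ℝ) 1) (a : List (Fin n)) :
    wordEntry q a = posEntry q (List.ofFn fun k => (a.get k, k)) := by
  rw [wordEntry, posEntry]
  have : (List.ofFn fun k : Fin a.length => simpleEntry q (a.get k) k (n := n)) =
      (List.ofFn fun k => (a.get k, k)).map fun p => simpleEntry q p.1 p.2 := by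
    rw [List.map_ofFn]; rfl
  rw [this, List.foldr_map]
  rfl

theorem posEntry_of_ne_zero (hq : (q : ℝ) ≠ 0) (L : List (Fin n × Fin m)) :
    posEntry q L = (L.map fun p => simpleMat q p.1 p.2).prod := by
  induction L with
  | nil =>
    funext i j
    exact (Matrix.one_apply (α := Op m) (i := i) (j := j)).symm
  | cons p L ih =>
    rw [List.map_cons, List.prod_cons, ← ih]
    exact conv_of_ne_zero hq _ _

theorem CommuteFactor.posEntry_commute {A : Op m} (L : List (Fin n × Fin m))
    (h : ∀ p ∈ L, CommuteFactor q p.2 A) (i j : Fin (n + 1)) : Commute (posEntry q L i j) A := by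
  induction L generalizing i j with
  | nil =>
    change Commute (if i = j then 1 else 0) A
    split_ifs
    · exact Commute.one_left A
    · exact Commute.zero_left A
  | cons p L ih =>
    have h1 := ih fun p hp => h p (List.mem_cons_of_mem _ hp)
    have h2 := (h p List.mem_cons_self).simpleEntry p.1
    change Commute (if (q : ℝ) = 0 then ∑ k ∈ Finset.Icc (min i j) (max i j),
      QSU.simpleEntry q p.1 p.2 i k * posEntry q L k j
      else ∑ k, QSU.simpleEntry q p.1 p.2 i k * posEntry q L k j) A
    split_ifs
    · exact Commute.sum_left _ _ _ fun k _ => (h2 i k).mul_left (h1 k j)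
    · exact Commute.sum_left _ _ _ fun k _ => (h2 i k).mul_left (h1 k j)

theorem commute_simpleEntry_posEntry {L : List (Fin n × Fin m)} {k : Fin m}
    (h : ∀ p ∈ L, p.2 ≠ k) (r : Fin n) (i j i' j' : Fin (n + 1)) :
    Commute (simpleEntry q r k i j) (posEntry q L i' j') :=
  (CommuteFactor.posEntry_commute L
    (fun p hp => commuteFactor_simpleEntry q (h p hp) r i j) i' j').symm

theorem quantumRel_posEntry (hq : (q : ℝ) ≠ 0) {L : List (Fin n × Fin m)}
    (hL : (L.map Prod.snd).Nodup) :
    QuantumRel q (posEntry q L) ∧ FRT ((q : ℝ) : ℂ) (posEntry q L) := by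
  induction L with
  | nil =>
    have e : (posEntry q [] : Matrix (Fin (n + 1)) (Fin (n + 1)) (Op m)) = charMat (Op m) 1 := by
      funext i j
      have : ∀ i : Fin (n + 1), torusEntry (1 : Fin n → Circle) i = 1 := fun i => by
        simp [torusEntry]
      simp only [charMat, charEntry, this, map_one]
      rfl
    rw [e]
    exact ⟨quantumRel_charEntry _ _ _, frt_charEntry _ _ _⟩
  | cons p L ih =>
    rw [List.map_cons, List.nodup_cons] at hL
    obtain ⟨h1, h2⟩ := ih hL.2
    have hc : ∀ i j k l, Commute (simpleEntry q p.1 p.2 i j) (posEntry q L k l) := fun i j k l =>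
      commute_simpleEntry_posEntry (fun p' hp' e => hL.1 (List.mem_map.2 ⟨p', hp', e⟩)) _ _ _ _ _
    have e : posEntry q (p :: L) = simpleMat q p.1 p.2 * posEntry q L :=
      conv_of_ne_zero hq _ _
    rw [e]
    exact ⟨(quantumRel_simpleEntry hq p.1 p.2).mul h1 hc, (frt_simpleEntry hq p.1 p.2).mul h2 hc⟩

theorem nodup_map_snd_ofFn (a : Fin m → Fin n) :
    ((List.ofFn fun k => (a k, k)).map Prod.snd).Nodup := by
  rw [List.map_ofFn]
  exact List.nodup_ofFn.2 fun _ _ h => h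

/-- The matrix of operators `π_{t,a}(z_{i,j})`. -/
noncomputable abbrev repMat (q : Set.Ico (0 : ℝ) 1) (t : Fin n → Circle) (a : List (Fin n)) :
    Matrix (Fin (n + 1)) (Fin (n + 1)) (Op a.length) := repEntry q t a

theorem repMat_of_ne_zero (hq : (q : ℝ) ≠ 0) (t : Fin n → Circle) (a : List (Fin n)) :
    repMat q t a =
      charMat _ t * posEntry q (List.ofFn fun k => (a.get k, k)) := by
  rw [← wordEntry_eq_posEntry]
  exact conv_of_ne_zero hq _ _

theorem quantumRel_repMat (hq : (q : ℝ) ≠ 0) (t : Fin n → Circle) (a : List (Fin n)) :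
    QuantumRel q (repMat q t a) := by
  rw [repMat_of_ne_zero hq]
  exact (quantumRel_charEntry _ _ _).mul (quantumRel_posEntry hq (nodup_map_snd_ofFn _)).1
    fun i j k l => commute_charEntry _ _ _ _

theorem frt_repMat (hq : (q : ℝ) ≠ 0) (t : Fin n → Circle) (a : List (Fin n)) :
    FRT ((q : ℝ) : ℂ) (repMat q t a) := by
  rw [repMat_of_ne_zero hq]
  exact (frt_charEntry _ _ _).mul (quantumRel_posEntry hq (nodup_map_snd_ofFn _)).2
    fun i j k l => commute_charEntry _ _ _ _

end Simple

end QSU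

namespace QSU

/-! ### The limit `q → 0` -/

section Limit

open Filter Topology

variable {n : ℕ}

/-- A sequence of positive parameters that tends to `0`. -/
noncomputable def qSeq (N : ℕ) : Set.Ico (0 : ℝ) 1 :=
  ⟨1 / ((N : ℝ) + 2), by positivity, by
    rw [div_lt_one (by positivity)]
    linarith [N.cast_nonneg (α := ℝ)]⟩

theorem qSeq_ne_zero (N : ℕ) : (qSeq N : ℝ) ≠ 0 := by
  simp only [qSeq]
  positivity

theorem tendsto_qSeq : Tendsto (fun N => (qSeq N : ℝ)) atTop (𝓝 0) := by
  simp only [qSeq]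
  have h : Tendsto (fun N : ℕ => ((N : ℝ) + 2)) atTop atTop :=
    tendsto_atTop_add_const_right _ _ tendsto_natCast_atTop_atTop
  simpa only [one_div] using! h.inv_tendsto_atTop

theorem tendsto_qSeq_complex : Tendsto (fun N => ((qSeq N : ℝ) : ℂ)) atTop (𝓝 0) := by
  simpa only [Complex.ofReal_zero] using! (Complex.continuous_ofReal.tendsto 0).comp tendsto_qSeq

theorem tendsto_neg_qSeq_pow (e : ℕ) :
    Tendsto (fun N => (-((qSeq N : ℝ) : ℂ)) ^ e) atTop (𝓝 (if e = 0 then 1 else 0)) := by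
  have := tendsto_qSeq_complex.neg.pow e
  convert this using 2
  rw [neg_zero, zero_pow_eq]

theorem neg_qSeq_pow_ne_zero (N e : ℕ) : (-((qSeq N : ℝ) : ℂ)) ^ e ≠ 0 :=
  pow_ne_zero _ (neg_ne_zero.2 (by exact_mod_cast qSeq_ne_zero N))

variable {B : Type*} [NormedRing B] [NormedAlgebra ℂ B]

/-- The entries above the diagonal, divided by the power of `-q` with which they vanish as `q → 0`.
The subtraction is truncated: entries on and below the diagonal are unchanged. -/
noncomputable def crystal (N : ℕ) (z : Matrix (Fin (n + 1)) (Fin (n + 1)) B)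
    (i j : Fin (n + 1)) : B :=
  ((-((qSeq N : ℝ) : ℂ)) ^ ((j : ℕ) - i))⁻¹ • z i j

theorem eq_smul_crystal (N : ℕ) (z : Matrix (Fin (n + 1)) (Fin (n + 1)) B) (i j : Fin (n + 1)) :
    z i j = (-((qSeq N : ℝ) : ℂ)) ^ ((j : ℕ) - i) • crystal N z i j := by
  rw [crystal, smul_inv_smul₀ (neg_qSeq_pow_ne_zero N _)]

/-- The matrices `z N`, belonging to the parameters `qSeq N`, have `z₀` as their crystal limit. -/
def CrystalLimit (z : ℕ → Matrix (Fin (n + 1)) (Fin (n + 1)) B)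
    (z₀ : Fin (n + 1) → Fin (n + 1) → B) : Prop :=
  ∀ i j, Tendsto (fun N => crystal N (z N) i j) atTop (𝓝 (z₀ i j))

/-- In the limit the convolution becomes the truncated convolution. -/
theorem CrystalLimit.mul {x y : ℕ → Matrix (Fin (n + 1)) (Fin (n + 1)) B}
    {x₀ y₀ : Fin (n + 1) → Fin (n + 1) → B} (hx : CrystalLimit x x₀) (hy : CrystalLimit y y₀) :
    CrystalLimit (fun N => x N * y N) (conv 0 x₀ y₀) := by
  intro i j
  have e1 : conv 0 x₀ y₀ i j = ∑ k : Fin (n + 1),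
      (if ((k : ℕ) - i) + (j - k) - (j - i) = 0 then (1 : ℂ) else 0) • (x₀ i k * y₀ k j) := by
    rw [conv, if_pos rfl]
    simp only [ite_smul, one_smul, zero_smul]
    rw [← Finset.sum_filter]
    congr 1
    ext k
    simp only [Finset.mem_Icc, Finset.mem_filter, Finset.mem_univ, true_and, min_le_iff,
      le_max_iff, Fin.le_def]
    omega
  have e2 : ∀ N, crystal N (x N * y N) i j = ∑ k : Fin (n + 1),
      (-((qSeq N : ℝ) : ℂ)) ^ (((k : ℕ) - i) + (j - k) - (j - i)) •
        (crystal N (x N) i k * crystal N (y N) k j) := by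
    intro N
    rw [crystal, Matrix.mul_apply, Finset.smul_sum]
    refine Finset.sum_congr rfl fun k _ => ?_
    rw [eq_smul_crystal N (x N), eq_smul_crystal N (y N), smul_mul_smul_comm, smul_smul,
      ← pow_add]
    congr 1
    rw [inv_mul_eq_iff_eq_mul₀ (neg_qSeq_pow_ne_zero N _), ← pow_add]
    congr 1
    omega
  simp only [e1, e2]
  exact tendsto_finsetSum _ fun k _ =>
    (tendsto_neg_qSeq_pow _).smul ((hx i k).mul (hy k j))

theorem crystalLimit_charMat (t : Fin n → Circle) :
    CrystalLimit (fun _ => charMat B t) (charEntry B t) := by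
  intro i j
  by_cases h : i = j
  · simp [crystal, h]
  · simp [crystal, charEntry, h]

theorem prod_ofFn_smul {R : Type*} [Ring R] [Algebra ℂ R] {p : ℕ} (c : Fin p → ℂ)
    (w : Fin p → R) :
    (List.ofFn fun m => c m • w m).prod = (∏ m, c m) • (List.ofFn w).prod := by
  induction p with
  | zero => simp
  | succ p ih =>
    rw [List.ofFn_succ, List.ofFn_succ, List.prod_cons, List.prod_cons, ih, Fin.prod_univ_succ,
      smul_mul_smul_comm]

omit [NormedAlgebra ℂ B] in
theorem tendsto_prod_ofFn {p : ℕ} {w : ℕ → Fin p → B} {w₀ : Fin p → B}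
    (h : ∀ m, Tendsto (fun N => w N m) atTop (𝓝 (w₀ m))) :
    Tendsto (fun N => (List.ofFn (w N)).prod) atTop (𝓝 (List.ofFn w₀).prod) := by
  induction p with
  | zero => simp
  | succ p ih =>
    simp only [List.ofFn_succ, List.prod_cons]
    exact (h 0).mul (ih fun m => h m.succ)

theorem prod_ofFn_eq_smul_crystal (N : ℕ) (z : Matrix (Fin (n + 1)) (Fin (n + 1)) B) {p : ℕ}
    (j k : Fin p → Fin (n + 1)) : (List.ofFn fun m => z (j m) (k m)).prod =
      (-((qSeq N : ℝ) : ℂ)) ^ (∑ m, ((k m : ℕ) - j m)) •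
        (List.ofFn fun m => crystal N z (j m) (k m)).prod := by
  simp_rw [eq_smul_crystal N z]
  rw [prod_ofFn_smul, Finset.prod_pow_eq_pow_sum]

theorem sum_val_succAbove (s : Fin (n + 1)) :
    (s : ℕ) + ∑ m : Fin n, (s.succAbove m : ℕ) = ∑ i : Fin (n + 1), (i : ℕ) :=
  (Fin.sum_univ_succAbove (fun i : Fin (n + 1) => (i : ℕ)) s).symm

/-- The exponent of `q` in the normalised cofactor expansion of the adjoint is nonnegative. -/
theorem max_le_add_sum_sub (r s : Fin (n + 1)) (σ : Equiv.Perm (Fin n)) :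
    (r : ℕ) + (s - r) ≤ s + ∑ m, ((s.succAbove (σ m) : ℕ) - r.succAbove m) := by
  have h1 := sum_val_succAbove r
  have h2 := sum_val_succAbove s
  have h3 : ∑ m, (s.succAbove (σ m) : ℕ) ≤
      ∑ m, ((s.succAbove (σ m) : ℕ) - r.succAbove m) + ∑ m, (r.succAbove m : ℕ) := by
    rw [← Finset.sum_add_distrib]
    exact Finset.sum_le_sum fun m _ => by omega
  rw [Equiv.sum_comp σ fun m => (s.succAbove m : ℕ)] at h3
  omega

/-- The exponent vanishes for the increasing matching of rows and columns. -/
theorem max_eq_add_sum_sub (r s : Fin (n + 1)) :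
    (r : ℕ) + (s - r) = s + ∑ m, ((s.succAbove m : ℕ) - r.succAbove m) := by
  have h1 := sum_val_succAbove r
  have h2 := sum_val_succAbove s
  rcases le_total (r : ℕ) s with h | h
  · have : ∑ m, ((s.succAbove m : ℕ) - r.succAbove m) = 0 := by
      refine Finset.sum_eq_zero fun m _ => Nat.sub_eq_zero_of_le ?_
      simp only [Fin.succAbove, Fin.lt_def]
      split_ifs <;> simp at * <;> omega
    omega
  · have : ∑ m, (s.succAbove m : ℕ) =
      ∑ m, ((s.succAbove m : ℕ) - r.succAbove m) + ∑ m, (r.succAbove m : ℕ) := by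
      rw [← Finset.sum_add_distrib]
      refine Finset.sum_congr rfl fun m _ => ?_
      have : (r.succAbove m : ℕ) ≤ s.succAbove m := by
        simp only [Fin.succAbove, Fin.lt_def]
        split_ifs <;> simp at * <;> omega
      omega
    omega

/-- The relations of the crystallized algebra are the limits of those of the quantum groups. -/
theorem CrystalLimit.crystalRel [StarRing B] [ContinuousStar B] [StarModule ℂ B]
    {z : ℕ → Matrix (Fin (n + 1)) (Fin (n + 1)) B} {z₀ : Fin (n + 1) → Fin (n + 1) → B}
    (h : CrystalLimit z z₀) (hF : ∀ N, FRT ((qSeq N : ℝ) : ℂ) (z N))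
    (hQ : ∀ N, QuantumRel (qSeq N) (z N)) : CrystalRel z₀ := by
  have hq : ∀ N, ((qSeq N : ℝ) : ℂ) ≠ 0 := fun N => by exact_mod_cast qSeq_ne_zero N
  have hpow : ∀ N e, (-((qSeq N : ℝ) : ℂ)) ^ e ≠ 0 := neg_qSeq_pow_ne_zero
  have hz := fun N => eq_smul_crystal N (z N)
  have h0 := tendsto_qSeq_complex
  -- The relation between the entries at `(i, j)` and `(k, l)` in terms of the normalised entries.
  have hdiag : ∀ N (i k j l : Fin (n + 1)), i < k → j < l →
      crystal N (z N) i j * crystal N (z N) k l - crystal N (z N) k l * crystal N (z N) i j =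
      ((((qSeq N : ℝ) : ℂ) - ((qSeq N : ℝ) : ℂ)⁻¹) *
        (-((qSeq N : ℝ) : ℂ)) ^ (min (k : ℕ) l - max (i : ℕ) j)) •
        (crystal N (z N) i l * crystal N (z N) k j) := by
    intro N i k j l hik hjl
    have h1 := (hF N).diag hik hjl
    rw [hz N i j, hz N k l, hz N i l, hz N k j] at h1
    simp only [smul_mul_smul_comm, smul_smul, ← pow_add] at h1
    rw [add_comm ((l : ℕ) - k), ← smul_sub] at h1
    apply smul_right_injective B (hpow N (((j : ℕ) - i) + (l - k)))
    simp only [h1, smul_smul]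
    congr 1
    rw [mul_left_comm, ← pow_add]
    congr 2
    rw [Fin.lt_def] at hik hjl
    omega
  refine ⟨?_, ?_, ?_, ?_, ?_, ?_, ?_, ?_⟩
  · intro i j l hjl
    have e : ∀ N, crystal N (z N) i j * crystal N (z N) i l =
        ((qSeq N : ℝ) : ℂ) • (crystal N (z N) i l * crystal N (z N) i j) := by
      intro N
      have h1 := (hF N).row i hjl
      rw [hz N i j, hz N i l] at h1
      simp only [smul_mul_smul_comm, smul_smul] at h1
      rw [mul_comm (_ ^ _) (_ ^ _), mul_comm ((qSeq N : ℝ) : ℂ), ← smul_smul _ ((qSeq N : ℝ) : ℂ)]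
        at h1
      exact smul_right_injective B (mul_ne_zero (hpow N _) (hpow N _)) h1
    have l1 := (h i j).mul (h i l)
    simp only [e] at l1
    have l2 := h0.smul ((h i l).mul (h i j))
    rw [zero_smul] at l2
    exact tendsto_nhds_unique l1 l2
  · intro i k j hik
    have e : ∀ N, crystal N (z N) i j * crystal N (z N) k j =
        ((qSeq N : ℝ) : ℂ) • (crystal N (z N) k j * crystal N (z N) i j) := by
      intro N
      have h1 := (hF N).col hik j
      rw [hz N i j, hz N k j] at h1
      simp only [smul_mul_smul_comm, smul_smul] at h1
      rw [mul_comm (_ ^ _) (_ ^ _), mul_comm ((qSeq N : ℝ) : ℂ), ← smul_smul _ ((qSeq N : ℝ) : ℂ)]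
        at h1
      exact smul_right_injective B (mul_ne_zero (hpow N _) (hpow N _)) h1
    have l1 := (h i j).mul (h k j)
    simp only [e] at l1
    have l2 := h0.smul ((h k j).mul (h i j))
    rw [zero_smul] at l2
    exact tendsto_nhds_unique l1 l2
  · intro i k j l hik hjl
    have e : ∀ N, crystal N (z N) i l * crystal N (z N) k j =
        crystal N (z N) k j * crystal N (z N) i l := by
      intro N
      have h1 := (hF N).anti hik hjl
      rw [hz N i l, hz N k j] at h1
      simp only [smul_mul_smul_comm] at h1
      rw [mul_comm (_ ^ _) (_ ^ _)] at h1
      exact smul_right_injective B (mul_ne_zero (hpow N _) (hpow N _)) h1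
    have l1 := (h i l).mul (h k j)
    simp only [e] at l1
    exact tendsto_nhds_unique l1 ((h k j).mul (h i l))
  · intro i k j l hik hjl hle
    have hd : min (k : ℕ) l - max (i : ℕ) j = 0 := by
      simp only [Fin.le_def, min_le_iff, le_max_iff] at hle
      omega
    have e : ∀ N, ((qSeq N : ℝ) : ℂ) • (crystal N (z N) i j * crystal N (z N) k l -
        crystal N (z N) k l * crystal N (z N) i j) =
        (((qSeq N : ℝ) : ℂ) ^ 2 - 1) • (crystal N (z N) i l * crystal N (z N) k j) := by
      intro N
      rw [hdiag N i k j l hik hjl, hd, pow_zero, mul_one, smul_smul, mul_sub,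
        mul_inv_cancel₀ (hq N), pow_two]
    have l1 := h0.smul (((h i j).mul (h k l)).sub ((h k l).mul (h i j)))
    simp only [e] at l1
    have l2 := ((h0.pow 2).sub_const 1).smul ((h i l).mul (h k j))
    have := tendsto_nhds_unique l2 l1
    rw [zero_smul, zero_pow two_ne_zero, zero_sub, neg_smul, one_smul, neg_eq_zero] at this
    exact this
  · intro i k j l hik hjl heq
    have hd : min (k : ℕ) l - max (i : ℕ) j = 1 := by
      rw [Fin.coe_max, Fin.coe_min] at heq
      omega
    have e : ∀ N, crystal N (z N) i j * crystal N (z N) k l -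
        crystal N (z N) k l * crystal N (z N) i j =
        (1 - ((qSeq N : ℝ) : ℂ) ^ 2) • (crystal N (z N) i l * crystal N (z N) k j) := by
      intro N
      rw [hdiag N i k j l hik hjl, hd, pow_one, sub_mul, mul_neg, mul_neg,
        inv_mul_cancel₀ (hq N), pow_two]
      congr 1
      ring
    have l1 := ((h i j).mul (h k l)).sub ((h k l).mul (h i j))
    simp only [e] at l1
    have l2 := ((h0.pow 2).const_sub 1).smul ((h i l).mul (h k j))
    rw [zero_pow two_ne_zero, sub_zero, one_smul] at l2
    exact tendsto_nhds_unique l1 l2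
  · intro i k j l hik hjl hlt
    obtain ⟨d, hd⟩ : ∃ d, min (k : ℕ) l - max (i : ℕ) j = d + 2 := by
      rw [Fin.coe_max, Fin.coe_min] at hlt
      exact ⟨min (k : ℕ) l - max (i : ℕ) j - 2, by omega⟩
    have e : ∀ N, crystal N (z N) i j * crystal N (z N) k l -
        crystal N (z N) k l * crystal N (z N) i j =
        ((1 - ((qSeq N : ℝ) : ℂ) ^ 2) * (-((qSeq N : ℝ) : ℂ)) ^ (d + 1)) •
          (crystal N (z N) i l * crystal N (z N) k j) := by
      intro N
      rw [hdiag N i k j l hik hjl, hd]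
      congr 1
      have := inv_mul_cancel₀ (hq N)
      rw [pow_succ _ (d + 1)]
      linear_combination (-((qSeq N : ℝ) : ℂ)) ^ (d + 1) * this
    have l1 := ((h i j).mul (h k l)).sub ((h k l).mul (h i j))
    simp only [e] at l1
    have l2 := (((h0.pow 2).const_sub 1).mul (tendsto_neg_qSeq_pow (d + 1))).smul
      ((h i l).mul (h k j))
    rw [if_neg (by omega), mul_zero, zero_smul] at l2
    exact sub_eq_zero.1 (tendsto_nhds_unique l1 l2)
  -- In the determinant the identity is the only sequence without a positive power of `q`.
  · have e : ∀ N, ∑ k : Fin (n + 1) → Fin (n + 1),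
        ((qTensor (qSeq N) k : ℂ) * (-((qSeq N : ℝ) : ℂ)) ^ (∑ m, ((k m : ℕ) - m))) •
          (List.ofFn fun m => crystal N (z N) m (k m)).prod = 1 := by
      intro N
      have h1 := (hQ N).det id
      rw [qTensor_of_injective _ Function.injective_id, invCount_strictMono strictMono_id,
        pow_zero, Complex.ofReal_one, one_smul] at h1
      rw [← h1]
      refine Finset.sum_congr rfl fun k _ => ?_
      rw [prod_ofFn_eq_smul_crystal N (z N) id k, smul_smul]
      rfl
    have l : Tendsto (fun N => ∑ k : Fin (n + 1) → Fin (n + 1),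
        ((qTensor (qSeq N) k : ℂ) * (-((qSeq N : ℝ) : ℂ)) ^ (∑ m, ((k m : ℕ) - m))) •
          (List.ofFn fun m => crystal N (z N) m (k m)).prod) atTop
        (𝓝 (∑ k : Fin (n + 1) → Fin (n + 1), (if k = id then (1 : ℂ) else 0) •
          (List.ofFn fun m => z₀ m (k m)).prod)) := by
      refine tendsto_finsetSum _ fun k _ => Tendsto.smul ?_ (tendsto_prod_ofFn fun m => h m (k m))
      by_cases hk : Function.Injective k
      · have e1 : ∀ N, (qTensor (qSeq N) k : ℂ) * (-((qSeq N : ℝ) : ℂ)) ^ (∑ m, ((k m : ℕ) - m)) =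
            (-((qSeq N : ℝ) : ℂ)) ^ (invCount k + ∑ m, ((k m : ℕ) - m)) := fun N => by
          rw [qTensor_of_injective _ hk, pow_add]
          push_cast
          rfl
        simp only [e1]
        convert tendsto_neg_qSeq_pow _ using 3
        rw [Nat.add_eq_zero_iff]
        constructor
        · rintro rfl
          exact ⟨invCount_strictMono strictMono_id, by simp⟩
        · exact fun e => (strictMono_of_invCount_eq_zero hk e.1).eq_id
      · rw [if_neg (by rintro rfl; exact hk Function.injective_id)]
        simp only [qTensor_of_not_injective _ hk, Complex.ofReal_zero, zero_mul]
        exact tendsto_const_nhds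
    simp only [e] at l
    have := tendsto_nhds_unique l tendsto_const_nhds
    simpa using this
  -- In the cofactor expansion the increasing matching is the only one without such a power.
  · intro r s
    have e : ∀ N, star (crystal N (z N) r s) = ∑ σ : Equiv.Perm (Fin n),
        (-((qSeq N : ℝ) : ℂ)) ^ (invCount σ +
          (s + ∑ m, ((s.succAbove (σ m) : ℕ) - r.succAbove m) - (r + (s - r)))) •
          (List.ofFn fun m => crystal N (z N) (r.succAbove m) (s.succAbove (σ m))).prod := by
      intro N
      have h1 := (hQ N).adj r s
      rw [hz N r s, star_smul, smul_smul, star_pow, star_neg,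
        show star (((qSeq N : ℝ) : ℂ)) = ((qSeq N : ℝ) : ℂ) from Complex.conj_ofReal _,
        ← pow_add] at h1
      apply smul_right_injective B (hpow N ((r : ℕ) + (s - r)))
      simp only [h1, Finset.smul_sum]
      refine Finset.sum_congr rfl fun σ _ => ?_
      rw [prod_ofFn_eq_smul_crystal N (z N) r.succAbove fun m => s.succAbove (σ m),
        smul_smul, smul_smul, smul_smul, ← pow_add, ← pow_add, ← pow_add]
      have := max_le_add_sum_sub r s σ
      congr 2
      omega
    have l : Tendsto (fun N => star (crystal N (z N) r s)) atTop
        (𝓝 (∑ σ : Equiv.Perm (Fin n), (if σ = 1 then (1 : ℂ) else 0) •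
          (List.ofFn fun m => z₀ (r.succAbove m) (s.succAbove (σ m))).prod)) := by
      simp only [e]
      refine tendsto_finsetSum _ fun σ _ =>
        Tendsto.smul ?_ (tendsto_prod_ofFn fun m => h _ (s.succAbove (σ m)))
      convert tendsto_neg_qSeq_pow _ using 3
      rw [Nat.add_eq_zero_iff]
      constructor
      · rintro rfl
        refine ⟨invCount_strictMono strictMono_id, ?_⟩
        simp only [Equiv.Perm.coe_one, id]
        rw [max_eq_add_sum_sub, Nat.sub_self]
      · exact fun e => Equiv.ext fun m =>
          congrFun (strictMono_of_invCount_eq_zero σ.injective e.1).eq_id m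
    have := tendsto_nhds_unique ((h r s).star) l
    simpa using this

end Limit

end QSU

namespace QSU

/-! ### The representations of the crystallized algebra -/

section CrystalRep

open Filter Topology

variable {n m : ℕ}

/-- The parameter `0`, which belongs to the crystallized algebra. -/
def qZero : Set.Ico (0 : ℝ) 1 := ⟨0, le_rfl, one_pos⟩

theorem tendsto_of_norm_sub_le {E : Type*} [SeminormedAddCommGroup E] {f : ℕ → E} {a : E}
    {g : ℕ → ℝ}
    (h : ∀ N, ‖f N - a‖ ≤ g N) (hg : Tendsto g atTop (𝓝 0)) : Tendsto f atTop (𝓝 a) :=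
  tendsto_iff_norm_sub_tendsto_zero.2 (squeeze_zero (fun _ => norm_nonneg _) h hg)

theorem tendsto_ann (k : Fin m) : Tendsto (fun N => ann (qSeq N) k) atTop (𝓝 (shift k)) := by
  have h : ∀ N, ‖ann (qSeq N) k - shift k‖ ≤ (qSeq N : ℝ) := fun N => by
    have h0 := (qSeq N).2.1
    have h1 := (qSeq N).2.2.le
    refine norm_le_of_apply_eq (d := fun x => (√(1 - (qSeq N : ℝ) ^ (2 * (x k + 1))) : ℂ) - 1)
      (g := fun x => x + Pi.single k 1) (add_left_injective _) (fun ξ x => ?_) h0 fun x => ?_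
    · rw [sub_apply, lp.coeFn_sub, Pi.sub_apply, ann_apply, shift_apply, sub_mul, one_mul]
    · have h2 : (qSeq N : ℝ) ^ (2 * (x k + 1)) ≤ qSeq N := by
        calc _ ≤ (qSeq N : ℝ) ^ 1 := pow_le_pow_of_le_one h0 h1 (by omega)
          _ = _ := pow_one _
      have h3 : (0 : ℝ) ≤ (qSeq N : ℝ) ^ (2 * (x k + 1)) := pow_nonneg h0 _
      rw [← Complex.ofReal_one, ← Complex.ofReal_sub, Complex.norm_real, Real.norm_eq_abs,
        abs_le]
      have h4 : √(1 - (qSeq N : ℝ) ^ (2 * (x k + 1))) ≤ 1 := Real.sqrt_le_one.2 (by linarith)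
      have h5 : 1 - (qSeq N : ℝ) ^ (2 * (x k + 1)) ≤ √(1 - (qSeq N : ℝ) ^ (2 * (x k + 1))) :=
        Real.le_sqrt_of_sq_le (by nlinarith)
      constructor <;> linarith
  exact tendsto_of_norm_sub_le h tendsto_qSeq

theorem proj_apply (k : Fin m) (ξ : H m) (x : Fin m → ℕ) :
    (1 - star (shift k) * shift k : Op m) ξ x = if x k = 0 then ξ x else 0 := by
  rw [sub_apply, lp.coeFn_sub, Pi.sub_apply, one_apply_eq_self, mul_apply_eq_comp, star_shift_apply]
  split_ifs with h
  · rw [sub_zero]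
  · rw [shift_apply, sub_single_add_single h, sub_self]

theorem tendsto_qPow (k : Fin m) :
    Tendsto (fun N => qPow (qSeq N) k) atTop (𝓝 (1 - star (shift k) * shift k)) := by
  have h : ∀ N, ‖qPow (qSeq N) k - (1 - star (shift k) * shift k)‖ ≤ (qSeq N : ℝ) := fun N => by
    have h0 := (qSeq N).2.1
    have h1 := (qSeq N).2.2.le
    refine norm_le_of_apply_eq
      (d := fun x => ((qSeq N : ℝ) : ℂ) ^ x k - if x k = 0 then 1 else 0)
      (g := id) Function.injective_id (fun ξ x => ?_) h0 fun x => ?_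
    · rw [sub_apply, lp.coeFn_sub, Pi.sub_apply, qPow_apply, proj_apply, sub_mul]
      simp
    · split_ifs with hx
      · simpa [hx] using h0
      · rw [sub_zero, norm_pow, Complex.norm_real, Real.norm_of_nonneg h0]
        exact pow_le_of_le_one h0 h1 hx
  exact tendsto_of_norm_sub_le h tendsto_qSeq

theorem crystalLimit_simpleMat (r : Fin n) (k : Fin m) :
    CrystalLimit (fun N => simpleMat (qSeq N) r k) (simpleEntry qZero r k) := by
  intro i j
  have e : ∀ N, crystal N (simpleMat (qSeq N) r k) i j =
      (if i = r.castSucc ∧ j = r.castSucc then ann (qSeq N) k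
      else if i = r.succ ∧ j = r.succ then star (ann (qSeq N) k)
      else if i = r.castSucc ∧ j = r.succ then qPow (qSeq N) k
      else if i = r.succ ∧ j = r.castSucc then qPow (qSeq N) k
      else if i = j then 1 else 0) := by
    intro N
    rw [crystal, simpleEntry_eq_blockMat (qSeq_ne_zero N)]
    unfold blockMat
    split_ifs with h1 h2 h3 h4 h5
    · rw [h1.1, h1.2, Nat.sub_self, pow_zero, inv_one, one_smul]
    · rw [h2.1, h2.2, Nat.sub_self, pow_zero, inv_one, one_smul]
    · rw [h3.1, h3.2, Fin.val_succ, Fin.val_castSucc, Nat.add_sub_cancel_left, pow_one,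
        inv_smul_smul₀]
      exact neg_ne_zero.2 (by exact_mod_cast qSeq_ne_zero N)
    · rw [h4.1, h4.2, Fin.val_succ, Fin.val_castSucc, Nat.sub_eq_zero_of_le (Nat.le_succ _),
        pow_zero, inv_one, one_smul]
    · rw [h5, Nat.sub_self, pow_zero, inv_one, one_smul]
    · rw [smul_zero]
  simp only [e, simpleEntry, qZero, if_true]
  split_ifs
  · exact tendsto_ann k
  · exact (tendsto_ann k).star
  · exact tendsto_qPow k
  · exact tendsto_qPow k
  · exact tendsto_const_nhds
  · exact tendsto_const_nhds

theorem crystalLimit_posEntry (L : List (Fin n × Fin m)) :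
    CrystalLimit (fun N => posEntry (qSeq N) L) (posEntry qZero L) := by
  induction L with
  | nil =>
    intro i j
    have : ∀ q : Set.Ico (0 : ℝ) 1, (posEntry q [] : Matrix (Fin (n + 1)) (Fin (n + 1)) (Op m)) i j
      = if i = j then 1 else 0 := fun q => rfl
    simp only [crystal, this]
    split_ifs with h
    · simp [h]
    · simp
  | cons p L ih =>
    have e : ∀ N, posEntry (qSeq N) (p :: L) = simpleMat (qSeq N) p.1 p.2 * posEntry (qSeq N) L :=
      fun N => conv_of_ne_zero (qSeq_ne_zero N) _ _
    simp only [e]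
    exact (crystalLimit_simpleMat p.1 p.2).mul ih

theorem crystalLimit_repMat (t : Fin n → Circle) (a : List (Fin n)) :
    CrystalLimit (fun N => repMat (qSeq N) t a) (repEntry qZero t a) := by
  have e : repEntry qZero t a =
      conv 0 (charEntry _ t) (posEntry qZero (List.ofFn fun k => (a.get k, k))) := by
    rw [← wordEntry_eq_posEntry]
    rfl
  simp only [repMat_of_ne_zero (qSeq_ne_zero _), e]
  exact (crystalLimit_charMat t).mul (crystalLimit_posEntry _)

theorem eq_qZero {q : Set.Ico (0 : ℝ) 1} (h : (q : ℝ) = 0) : q = qZero := Subtype.ext h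

/-- The operators `π_{t,a}(z_{i,j})` satisfy the relations of `A_q(n)`, for every word `a`. -/
theorem rel_repEntry (q : Set.Ico (0 : ℝ) 1) (t : Fin n → Circle) (a : List (Fin n)) :
    Rel q (repEntry q t a) := by
  by_cases h : (q : ℝ) = 0
  · obtain rfl := eq_qZero h
    exact Or.inl ⟨rfl, (crystalLimit_repMat t a).crystalRel
      (fun N => frt_repMat (qSeq_ne_zero N) t a) fun N => quantumRel_repMat (qSeq_ne_zero N) t a⟩
  · exact Or.inr ⟨h, quantumRel_repMat h t a⟩

end CrystalRep

end QSU

namespace QSU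

/-! ### Evaluation of a tensor factor of the Toeplitz algebra at the point `1` of the circle -/

section Evaluation

open Filter Topology
open scoped ENNReal

variable {m : ℕ}

theorem hasSum_geometric_sq {r : ℝ} (hr : r ∈ Set.Ico (0 : ℝ) 1) :
    HasSum (fun j : ℕ => (√(1 - r ^ 2) * r ^ j) ^ 2) 1 := by
  have h1 : r ^ 2 < 1 := by nlinarith [hr.1, hr.2]
  have := (hasSum_geometric_of_lt_one (sq_nonneg r) h1).mul_left (1 - r ^ 2)
  rw [mul_inv_cancel₀ (by linarith)] at this
  have e : (fun j : ℕ => (√(1 - r ^ 2) * r ^ j) ^ 2) = fun j => (1 - r ^ 2) * (r ^ 2) ^ j := by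
    funext j
    rw [mul_pow, Real.sq_sqrt (by linarith), pow_right_comm]
  rwa [e]

theorem hasSum_norm_sq {ι : Type*} (ξ : lp (fun _ : ι => ℂ) 2) :
    HasSum (fun x => ‖ξ x‖ ^ 2) (‖ξ‖ ^ 2) := by
  have h0 : 0 < (2 : ℝ≥0∞).toReal := by simp
  have := lp.hasSum_norm h0 ξ
  simpa using this

/-- The sum of the squares of the coordinates of `v ⊗ ξ` for a unit vector `v`. -/
theorem hasSum_tensor {r : ℝ} (hr : r ∈ Set.Ico (0 : ℝ) 1) (k : Fin (m + 1)) (ξ : H m) :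
    HasSum (fun x : Fin (m + 1) → ℕ =>
      ‖((√(1 - r ^ 2) * r ^ x k : ℝ) : ℂ) * ξ fun l => x (k.succAbove l)‖ ^ 2) (‖ξ‖ ^ 2) := by
  have h1 := hasSum_geometric_sq hr
  have h2 := hasSum_norm_sq ξ
  have h3 := h1.mul h2 (h1.summable.mul_of_nonneg h2.summable (fun _ => by positivity)
    fun _ => by positivity)
  rw [one_mul] at h3
  rw [← (Fin.insertNthEquiv (fun _ => ℕ) k).hasSum_iff]
  refine Eq.subst (motive := fun f => HasSum f _) (funext fun p => ?_) h3
  simp only [Function.comp_apply, Fin.insertNthEquiv_apply, Fin.insertNth_apply_same,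
    Fin.insertNth_apply_succAbove]
  rw [norm_mul, Complex.norm_real, Real.norm_eq_abs, ← sq_abs (√(1 - r ^ 2) * r ^ p.1)]
  exact (mul_pow _ _ 2).symm

/-- The isometry `ξ ↦ v ⊗ ξ`, where the unit vector `v = √(1 - r²) ∑_j r^j e_j`, an eigenvector of
the backward shift with eigenvalue `r`, is placed in the `k`-th factor. -/
noncomputable def coherent (r : Set.Ico (0 : ℝ) 1) (k : Fin (m + 1)) : H m →ₗᵢ[ℂ] H (m + 1) where
  toFun ξ := ⟨fun x => ((√(1 - (r : ℝ) ^ 2) * (r : ℝ) ^ x k : ℝ) : ℂ) * ξ fun l => x (k.succAbove l),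
    memℓp_gen (by simpa using (hasSum_tensor r.2 k ξ).summable)⟩
  map_add' ξ η := by ext x; exact mul_add _ _ _
  map_smul' c ξ := by ext x; exact mul_left_comm _ _ _
  norm_map' ξ := by
    rw [← sq_eq_sq₀ (norm_nonneg _) (norm_nonneg _)]
    exact (hasSum_norm_sq _).unique (hasSum_tensor r.2 k ξ)

/-- The isometry `coherent` as a bounded operator. -/
noncomputable def coherentOp (r : Set.Ico (0 : ℝ) 1) (k : Fin (m + 1)) : H m →L[ℂ] H (m + 1) :=
  (coherent r k).toContinuousLinearMap

theorem coherentOp_apply (r : Set.Ico (0 : ℝ) 1) (k : Fin (m + 1)) (ξ : H m)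
    (x : Fin (m + 1) → ℕ) : coherentOp r k ξ x =
      ((√(1 - (r : ℝ) ^ 2) * (r : ℝ) ^ x k : ℝ) : ℂ) * ξ fun l => x (k.succAbove l) := rfl

open ContinuousLinearMap in
theorem adjoint_coherentOp_comp (r : Set.Ico (0 : ℝ) 1) (k : Fin (m + 1)) :
    adjoint (coherentOp r k) ∘L coherentOp r k = 1 := by
  rw [← ContinuousLinearMap.norm_map_iff_adjoint_comp_self]
  exact (coherent r k).norm_map

theorem norm_coherentOp_comp (r : Set.Ico (0 : ℝ) 1) (k : Fin (m + 1)) (Y : Op m) :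
    ‖coherentOp r k ∘L Y‖ = ‖Y‖ :=
  (coherent r k).norm_toContinuousLinearMap_comp

/-- The coherent vectors are eigenvectors of the shift. -/
theorem shift_comp_coherentOp (r : Set.Ico (0 : ℝ) 1) (k : Fin (m + 1)) :
    shift k ∘L coherentOp r k = ((r : ℝ) : ℂ) • coherentOp r k := by
  refine ContinuousLinearMap.ext fun ξ => lp.ext (funext fun x => ?_)
  rw [ContinuousLinearMap.comp_apply, shift_apply, smul_apply, lp.coeFn_smul, Pi.smul_apply,
    coherentOp_apply, coherentOp_apply]
  have : (fun l => (x + Pi.single k 1 : Fin (m + 1) → ℕ) (k.succAbove l)) =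
      fun l => x (k.succAbove l) := funext fun l => by simp
  rw [this, Pi.add_apply, Pi.single_eq_same, pow_succ]
  push_cast
  rw [smul_eq_mul]
  ring

theorem shift_succAbove_comp_coherentOp (r : Set.Ico (0 : ℝ) 1) (k : Fin (m + 1)) (l : Fin m) :
    shift (k.succAbove l) ∘L coherentOp r k = coherentOp r k ∘L shift l := by
  refine ContinuousLinearMap.ext fun ξ => lp.ext (funext fun x => ?_)
  rw [ContinuousLinearMap.comp_apply, ContinuousLinearMap.comp_apply, shift_apply,
    coherentOp_apply, coherentOp_apply, shift_apply]
  have : (fun l' => (x + Pi.single (k.succAbove l) 1 : Fin (m + 1) → ℕ) (k.succAbove l')) =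
      (fun l' => x (k.succAbove l')) + Pi.single l 1 := funext fun l' => by
    simp [Pi.single_apply]
  rw [this, Pi.add_apply, Pi.single_eq_of_ne (Fin.succAbove_ne k l).symm, add_zero]

open ContinuousLinearMap in
/-- The coherent vectors are approximate eigenvectors of the adjoint of the shift,
with eigenvalue `1`. -/
theorem norm_star_shift_comp_coherentOp_sub (r : Set.Ico (0 : ℝ) 1) (k : Fin (m + 1)) :
    ‖star (shift k) ∘L coherentOp r k - coherentOp r k‖ ≤ √(2 * (1 - r)) := by
  set V := coherentOp r k
  set S := shift k
  have hV : adjoint V ∘L V = 1 := adjoint_coherentOp_comp r k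
  have hS : S ∘L star S = 1 := shift_mul_star_shift k
  have hSV : S ∘L V = ((r : ℝ) : ℂ) • V := shift_comp_coherentOp r k
  have hVS : adjoint V ∘L star S = ((r : ℝ) : ℂ) • adjoint V := by
    have := congrArg adjoint hSV
    rw [adjoint_comp, ← star_eq_adjoint S] at this
    rw [this, map_smulₛₗ, Complex.conj_ofReal]
  have e : adjoint (star S ∘L V - V) ∘L (star S ∘L V - V) = ((2 * (1 - (r : ℝ)) : ℝ) : ℂ) • 1 := by
    rw [map_sub, adjoint_comp, ← star_eq_adjoint (star S), star_star, sub_comp, comp_sub, comp_sub,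
      comp_assoc, ← comp_assoc S, hS, ← comp_assoc _ (star S), hVS, comp_assoc, hSV]
    simp only [one_def, id_comp, smul_comp, comp_smul, hV]
    push_cast
    module
  refine Real.le_sqrt_of_sq_le ?_
  rw [pow_two, ← norm_adjoint_comp_self, e, norm_smul, Complex.norm_real, Real.norm_of_nonneg
    (by linarith [r.2.2])]
  exact mul_le_of_le_one_right (by linarith [r.2.2]) norm_id_le

open ContinuousLinearMap in
theorem star_shift_succAbove_comp_coherentOp (r : Set.Ico (0 : ℝ) 1) (k : Fin (m + 1))
    (l : Fin m) :
    star (shift (k.succAbove l)) ∘L coherentOp r k = coherentOp r k ∘L star (shift l) := by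
  set V := coherentOp r k
  set S := shift (k.succAbove l)
  set T := shift l
  have hV : adjoint V ∘L V = 1 := adjoint_coherentOp_comp r k
  have hS : S ∘L star S = 1 := shift_mul_star_shift _
  have hT : T ∘L star T = 1 := shift_mul_star_shift _
  have hSV : S ∘L V = V ∘L T := shift_succAbove_comp_coherentOp r k l
  have hVS : adjoint V ∘L star S = star T ∘L adjoint V := by
    have := congrArg adjoint hSV
    rwa [adjoint_comp, adjoint_comp, ← star_eq_adjoint S, ← star_eq_adjoint T] at this
  have e : adjoint (star S ∘L V - V ∘L star T) ∘L (star S ∘L V - V ∘L star T) = 0 := by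
    rw [map_sub, adjoint_comp, adjoint_comp, ← star_eq_adjoint (star S), star_star,
      ← star_eq_adjoint (star T), star_star, sub_comp, comp_sub, comp_sub]
    have e1 : (adjoint V ∘L S) ∘L star S ∘L V = 1 := by
      rw [comp_assoc, ← comp_assoc S, hS]; exact hV
    have e2 : (adjoint V ∘L S) ∘L V ∘L star T = 1 := by
      rw [comp_assoc, ← comp_assoc S, hSV, comp_assoc, hT]; exact hV
    have e3 : (T ∘L adjoint V) ∘L star S ∘L V = 1 := by
      rw [comp_assoc, ← comp_assoc _ (star S), hVS, comp_assoc, hV]; exact hT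
    have e4 : (T ∘L adjoint V) ∘L V ∘L star T = 1 := by
      rw [comp_assoc, ← comp_assoc (adjoint V), hV]; exact hT
    rw [e1, e2, e3, e4, sub_self]
  rw [← sub_eq_zero, ← norm_eq_zero, ← mul_self_eq_zero, ← norm_adjoint_comp_self, e, norm_zero]

end Evaluation

end QSU

namespace QSU

/-! ### Asymptotic intertwiners and evaluation -/

section Evaluation

open Filter Topology
open scoped ENNReal

/-- `X` intertwines `Y` asymptotically along the isometries `W N`: the difference of `X ∘ W N` and
`W N ∘ Y` tends to `0` in norm. -/
def AsympInter {E F : Type*} [NormedAddCommGroup E] [NormedSpace ℂ E] [NormedAddCommGroup F]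
    [NormedSpace ℂ F] (W : ℕ → E →ₗᵢ[ℂ] F) (X : F →L[ℂ] F) (Y : E →L[ℂ] E) : Prop :=
  Tendsto (fun N => X ∘L (W N).toContinuousLinearMap - (W N).toContinuousLinearMap ∘L Y) atTop (𝓝 0)

namespace AsympInter

variable {E F : Type*} [NormedAddCommGroup E] [NormedSpace ℂ E] [NormedAddCommGroup F]
  [NormedSpace ℂ F] {W : ℕ → E →ₗᵢ[ℂ] F} {X X' : F →L[ℂ] F} {Y Y' : E →L[ℂ] E}

theorem add (h : AsympInter W X Y) (h' : AsympInter W X' Y') :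
    AsympInter W (X + X') (Y + Y') := by
  have := Tendsto.add h h'
  rw [add_zero] at this
  refine this.congr fun N => ?_
  rw [ContinuousLinearMap.add_comp, ContinuousLinearMap.comp_add]
  abel

theorem neg (h : AsympInter W X Y) : AsympInter W (-X) (-Y) := by
  have := Tendsto.neg h
  rw [neg_zero] at this
  refine this.congr fun N => ?_
  rw [ContinuousLinearMap.neg_comp, ContinuousLinearMap.comp_neg]
  abel

theorem sub (h : AsympInter W X Y) (h' : AsympInter W X' Y') :
    AsympInter W (X - X') (Y - Y') := by
  rw [sub_eq_add_neg, sub_eq_add_neg]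
  exact h.add h'.neg

theorem of_eq (h : ∀ N, X ∘L (W N).toContinuousLinearMap = (W N).toContinuousLinearMap ∘L Y) :
    AsympInter W X Y := by
  simp only [AsympInter, h, sub_self]
  exact tendsto_const_nhds

theorem scalar (W : ℕ → E →ₗᵢ[ℂ] F) (c : ℂ) :
    AsympInter W (algebraMap ℂ _ c) (algebraMap ℂ _ c) :=
  of_eq fun N => by
    rw [Algebra.algebraMap_eq_smul_one, Algebra.algebraMap_eq_smul_one,
      ContinuousLinearMap.smul_comp, ContinuousLinearMap.comp_smul, ContinuousLinearMap.one_def,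
      ContinuousLinearMap.one_def, ContinuousLinearMap.id_comp, ContinuousLinearMap.comp_id]

theorem mul (h : AsympInter W X Y) (h' : AsympInter W X' Y') :
    AsympInter W (X * X') (Y * Y') := by
  rw [AsympInter, tendsto_zero_iff_norm_tendsto_zero] at *
  have := (h'.const_mul ‖X‖).add (h.mul_const ‖Y'‖)
  rw [mul_zero, zero_mul, add_zero] at this
  refine squeeze_zero (fun _ => norm_nonneg _) (fun N => ?_) this
  set V := (W N).toContinuousLinearMap
  have e : (X * X') ∘L V - V ∘L (Y * Y') =
      X ∘L (X' ∘L V - V ∘L Y') + (X ∘L V - V ∘L Y) ∘L Y' := by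
    rw [ContinuousLinearMap.comp_sub, ContinuousLinearMap.sub_comp]
    change X ∘L X' ∘L _ - _ ∘L Y ∘L Y' = _
    rw [ContinuousLinearMap.comp_assoc, ContinuousLinearMap.comp_assoc, sub_add_sub_cancel]
  rw [e]
  exact (norm_add_le _ _).trans (add_le_add (ContinuousLinearMap.opNorm_comp_le _ _)
    (ContinuousLinearMap.opNorm_comp_le _ _))

theorem norm_comp_le (V : E →ₗᵢ[ℂ] F) (X : F →L[ℂ] F) : ‖X ∘L V.toContinuousLinearMap‖ ≤ ‖X‖ :=
  (ContinuousLinearMap.opNorm_comp_le _ _).trans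
    (mul_le_of_le_one_right (norm_nonneg _) V.norm_toContinuousLinearMap_le)

theorem norm_le (h : AsympInter W X Y) : ‖Y‖ ≤ ‖X‖ := by
  rw [AsympInter, tendsto_zero_iff_norm_tendsto_zero] at h
  have := h.const_add ‖X‖
  rw [add_zero] at this
  refine ge_of_tendsto' this fun N => ?_
  rw [← (W N).norm_toContinuousLinearMap_comp]
  set V := (W N).toContinuousLinearMap
  calc _ = ‖X ∘L V - (X ∘L V - V ∘L Y)‖ := by rw [sub_sub_cancel]
    _ ≤ _ := (norm_sub_le _ _).trans (add_le_add_left (norm_comp_le _ _) _)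

theorem unique (h : AsympInter W X Y) (h' : AsympInter W X Y') : Y = Y' := by
  have := (h.sub h').norm_le
  rw [sub_self, norm_zero] at this
  exact sub_eq_zero.1 (norm_le_zero_iff.1 this)

/-- The relation is closed in the norm topology. -/
theorem of_tendsto {x : ℕ → F →L[ℂ] F} {y : ℕ → E →L[ℂ] E} (h : ∀ i, AsympInter W (x i) (y i))
    (hx : Tendsto x atTop (𝓝 X)) (hy : Tendsto y atTop (𝓝 Y)) : AsympInter W X Y := by
  rw [AsympInter, tendsto_zero_iff_norm_tendsto_zero, Metric.tendsto_atTop]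
  intro ε hε
  rw [Metric.tendsto_atTop] at hx hy
  obtain ⟨i₁, hi₁⟩ := hx (ε / 3) (by positivity)
  obtain ⟨i₂, hi₂⟩ := hy (ε / 3) (by positivity)
  set i := max i₁ i₂
  have h1 := hi₁ i (le_max_left _ _)
  have h2 := hi₂ i (le_max_right _ _)
  have h3 := tendsto_zero_iff_norm_tendsto_zero.1 (h i)
  rw [Metric.tendsto_atTop] at h3
  obtain ⟨N₀, hN₀⟩ := h3 (ε / 3) (by positivity)
  refine ⟨N₀, fun N hN => ?_⟩
  have h4 := hN₀ N hN
  rw [Real.dist_0_eq_abs, abs_norm] at h4 ⊢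
  rw [dist_eq_norm, norm_sub_rev] at h1
  rw [dist_eq_norm] at h2
  have h5 := norm_comp_le (W N) (X - x i)
  have h6 := LinearIsometry.norm_toContinuousLinearMap_comp (f := W N) (g := y i - Y)
  set V := (W N).toContinuousLinearMap
  have e : X ∘L V - V ∘L Y =
      (X - x i) ∘L V + (x i ∘L V - V ∘L y i) + V ∘L (y i - Y) := by
    rw [ContinuousLinearMap.comp_sub, ContinuousLinearMap.sub_comp]
    abel
  rw [e]
  refine (norm_add₃_le).trans_lt ?_
  linarith

end AsympInter

variable {m : ℕ}

/-- A sequence of parameters that tends to `1`. -/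
noncomputable def rSeq (N : ℕ) : Set.Ico (0 : ℝ) 1 :=
  ⟨1 - qSeq N, by linarith [(qSeq N).2.2], by
    have := (qSeq N).2.1
    have h := qSeq_ne_zero N
    linarith [lt_of_le_of_ne this h.symm]⟩

/-- `Y` is the value of `X` when the backward shift of the `k`-th factor is replaced by `1`: on
vectors that are coherent in this factor, `X` acts as `Y` in the limit `r → 1`. -/
abbrev EvalRel (k : Fin (m + 1)) (X : Op (m + 1)) (Y : Op m) : Prop :=
  AsympInter (fun N => coherent (rSeq N) k) X Y

theorem evalRel_algebraMap (k : Fin (m + 1)) (c : ℂ) :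
    EvalRel k (algebraMap ℂ _ c) (algebraMap ℂ _ c) :=
  AsympInter.scalar _ c

theorem evalRel_shift_self (k : Fin (m + 1)) : EvalRel k (shift k) 1 := by
  refine tendsto_zero_iff_norm_tendsto_zero.2 ?_
  refine squeeze_zero (fun _ => norm_nonneg _) (fun N => ?_) tendsto_qSeq
  change ‖shift k ∘L coherentOp (rSeq N) k - coherentOp (rSeq N) k ∘L 1‖ ≤ _
  rw [shift_comp_coherentOp, ContinuousLinearMap.one_def, ContinuousLinearMap.comp_id]
  have e : (((rSeq N : ℝ) : ℂ)) • coherentOp (rSeq N) k - coherentOp (rSeq N) k =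
      (-(qSeq N : ℝ) : ℂ) • (coherentOp (rSeq N) k ∘L 1) := by
    rw [ContinuousLinearMap.one_def, ContinuousLinearMap.comp_id]
    simp only [rSeq]
    push_cast
    module
  rw [e, norm_smul, norm_coherentOp_comp, norm_neg, Complex.norm_real, Real.norm_of_nonneg
    (qSeq N).2.1]
  exact mul_le_of_le_one_right (qSeq N).2.1 ContinuousLinearMap.norm_id_le

theorem evalRel_star_shift_self (k : Fin (m + 1)) : EvalRel k (star (shift k)) 1 := by
  refine tendsto_zero_iff_norm_tendsto_zero.2 ?_
  have l : Tendsto (fun N => √(2 * (1 - (rSeq N : ℝ)))) atTop (𝓝 0) := by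
    have := ((tendsto_qSeq.const_mul 2).sqrt)
    rw [mul_zero, Real.sqrt_zero] at this
    simpa only [rSeq, sub_sub_cancel] using this
  refine squeeze_zero (fun _ => norm_nonneg _) (fun N => ?_) l
  change ‖star (shift k) ∘L coherentOp (rSeq N) k - coherentOp (rSeq N) k ∘L 1‖ ≤ _
  rw [ContinuousLinearMap.one_def, ContinuousLinearMap.comp_id]
  exact norm_star_shift_comp_coherentOp_sub _ _

theorem evalRel_shift_succAbove (k : Fin (m + 1)) (l : Fin m) :
    EvalRel k (shift (k.succAbove l)) (shift l) :=
  AsympInter.of_eq fun N => shift_succAbove_comp_coherentOp (rSeq N) k l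

theorem evalRel_star_shift_succAbove (k : Fin (m + 1)) (l : Fin m) :
    EvalRel k (star (shift (k.succAbove l))) (star (shift l)) :=
  AsympInter.of_eq fun N => star_shift_succAbove_comp_coherentOp (rSeq N) k l

theorem isClosed_toeplitzPow (m : ℕ) : IsClosed (toeplitzPow m : Set (Op m)) :=
  StarSubalgebra.isClosed_topologicalClosure _

theorem shift_mem_toeplitzPow (k : Fin m) : shift k ∈ toeplitzPow m := (toeplitzShift k).2

/-- The operators that have a value in the Toeplitz algebra of the remaining factors. -/
def evalDomain (k : Fin (m + 1)) : StarSubalgebra ℂ (Op (m + 1)) where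
  carrier := {X | ∃ Y ∈ toeplitzPow m, EvalRel k X Y ∧ EvalRel k (star X) (star Y)}
  mul_mem' := by
    rintro X X' ⟨Y, hY, h1, h2⟩ ⟨Y', hY', h1', h2'⟩
    exact ⟨Y * Y', mul_mem hY hY', h1.mul h1', by rw [star_mul, star_mul]; exact h2'.mul h2⟩
  add_mem' := by
    rintro X X' ⟨Y, hY, h1, h2⟩ ⟨Y', hY', h1', h2'⟩
    exact ⟨Y + Y', add_mem hY hY', h1.add h1', by rw [star_add, star_add]; exact h2.add h2'⟩
  algebraMap_mem' c := ⟨algebraMap ℂ _ c, algebraMap_mem _ c, evalRel_algebraMap k c, by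
    rw [← algebraMap_star_comm, ← algebraMap_star_comm]; exact evalRel_algebraMap k _⟩
  star_mem' := by
    rintro X ⟨Y, hY, h1, h2⟩
    exact ⟨star Y, star_mem hY, h2, by rwa [star_star, star_star]⟩

/-- The values form a Cauchy sequence by `AsympInter.norm_le`. -/
theorem isClosed_evalDomain (k : Fin (m + 1)) : IsClosed (evalDomain k : Set (Op (m + 1))) := by
  refine IsSeqClosed.isClosed fun x X hx hX => ?_
  choose y hy h1 h2 using hx
  have hc : CauchySeq y := by
    have := hX.cauchySeq
    rw [Metric.cauchySeq_iff] at this ⊢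
    intro ε hε
    obtain ⟨N, hN⟩ := this ε hε
    refine ⟨N, fun i hi j hj => ?_⟩
    have := hN i hi j hj
    rw [dist_eq_norm] at this ⊢
    exact ((h1 i).sub (h1 j)).norm_le.trans_lt this
  obtain ⟨Y, hY⟩ := cauchySeq_tendsto_of_complete hc
  exact ⟨Y, (isClosed_toeplitzPow m).mem_of_tendsto hY (Eventually.of_forall hy),
    AsympInter.of_tendsto h1 hX hY, AsympInter.of_tendsto h2 hX.star hY.star⟩

theorem toeplitzPow_le_evalDomain (k : Fin (m + 1)) : toeplitzPow (m + 1) ≤ evalDomain k := by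
  refine StarSubalgebra.topologicalClosure_minimal ?_ (isClosed_evalDomain k)
  rw [StarAlgebra.adjoin_le_iff]
  rintro _ ⟨l, rfl⟩
  by_cases h : l = k
  · subst h
    exact ⟨1, one_mem _, evalRel_shift_self l, by rw [star_one]; exact evalRel_star_shift_self l⟩
  · obtain ⟨l, rfl⟩ := Fin.exists_succAbove_eq h
    exact ⟨shift l, shift_mem_toeplitzPow l, evalRel_shift_succAbove k l,
      evalRel_star_shift_succAbove k l⟩

/-- Evaluation of one factor of the Toeplitz algebra at the point `1` of the circle. -/
theorem exists_eval_factor (k : Fin (m + 1)) :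
    ∃ ev : toeplitzPow (m + 1) →⋆ₐ[ℂ] toeplitzPow m,
      ev (toeplitzShift k) = 1 ∧ ∀ l, ev (toeplitzShift (k.succAbove l)) = toeplitzShift l := by
  choose f hf h1 h2 using fun X : toeplitzPow (m + 1) => toeplitzPow_le_evalDomain k X.2
  refine ⟨
    { toFun := fun X => ⟨f X, hf X⟩
      map_one' := Subtype.ext ((h1 1).unique (by simpa using evalRel_algebraMap k 1))
      map_mul' := fun X X' => Subtype.ext ((h1 (X * X')).unique ((h1 X).mul (h1 X')))
      map_zero' := Subtype.ext ((h1 0).unique (by simpa using evalRel_algebraMap k 0))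
      map_add' := fun X X' => Subtype.ext ((h1 (X + X')).unique ((h1 X).add (h1 X')))
      commutes' := fun c => Subtype.ext ((h1 _).unique (evalRel_algebraMap k c))
      map_star' := fun X => Subtype.ext ((h1 (star X)).unique (h2 X)) }, ?_, fun l => ?_⟩
  · exact Subtype.ext ((h1 _).unique (evalRel_shift_self k))
  · exact Subtype.ext ((h1 _).unique (evalRel_shift_succAbove k l))

/-- Evaluation at `1` of the factors outside of the range of `e`. -/
theorem exists_eval {m' m : ℕ} (e : Fin m' ↪o Fin m) :
    ∃ ev : toeplitzPow m →⋆ₐ[ℂ] toeplitzPow m', (∀ k, ev (toeplitzShift (e k)) = toeplitzShift k) ∧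
      ∀ k, k ∉ Set.range e → ev (toeplitzShift k) = 1 := by
  induction m with
  | zero =>
    obtain rfl : m' = 0 := by
      have := Fintype.card_le_of_injective e e.injective
      simpa using this
    exact ⟨StarAlgHom.id ℂ _, fun k => k.elim0, fun k => k.elim0⟩
  | succ m ih =>
    by_cases hs : Function.Surjective e
    · obtain rfl : m' = m + 1 := by
        have := Fintype.card_of_bijective (f := e) ⟨e.injective, hs⟩
        simpa using this
      have : ∀ k, e k = k := fun k => e.strictMono.apply_eq
      exact ⟨StarAlgHom.id ℂ _, fun k => by rw [this]; rfl, fun k hk => absurd (hs k) hk⟩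
    · obtain ⟨k, hk⟩ := not_forall.1 hs
      have hne : ∀ l, ∃ y, k.succAbove y = e l := fun l =>
        Fin.exists_succAbove_eq fun h => hk ⟨l, h⟩
      choose e' he' using hne
      obtain ⟨ev, hev, hev'⟩ := ih (OrderEmbedding.ofStrictMono e' fun a b hab =>
        (Fin.strictMono_succAbove k).lt_iff_lt.1 (by rw [he', he']; exact e.strictMono hab))
      obtain ⟨ev₁, h1, h2⟩ := exists_eval_factor k
      refine ⟨ev.comp ev₁, fun l => ?_, fun l hl => ?_⟩
      · rw [StarAlgHom.comp_apply, ← he', h2]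
        exact hev l
      · rw [StarAlgHom.comp_apply]
        by_cases hlk : l = k
        · rw [hlk, h1, map_one]
        · obtain ⟨y, rfl⟩ := Fin.exists_succAbove_eq hlk
          rw [h2]
          refine hev' y ?_
          rintro ⟨x, rfl⟩
          exact hl ⟨x, (he' x).symm⟩

end Evaluation

end QSU

namespace QSU

/-! ### The image of the representations in the Toeplitz algebra -/

section Toeplitz

open Filter Topology
open scoped ENNReal

variable {m m' : ℕ}

/-- The operator on the `k`-th tensor factor that is diagonal with entries `d`. -/
noncomputable def diagOp (d : ℕ → ℝ) (hd : ∀ j, |d j| ≤ 1) (k : Fin m) : Op m :=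
  weightedComp (fun x => d (x k)) (fun x => hd (x k)) id Function.injective_id

/-- The diagonal element with entries `d 0, …, d (M - 1), c, c, …`, written in terms of the
backward shift `s`. -/
noncomputable def diagApprox {B : Type*} [Ring B] [StarRing B] [Algebra ℂ B] (s : B) (c : ℝ) :
    ℕ → (ℕ → ℝ) → B
  | 0, _ => algebraMap ℂ B c
  | M + 1, d => (d 0 : ℂ) • (1 - star s * s) + star s * diagApprox s c M (fun j => d (j + 1)) * s

theorem diagApprox_one {B : Type*} [Ring B] [StarRing B] [Algebra ℂ B] (c : ℝ) (M : ℕ)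
    (d : ℕ → ℝ) : diagApprox (1 : B) c M d = algebraMap ℂ B c := by
  induction M generalizing d with
  | zero => rfl
  | succ M ih => simp [diagApprox, ih]

theorem diagOp_apply (d : ℕ → ℝ) (hd : ∀ j, |d j| ≤ 1) (k : Fin m) (ξ : H m) (x : Fin m → ℕ) :
    diagOp d hd k ξ x = (d (x k) : ℂ) * ξ x := rfl

/-- The diagonal operator splits into its entry at `0` and a shifted diagonal operator. -/
theorem diagOp_eq (d : ℕ → ℝ) (hd : ∀ j, |d j| ≤ 1) (k : Fin m) :
    diagOp d hd k = (d 0 : ℂ) • (1 - star (shift k) * shift k) +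
      star (shift k) * diagOp (fun j => d (j + 1)) (fun j => hd (j + 1)) k * shift k := by
  refine Op.ext_apply fun ξ x => ?_
  change _ = (d 0 : ℂ) * (ξ x - star (shift k) (shift k ξ) x) +
    star (shift k) (diagOp (fun j => d (j + 1)) (fun j => hd (j + 1)) k (shift k ξ)) x
  rw [star_shift_apply, star_shift_apply, diagOp_apply]
  split_ifs with h
  · rw [h]; ring
  · rw [diagOp_apply, shift_apply, sub_single_add_single h, Pi.sub_apply, Pi.single_eq_same,
      Nat.sub_add_cancel (Nat.one_le_iff_ne_zero.2 h)]
    ring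

theorem norm_shift_le (k : Fin m) : ‖shift k‖ ≤ 1 :=
  norm_le_of_apply_eq (d := fun _ => 1) (add_left_injective (Pi.single k 1))
    (fun ξ x => by rw [shift_apply, one_mul]) zero_le_one (by simp)

theorem norm_diagOp_sub_diagApprox_le (d : ℕ → ℝ) (hd : ∀ j, |d j| ≤ 1) (k : Fin m) (c : ℝ) {ε : ℝ}
    (hε : 0 ≤ ε) (M : ℕ) (h : ∀ j, M ≤ j → |d j - c| ≤ ε) :
    ‖diagOp d hd k - diagApprox (shift k) c M d‖ ≤ ε := by
  induction M generalizing d with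
  | zero =>
    refine norm_le_of_apply_eq (d := fun x => ((d (x k) - c : ℝ) : ℂ)) Function.injective_id
      (fun ξ x => ?_) hε fun x => ?_
    · change (d (x k) : ℂ) * ξ x - (c : ℂ) * ξ x = _
      push_cast
      exact (sub_mul _ _ _).symm
    · rw [Complex.norm_real, Real.norm_eq_abs]
      exact h _ (Nat.zero_le _)
  | succ M ih =>
    have e := ih (fun j => d (j + 1)) (fun j => hd (j + 1)) fun j hj => h _ (by omega)
    rw [diagOp_eq, diagApprox, add_sub_add_left_eq_sub, ← sub_mul, ← mul_sub]
    have h1 := norm_shift_le k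
    have h2 : ‖star (shift k)‖ ≤ 1 := (norm_star (shift k)).trans_le h1
    refine (norm_mul_le _ _).trans ((mul_le_of_le_one_right (norm_nonneg _) h1).trans ?_)
    exact (norm_mul_le _ _).trans ((mul_le_of_le_one_left (norm_nonneg _) h2).trans e)

theorem continuous_toeplitzPow_hom (ev : toeplitzPow m →⋆ₐ[ℂ] toeplitzPow m') : Continuous ev := by
  let _ := StarSubalgebra.cstarAlgebra (toeplitzPow m) (h_closed := isClosed_toeplitzPow m)
  let _ := StarSubalgebra.cstarAlgebra (toeplitzPow m') (h_closed := isClosed_toeplitzPow m')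
  exact AddMonoidHomClass.continuous_of_bound ev 1 fun x => by
    rw [one_mul]; exact NonUnitalStarAlgHom.norm_apply_le ev x

/-- `X` lies in the Toeplitz algebra and `ev` maps it to `Y`. -/
def EvTo (ev : toeplitzPow m →⋆ₐ[ℂ] toeplitzPow m') (X : Op m) (Y : Op m') : Prop :=
  ∃ hX : X ∈ toeplitzPow m, (ev ⟨X, hX⟩ : Op m') = Y

namespace EvTo

variable {ev : toeplitzPow m →⋆ₐ[ℂ] toeplitzPow m'} {X X' : Op m} {Y Y' : Op m'}

theorem add (h : EvTo ev X Y) (h' : EvTo ev X' Y') : EvTo ev (X + X') (Y + Y') := by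
  obtain ⟨hX, rfl⟩ := h
  obtain ⟨hX', rfl⟩ := h'
  exact ⟨add_mem hX hX', congrArg Subtype.val (map_add ev ⟨X, hX⟩ ⟨X', hX'⟩)⟩

theorem mul (h : EvTo ev X Y) (h' : EvTo ev X' Y') : EvTo ev (X * X') (Y * Y') := by
  obtain ⟨hX, rfl⟩ := h
  obtain ⟨hX', rfl⟩ := h'
  exact ⟨mul_mem hX hX', congrArg Subtype.val (map_mul ev ⟨X, hX⟩ ⟨X', hX'⟩)⟩

protected theorem star (h : EvTo ev X Y) : EvTo ev (star X) (star Y) := by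
  obtain ⟨hX, rfl⟩ := h
  have h1 := map_star ev ⟨X, hX⟩
  exact ⟨star_mem hX, congrArg Subtype.val h1⟩

theorem smul (c : ℂ) (h : EvTo ev X Y) : EvTo ev (c • X) (c • Y) := by
  obtain ⟨hX, rfl⟩ := h
  exact ⟨SMulMemClass.smul_mem c hX, congrArg Subtype.val (map_smul ev c ⟨X, hX⟩)⟩

theorem sub (h : EvTo ev X Y) (h' : EvTo ev X' Y') : EvTo ev (X - X') (Y - Y') := by
  obtain ⟨hX, rfl⟩ := h
  obtain ⟨hX', rfl⟩ := h'
  exact ⟨sub_mem hX hX', congrArg Subtype.val (map_sub ev ⟨X, hX⟩ ⟨X', hX'⟩)⟩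

theorem scalar (c : ℂ) : EvTo ev (algebraMap ℂ _ c) (algebraMap ℂ _ c) :=
  ⟨algebraMap_mem _ c, congrArg Subtype.val (AlgHomClass.commutes ev c)⟩

theorem one : EvTo ev 1 1 := by
  simpa using scalar (ev := ev) 1

theorem zero : EvTo ev 0 0 := by
  simpa using scalar (ev := ev) 0

theorem sum {ι : Type*} (s : Finset ι) {F : ι → Op m} {G : ι → Op m'}
    (h : ∀ i ∈ s, EvTo ev (F i) (G i)) : EvTo ev (∑ i ∈ s, F i) (∑ i ∈ s, G i) := by
  classical
  induction s using Finset.induction_on with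
  | empty => simpa using zero
  | insert a s ha ih =>
    rw [Finset.sum_insert ha, Finset.sum_insert ha]
    exact (h a (Finset.mem_insert_self a s)).add
      (ih fun i hi => h i (Finset.mem_insert_of_mem hi))

theorem of_tendsto {x : ℕ → Op m} {y : ℕ → Op m'} (h : ∀ i, EvTo ev (x i) (y i))
    (hx : Tendsto x atTop (𝓝 X)) (hy : Tendsto y atTop (𝓝 Y)) : EvTo ev X Y := by
  choose hm he using h
  have hX : X ∈ toeplitzPow m :=
    (isClosed_toeplitzPow m).mem_of_tendsto hx (Eventually.of_forall hm)
  have hc := continuous_toeplitzPow_hom ev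
  have hx' : Tendsto (fun i => (⟨x i, hm i⟩ : toeplitzPow m)) atTop (𝓝 ⟨X, hX⟩) :=
    tendsto_subtype_rng.2 hx
  have h1 := continuous_subtype_val.continuousAt.tendsto.comp
    (hc.continuousAt.tendsto.comp hx')
  refine ⟨hX, tendsto_nhds_unique h1 (hy.congr fun i => (he i).symm)⟩

theorem shift_self {k : Fin m} {k' : Fin m'} (h : ev (toeplitzShift k) = toeplitzShift k') :
    EvTo ev (shift k) (shift k') :=
  ⟨shift_mem_toeplitzPow k, congrArg Subtype.val h⟩

theorem shift_one {k : Fin m} (h : ev (toeplitzShift k) = 1) : EvTo ev (shift k) 1 :=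
  ⟨shift_mem_toeplitzPow k, congrArg Subtype.val h⟩

theorem diagApprox {s : Op m} {s' : Op m'} (h : EvTo ev s s') (c : ℝ) (M : ℕ) (d : ℕ → ℝ) :
    EvTo ev (diagApprox s c M d) (QSU.diagApprox s' c M d) := by
  induction M generalizing d with
  | zero => exact scalar _
  | succ M ih => exact ((one.sub (h.star.mul h)).smul _).add ((h.star.mul (ih _)).mul h)

end EvTo

theorem tendsto_diagApprox {d : ℕ → ℝ} (hd : ∀ j, |d j| ≤ 1) {c : ℝ}
    (hc : Tendsto d atTop (𝓝 c)) (k : Fin m) :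
    Tendsto (fun M => diagApprox (shift k) c M d) atTop (𝓝 (diagOp d hd k)) := by
  rw [Metric.tendsto_atTop] at hc ⊢
  intro ε hε
  obtain ⟨N, hN⟩ := hc (ε / 2) (by positivity)
  refine ⟨N, fun M hM => ?_⟩
  rw [dist_eq_norm, norm_sub_rev]
  refine (norm_diagOp_sub_diagApprox_le d hd k c (by positivity) M fun j hj => ?_).trans_lt
    (half_lt_self hε)
  have := hN j (hM.trans hj)
  rw [Real.dist_eq] at this
  exact this.le

variable {ev : toeplitzPow m →⋆ₐ[ℂ] toeplitzPow m'}

theorem EvTo.diagOp_self {d : ℕ → ℝ} (hd : ∀ j, |d j| ≤ 1) {c : ℝ} (hc : Tendsto d atTop (𝓝 c))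
    {k : Fin m} {k' : Fin m'} (h : ev (toeplitzShift k) = toeplitzShift k') :
    EvTo ev (diagOp d hd k) (diagOp d hd k') :=
  EvTo.of_tendsto (fun M => (EvTo.shift_self h).diagApprox c M d) (tendsto_diagApprox hd hc k)
    (tendsto_diagApprox hd hc k')

theorem EvTo.diagOp_limit {d : ℕ → ℝ} (hd : ∀ j, |d j| ≤ 1) {c : ℝ} (hc : Tendsto d atTop (𝓝 c))
    {k : Fin m} (h : ev (toeplitzShift k) = 1) :
    EvTo ev (diagOp d hd k) (algebraMap ℂ _ (c : ℂ)) := by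
  refine EvTo.of_tendsto (fun M => (EvTo.shift_one h).diagApprox c M d) (tendsto_diagApprox hd hc k)
    ?_
  simp only [diagApprox_one]
  exact tendsto_const_nhds

theorem abs_pow_le_one (q : Set.Ico (0 : ℝ) 1) (j : ℕ) : |(q : ℝ) ^ j| ≤ 1 := by
  rw [abs_of_nonneg (pow_nonneg q.2.1 _)]
  exact pow_le_one₀ q.2.1 q.2.2.le

theorem abs_sqrt_le_one (q : Set.Ico (0 : ℝ) 1) (j : ℕ) : |√(1 - (q : ℝ) ^ (2 * j))| ≤ 1 := by
  rw [abs_of_nonneg (Real.sqrt_nonneg _), Real.sqrt_le_one]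
  linarith [pow_nonneg q.2.1 (2 * j)]

theorem tendsto_qPow_entries (q : Set.Ico (0 : ℝ) 1) :
    Tendsto (fun j : ℕ => (q : ℝ) ^ j) atTop (𝓝 0) :=
  tendsto_pow_atTop_nhds_zero_of_lt_one q.2.1 q.2.2

theorem tendsto_sqrtOp_entries (q : Set.Ico (0 : ℝ) 1) :
    Tendsto (fun j : ℕ => √(1 - (q : ℝ) ^ (2 * j))) atTop (𝓝 1) := by
  have h := (tendsto_qPow_entries q).comp (tendsto_id.const_mul_atTop' (r := 2) (by norm_num))
  have := (h.const_sub 1).sqrt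
  simpa using this

theorem EvTo.simpleEntry_self (q : Set.Ico (0 : ℝ) 1) {n : ℕ} (r : Fin n) {k : Fin m} {k' : Fin m'}
    (h : ev (toeplitzShift k) = toeplitzShift k') (i j : Fin (n + 1)) :
    EvTo ev (simpleEntry q r k i j) (simpleEntry q r k' i j) := by
  have hS := EvTo.shift_self h
  have hQ : EvTo ev (qPow q k) (qPow q k') :=
    EvTo.diagOp_self (abs_pow_le_one q) (tendsto_qPow_entries q) h
  have hR : EvTo ev (sqrtOp q k) (sqrtOp q k') :=
    EvTo.diagOp_self (abs_sqrt_le_one q) (tendsto_sqrtOp_entries q) h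
  have hP := EvTo.one.sub (hS.star.mul hS)
  unfold simpleEntry
  split_ifs
  exacts [hS, hS.mul hR, hS.star, hR.mul hS.star, hP, hQ.smul _, hP, hQ, EvTo.one, EvTo.zero]

/-- Evaluation of the shift at `1` turns the elementary representation into the counit, because `q^N`
becomes `0` and `√(1 - q^{2N})` becomes `1`. -/
theorem EvTo.simpleEntry_one (q : Set.Ico (0 : ℝ) 1) {n : ℕ} (r : Fin n) {k : Fin m}
    (h : ev (toeplitzShift k) = 1) (i j : Fin (n + 1)) :
    EvTo ev (simpleEntry q r k i j) (counitMat i j) := by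
  have hS := EvTo.shift_one h
  have hQ : EvTo ev (qPow q k) 0 := by
    have := EvTo.diagOp_limit (abs_pow_le_one q) (tendsto_qPow_entries q) h
    rwa [Complex.ofReal_zero, map_zero] at this
  have hR : EvTo ev (sqrtOp q k) 1 := by
    have := EvTo.diagOp_limit (abs_sqrt_le_one q) (tendsto_sqrtOp_entries q) h
    rwa [Complex.ofReal_one, map_one] at this
  have hP : EvTo ev (1 - Star.star (shift k) * shift k) 0 := by
    simpa using EvTo.one.sub (hS.star.mul hS)
  have hne : r.castSucc ≠ r.succ := (Fin.castSucc_lt_succ).ne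
  unfold simpleEntry counitMat
  by_cases h1 : i = r.castSucc ∧ j = r.castSucc
  · rw [if_pos h1, if_pos (h1.1.trans h1.2.symm)]
    split_ifs
    · exact hS
    · simpa using hS.mul hR
  rw [if_neg h1]
  by_cases h2 : i = r.succ ∧ j = r.succ
  · rw [if_pos h2, if_pos (h2.1.trans h2.2.symm)]
    split_ifs
    · simpa using hS.star
    · simpa using hR.mul hS.star
  rw [if_neg h2]
  by_cases h3 : i = r.castSucc ∧ j = r.succ
  · rw [if_pos h3, if_neg fun e : i = j => hne (h3.1.symm.trans (e.trans h3.2))]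
    split_ifs
    · exact hP
    · simpa using hQ.smul (-((q : ℝ) : ℂ))
  rw [if_neg h3]
  by_cases h4 : i = r.succ ∧ j = r.castSucc
  · rw [if_pos h4, if_neg fun e : i = j => hne (h4.2.symm.trans (e.symm.trans h4.1))]
    split_ifs
    · exact hP
    · exact hQ
  rw [if_neg h4]
  split_ifs
  · exact EvTo.one
  · exact EvTo.zero

theorem EvTo.conv {q : ℝ} {n : ℕ} {X Y : Fin (n + 1) → Fin (n + 1) → Op m}
    {X' Y' : Fin (n + 1) → Fin (n + 1) → Op m'} (h : ∀ i j, EvTo ev (X i j) (X' i j))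
    (h' : ∀ i j, EvTo ev (Y i j) (Y' i j)) (i j : Fin (n + 1)) :
    EvTo ev (conv q X Y i j) (QSU.conv q X' Y' i j) := by
  unfold QSU.conv
  split_ifs
  · exact EvTo.sum _ fun k _ => (h i k).mul (h' k j)
  · exact EvTo.sum _ fun k _ => (h i k).mul (h' k j)

theorem conv_counitMat {n : ℕ} {B : Type*} [Ring B] (q : ℝ) (Y : Fin (n + 1) → Fin (n + 1) → B) :
    conv q counitMat Y = Y := by
  funext i j
  unfold conv counitMat
  split_ifs
  · rw [Finset.sum_eq_single_of_mem i (Finset.mem_Icc.2 ⟨min_le_left _ _, le_max_left _ _⟩)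
      fun k _ hk => by rw [if_neg hk.symm, zero_mul], if_pos rfl, one_mul]
  · rw [Finset.sum_eq_single_of_mem i (Finset.mem_univ i)
      fun k _ hk => by rw [if_neg hk.symm, zero_mul], if_pos rfl, one_mul]

/-- If `ev` evaluates the factors outside of the range of `e` at `1`, the corresponding letters are
deleted. -/
theorem EvTo.posEntry (q : Set.Ico (0 : ℝ) 1) {n : ℕ} {e : Fin m' → Fin m}
    (he : ∀ k, ev (toeplitzShift (e k)) = toeplitzShift k)
    (he' : ∀ k, k ∉ Set.range e → ev (toeplitzShift k) = 1) (f : Fin m → Fin n) (L : List (Fin m))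
    (L' : List (Fin m')) (hL : open Classical in L.filter (· ∈ Set.range e) = L'.map e)
    (i j : Fin (n + 1)) :
    EvTo ev (posEntry q (L.map fun k => (f k, k)) i j)
      (QSU.posEntry q (L'.map fun k => (f (e k), k)) i j) := by
  induction L generalizing L' i j with
  | nil =>
    obtain rfl : L' = [] := by simpa using hL.symm
    change EvTo ev (if i = j then 1 else 0) (if i = j then 1 else 0)
    split_ifs
    · exact EvTo.one
    · exact EvTo.zero
  | cons k L ih =>
    by_cases hk : k ∈ Set.range e
    · rw [List.filter_cons_of_pos (by simpa using hk)] at hL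
      cases L' with
      | nil => simp at hL
      | cons k' L' =>
        rw [List.map_cons, List.cons.injEq] at hL
        obtain ⟨rfl, hL⟩ := hL
        exact EvTo.conv (EvTo.simpleEntry_self q _ (he k')) (ih L' hL) i j
    · rw [List.filter_cons_of_neg (by simpa using hk)] at hL
      have := EvTo.conv (q := (q : ℝ)) (EvTo.simpleEntry_one q (f k) (he' k hk)) (ih L' hL) i j
      exact Eq.mp (congrArg (EvTo ev _) (congrFun (congrFun (conv_counitMat (q : ℝ) _) i) j)) this

theorem filter_finRange_mem_range (e : Fin m' ↪o Fin m) :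
    (open Classical in (List.finRange m).filter (· ∈ Set.range e)) = (List.finRange m').map e := by
  classical
  refine List.Perm.eq_of_pairwise (le := (· < ·)) (fun a b _ _ h h' => absurd h h'.asymm) ?_ ?_ ?_
  · exact (List.pairwise_lt_finRange m).filter _
  · exact (List.pairwise_map.2 ((List.pairwise_lt_finRange m').imp fun h => e.strictMono h))
  · refine (List.perm_ext_iff_of_nodup ((List.nodup_finRange m).filter _)
      ((List.nodup_finRange m').map e.injective)).2 fun k => ?_
    simp

theorem EvTo.repEntry (q : Set.Ico (0 : ℝ) 1) {n : ℕ} (t : Fin n → Circle) {a b : List (Fin n)}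
    (e : Fin b.length ↪o Fin a.length) (hb : ∀ k, b.get k = a.get (e k))
    {ev : toeplitzPow a.length →⋆ₐ[ℂ] toeplitzPow b.length}
    (he : ∀ k, ev (toeplitzShift (e k)) = toeplitzShift k)
    (he' : ∀ k, k ∉ Set.range e → ev (toeplitzShift k) = 1) (i j : Fin (n + 1)) :
    EvTo ev (repEntry q t a i j) (QSU.repEntry q t b i j) := by
  refine EvTo.conv (fun i j => ?_) (fun i j => ?_) i j
  · unfold charEntry
    split_ifs
    · exact EvTo.scalar _
    · exact EvTo.zero
  · rw [wordEntry_eq_posEntry, wordEntry_eq_posEntry, List.ofFn_eq_map, List.ofFn_eq_map]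
    simp only [hb]
    exact EvTo.posEntry q he he' a.get _ _ (filter_finRange_mem_range e) i j

end Toeplitz

section Aq

variable {q : ℝ} {n : ℕ}

/-- The star subalgebra generated by the `z_{i,j}` is dense in `A_q(n)`. -/
theorem Aq.induction_closed {p : Aq q n → Prop} (hz : ∀ i j, p (Aq.z q n i j))
    (hmul : ∀ x y, p x → p y → p (x * y)) (hadd : ∀ x y, p x → p y → p (x + y))
    (hstar : ∀ x, p x → p (star x)) (halg : ∀ c : ℂ, p (algebraMap ℂ _ c))
    (hcl : IsClosed {x | p x}) (x : Aq q n) : p x := by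
  obtain ⟨x, hx⟩ := x
  have hD : ∀ y (hy : y ∈ StarAlgebra.adjoin ℂ
      (Set.range fun p : Fin (n + 1) × Fin (n + 1) => univGen q n p.1 p.2)),
      p ⟨y, StarSubalgebra.le_topologicalClosure _ hy⟩ := fun y hy => by
    induction hy using StarAlgebra.adjoin_induction with
    | mem y hy =>
      obtain ⟨⟨i, j⟩, rfl⟩ := hy
      exact hz i j
    | algebraMap c => exact halg c
    | add x y hx hy h h' => exact hadd _ _ h h'
    | mul x y hx hy h h' => exact hmul _ _ h h'
    | star x hx h => exact hstar _ h
  have hx' := hx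
  rw [← SetLike.mem_coe, StarSubalgebra.topologicalClosure_coe, mem_closure_iff_seq_limit] at hx'
  obtain ⟨y, hy, hlim⟩ := hx'
  exact hcl.mem_of_tendsto (b := Filter.atTop)
    (f := fun N => (⟨y N, StarSubalgebra.le_topologicalClosure _ (hy N)⟩ : Aq q n))
    (tendsto_subtype_rng.2 hlim) (Filter.Eventually.of_forall fun N => hD _ (hy N))

theorem continuous_starAlgHom {A B : Type*} [CStarAlgebra A] [CStarAlgebra B] (f : A →⋆ₐ[ℂ] B) :
    Continuous f :=
  AddMonoidHomClass.continuous_of_bound f 1 fun x => by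
    rw [one_mul]; exact NonUnitalStarAlgHom.norm_apply_le f x

instance (m : ℕ) : Nontrivial (Op m) :=
  ⟨0, 1, fun h => by
    have := congrArg (fun A : Op m => A (ket 0) 0) h
    simp [ket_apply] at this⟩

/-- The representation `π_{t,a}` of `A_q(n)`. -/
noncomputable def rep (q : Set.Ico (0 : ℝ) 1) (t : Fin n → Circle) (a : List (Fin n)) :
    Aq q n →⋆ₐ[ℂ] Op a.length :=
  Aq.eval ⟨Op a.length, repEntry q t a, rel_repEntry q t a⟩

theorem rep_z (q : Set.Ico (0 : ℝ) 1) (t : Fin n → Circle) (a : List (Fin n))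
    (i j : Fin (n + 1)) : rep q t a (Aq.z q n i j) = repEntry q t a i j := rfl

theorem EvTo.rep (q : Set.Ico (0 : ℝ) 1) (t : Fin n → Circle) {a b : List (Fin n)}
    {ev : toeplitzPow a.length →⋆ₐ[ℂ] toeplitzPow b.length}
    (h : ∀ i j, EvTo ev (QSU.repEntry q t a i j) (QSU.repEntry q t b i j)) (x : Aq q n) :
    EvTo ev (QSU.rep q t a x) (QSU.rep q t b x) := by
  refine Aq.induction_closed (p := fun x => EvTo ev (QSU.rep q t a x) (QSU.rep q t b x))
    (fun i j => h i j) ?_ ?_ ?_ ?_ ?_ x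
  · intro x y hx hy
    simpa only [map_mul] using hx.mul hy
  · intro x y hx hy
    simpa only [map_add] using hx.add hy
  · intro x hx
    simpa only [map_star] using hx.star
  · intro c
    simpa only [AlgHomClass.commutes] using EvTo.scalar c
  · refine IsSeqClosed.isClosed fun x X hx hX => ?_
    exact EvTo.of_tendsto hx ((continuous_starAlgHom _).continuousAt.tendsto.comp hX)
      ((continuous_starAlgHom _).continuousAt.tendsto.comp hX)

end Aq

end QSU

namespace QSU

/-! ### A Fock basis for the braid relations -/

section Fock

variable {E : Type*} [NormedAddCommGroup E] [InnerProductSpace ℂ E] [CompleteSpace E]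

/-- The relations between the entries `x = z_{3,3}`, `y = z_{3,2}`, `w = -q⁻¹ z_{2,3}`, `p = z_{3,1}`
and `r = q⁻² z_{1,3}` of a quantum `3 × 3` matrix in the representation that belongs to the longest
element of `S_3`. They are invariant under exchanging `y` with `w` and `p` with `r`. -/
structure BraidRel {A : Type*} [Ring A] [StarRing A] [Algebra ℂ A] (q : ℂ) (x y w p r : A) :
    Prop where
  yx : y * x = q • (x * y)
  wx : w * x = q • (x * w)
  wy : w * y = y * w
  px : p * x = q • (x * p)
  py : p * y = q • (y * p)
  pw : p * w = w * p
  rx : r * x = q • (x * r)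
  rw : r * w = q • (w * r)
  ry : r * y = y * r
  xx : star x * x = (1 - q ^ 2) • 1 + q ^ 2 • (x * star x)
  xy : star x * y = q • (y * star x)
  xw : star x * w = q • (w * star x)
  yy : star y * y = y * star y + (1 - q ^ 2) • (p * p)
  ww : star w * w = w * star w + (1 - q ^ 2) • (r * r)
  yw : star y * w = w * star y

/-- A vector that is annihilated by the adjoints of `x`, `y` and `w`, and fixed by `p` and `r`. -/
structure IsVacuum (x y w p r : E →L[ℂ] E) (ω : E) : Prop where
  x : star x ω = 0
  y : star y ω = 0
  w : star w ω = 0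
  p : p ω = ω
  r : r ω = ω

/-- The unnormalised basis vectors `x^b y^c w^a ω`. -/
def fockVec (x y w : E →L[ℂ] E) (b c a : ℕ) (ω : E) : E := (x ^ b) ((y ^ c) ((w ^ a) ω))

variable {q : ℝ} {x y w p r : E →L[ℂ] E} {ω : E}

omit [CompleteSpace E] in
theorem pow_succ_apply' (x : E →L[ℂ] E) (b : ℕ) (ξ : E) : (x ^ (b + 1)) ξ = x ((x ^ b) ξ) := by
  rw [pow_succ', mul_apply_eq_comp]

omit [CompleteSpace E] in
theorem apply_pow_apply {u v : E →L[ℂ] E} {c : ℂ} (h : u * v = c • (v * u)) (b : ℕ) (ξ : E) :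
    u ((v ^ b) ξ) = c ^ b • (v ^ b) (u ξ) := by
  have h' : ∀ ξ, u (v ξ) = c • v (u ξ) := fun ξ => congrArg (fun A : E →L[ℂ] E => A ξ) h
  induction b with
  | zero => simp
  | succ b ih => rw [pow_succ_apply', pow_succ_apply', h', ih, map_smul, smul_smul, pow_succ']

omit [CompleteSpace E] in
theorem apply_pow_apply_of_commute {u v : E →L[ℂ] E} (h : u * v = v * u) (b : ℕ) (ξ : E) :
    u ((v ^ b) ξ) = (v ^ b) (u ξ) := by
  have := apply_pow_apply (c := 1) (by rw [h, one_smul]) b ξ (u := u) (v := v)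
  rwa [one_pow, one_smul] at this

namespace BraidRel

variable (h : BraidRel (q : ℂ) x y w p r)
include h

theorem symm : BraidRel (q : ℂ) x w y r p where
  yx := h.wx
  wx := h.yx
  wy := h.wy.symm
  px := h.rx
  py := h.rw
  pw := h.ry
  rx := h.px
  rw := h.py
  ry := h.pw
  xx := h.xx
  xy := h.xw
  xw := h.xy
  yy := h.ww
  ww := h.yy
  yw := by simpa using congrArg star h.yw

theorem star_yx : star y * x = (q : ℂ) • (x * star y) := by
  have := congrArg star h.xy
  simpa [star_smul] using this

theorem fockVec_swap (b c a : ℕ) (ω : E) : fockVec x w y b a c ω = fockVec x y w b c a ω := by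
  have : ((y ^ c) * (w ^ a)) ω = ((w ^ a) * (y ^ c)) ω := by
    rw [((show Commute w y from h.wy).pow_pow a c).eq]
  unfold fockVec
  rw [mul_apply_eq_comp, mul_apply_eq_comp] at this
  rw [this]

omit h [CompleteSpace E] in
theorem x_fockVec (b c a : ℕ) (ω : E) :
    x (fockVec x y w b c a ω) = fockVec x y w (b + 1) c a ω := by
  unfold fockVec
  rw [pow_succ_apply']

theorem y_fockVec (b c a : ℕ) (ω : E) :
    y (fockVec x y w b c a ω) = (q : ℂ) ^ b • fockVec x y w b (c + 1) a ω := by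
  unfold fockVec
  rw [apply_pow_apply h.yx, pow_succ_apply' y]

theorem p_fockVec (hω : IsVacuum x y w p r ω) (b c a : ℕ) :
    p (fockVec x y w b c a ω) = (q : ℂ) ^ (b + c) • fockVec x y w b c a ω := by
  unfold fockVec
  rw [apply_pow_apply h.px, apply_pow_apply h.py, apply_pow_apply_of_commute h.pw, hω.p, map_smul,
    smul_smul, pow_add]

theorem star_x_fockVec_zero (hω : IsVacuum x y w p r ω) (c a : ℕ) :
    star x (fockVec x y w 0 c a ω) = 0 := by
  unfold fockVec
  rw [pow_zero, one_apply_eq_self, apply_pow_apply h.xy, apply_pow_apply h.xw, hω.x]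
  simp

theorem star_x_fockVec (hω : IsVacuum x y w p r ω) (b c a : ℕ) :
    star x (fockVec x y w (b + 1) c a ω) =
      (1 - (q : ℂ) ^ (2 * (b + 1))) • fockVec x y w b c a ω := by
  have hx : ∀ ξ, star x (x ξ) = (1 - (q : ℂ) ^ 2) • ξ + (q : ℂ) ^ 2 • x (star x ξ) := fun ξ =>
    congrArg (fun A : E →L[ℂ] E => A ξ) h.xx
  induction b with
  | zero => rw [← x_fockVec, hx, h.star_x_fockVec_zero hω]; simp
  | succ b ih =>
    rw [← x_fockVec, hx, ih, map_smul, x_fockVec, smul_smul, ← add_smul]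
    congr 1
    ring

theorem star_y_fockVec_zero (hω : IsVacuum x y w p r ω) (b a : ℕ) :
    star y (fockVec x y w b 0 a ω) = 0 := by
  unfold fockVec
  rw [pow_zero, one_apply_eq_self, apply_pow_apply h.star_yx, apply_pow_apply_of_commute h.yw, hω.y]
  simp

theorem star_y_fockVec (hω : IsVacuum x y w p r ω) (b c a : ℕ) :
    star y (fockVec x y w b (c + 1) a ω) =
      ((q : ℂ) ^ b * (1 - (q : ℂ) ^ (2 * (c + 1)))) • fockVec x y w b c a ω := by
  have hy : ∀ ξ, star y (y ξ) = y (star y ξ) + (1 - (q : ℂ) ^ 2) • p (p ξ) := fun ξ =>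
    congrArg (fun A : E →L[ℂ] E => A ξ) h.yy
  -- Each commutation of `star y` with `y` contributes `(1 - q²) q^{2c}`, which telescopes.
  have key : ∀ c, star y ((y ^ (c + 1)) ((w ^ a) ω)) =
      (1 - (q : ℂ) ^ (2 * (c + 1))) • (y ^ c) ((w ^ a) ω) := fun c => by
    have hp : p (p ((y ^ c) ((w ^ a) ω))) = (q : ℂ) ^ (2 * c) • (y ^ c) ((w ^ a) ω) := by
      have := h.p_fockVec hω 0 c a
      simp only [fockVec, pow_zero, one_apply_eq_self, zero_add] at this
      rw [this, map_smul, this, smul_smul, two_mul, pow_add]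
    rw [pow_succ_apply', hy, hp, smul_smul]
    clear hp
    induction c with
    | zero =>
      rw [pow_zero, one_apply_eq_self, apply_pow_apply_of_commute h.yw, hω.y]
      simp
    | succ c ih =>
      have hp : p (p ((y ^ c) ((w ^ a) ω))) = (q : ℂ) ^ (2 * c) • (y ^ c) ((w ^ a) ω) := by
        have := h.p_fockVec hω 0 c a
        simp only [fockVec, pow_zero, one_apply_eq_self, zero_add] at this
        rw [this, map_smul, this, smul_smul, two_mul, pow_add]
      rw [pow_succ_apply', hy, hp, smul_smul, ih, map_smul, ← add_smul]
      congr 1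
      ring
  unfold fockVec
  rw [apply_pow_apply h.star_yx, key, map_smul, smul_smul]

end BraidRel

theorem IsVacuum.symm (h : IsVacuum x y w p r ω) : IsVacuum x w y r p ω :=
  ⟨h.x, h.w, h.y, h.r, h.p⟩

/-- The product of the numbers `√(1 - q^{2i})` for `1 ≤ i ≤ b`. -/
noncomputable def qNorm (q : ℝ) (b : ℕ) : ℝ := ∏ i ∈ Finset.range b, √(1 - q ^ (2 * (i + 1)))

theorem sqrt_pos_of_mem {q : ℝ} (hq : q ∈ Set.Ico (0 : ℝ) 1) (b : ℕ) :
    0 < √(1 - q ^ (2 * (b + 1))) := by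
  rw [Real.sqrt_pos, sub_pos]
  exact pow_lt_one₀ hq.1 hq.2 (by omega)

theorem qNorm_pos {q : ℝ} (hq : q ∈ Set.Ico (0 : ℝ) 1) (b : ℕ) : 0 < qNorm q b :=
  Finset.prod_pos fun i _ => sqrt_pos_of_mem hq i

theorem qNorm_succ (q : ℝ) (b : ℕ) :
    qNorm q (b + 1) = qNorm q b * √(1 - q ^ (2 * (b + 1))) := Finset.prod_range_succ _ _

/-- The normalised basis vectors. -/
noncomputable def fockBasis (q : ℝ) (x y w : E →L[ℂ] E) (b c a : ℕ) (ω : E) : E :=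
  (((qNorm q b * qNorm q c * qNorm q a)⁻¹ : ℝ) : ℂ) • fockVec x y w b c a ω

namespace BraidRel

variable (hq : q ∈ Set.Ico (0 : ℝ) 1)
include hq

omit [CompleteSpace E] in
theorem x_fockBasis (b c a : ℕ) (ω : E) : x (fockBasis q x y w b c a ω) =
    (√(1 - q ^ (2 * (b + 1))) : ℂ) • fockBasis q x y w (b + 1) c a ω := by
  have h1 := (qNorm_pos hq b).ne'
  have h4 := (sqrt_pos_of_mem hq b).ne'
  rw [fockBasis, fockBasis, map_smul, x_fockVec, smul_smul, ← Complex.ofReal_mul, qNorm_succ]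
  congr 2
  field_simp

variable (h : BraidRel (q : ℂ) x y w p r)
include h

omit hq in
theorem fockBasis_swap (b c a : ℕ) (ω : E) :
    fockBasis q x w y b a c ω = fockBasis q x y w b c a ω := by
  rw [fockBasis, fockBasis, h.fockVec_swap, mul_right_comm]

theorem y_fockBasis (b c a : ℕ) (ω : E) : y (fockBasis q x y w b c a ω) =
    (q ^ b * √(1 - q ^ (2 * (c + 1))) : ℂ) • fockBasis q x y w b (c + 1) a ω := by
  have h1 := (qNorm_pos hq c).ne'
  have h4 := (sqrt_pos_of_mem hq c).ne'
  rw [fockBasis, fockBasis, map_smul, h.y_fockVec, smul_smul, smul_smul, ← Complex.ofReal_pow,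
    ← Complex.ofReal_mul, ← Complex.ofReal_mul, ← Complex.ofReal_mul, qNorm_succ]
  congr 2
  field_simp

omit hq in
theorem p_fockBasis (hω : IsVacuum x y w p r ω) (b c a : ℕ) :
    p (fockBasis q x y w b c a ω) = (q : ℂ) ^ (b + c) • fockBasis q x y w b c a ω := by
  rw [fockBasis, map_smul, h.p_fockVec hω, smul_comm]

omit hq in
theorem star_x_fockBasis_zero (hω : IsVacuum x y w p r ω) (c a : ℕ) :
    star x (fockBasis q x y w 0 c a ω) = 0 := by
  rw [fockBasis, map_smul, h.star_x_fockVec_zero hω, smul_zero]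

omit hq in
theorem star_y_fockBasis_zero (hω : IsVacuum x y w p r ω) (b a : ℕ) :
    star y (fockBasis q x y w b 0 a ω) = 0 := by
  rw [fockBasis, map_smul, h.star_y_fockVec_zero hω, smul_zero]

theorem star_x_fockBasis (hω : IsVacuum x y w p r ω) (b c a : ℕ) :
    star x (fockBasis q x y w (b + 1) c a ω) =
      (√(1 - q ^ (2 * (b + 1))) : ℂ) • fockBasis q x y w b c a ω := by
  have h1 := (qNorm_pos hq b).ne'
  have h4 := (sqrt_pos_of_mem hq b).ne'
  have h5 := ofReal_sqrt_mul_self hq (2 * (b + 1))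
  rw [fockBasis, fockBasis, map_smul, h.star_x_fockVec hω, smul_smul, smul_smul, ← h5,
    ← Complex.ofReal_mul, ← Complex.ofReal_mul, ← Complex.ofReal_mul, qNorm_succ]
  congr 2
  field_simp

theorem star_y_fockBasis (hω : IsVacuum x y w p r ω) (b c a : ℕ) :
    star y (fockBasis q x y w b (c + 1) a ω) =
      (q ^ b * √(1 - q ^ (2 * (c + 1))) : ℂ) • fockBasis q x y w b c a ω := by
  have h1 := (qNorm_pos hq c).ne'
  have h4 := (sqrt_pos_of_mem hq c).ne'
  have h5 := ofReal_sqrt_mul_self hq (2 * (c + 1))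
  rw [fockBasis, fockBasis, map_smul, h.star_y_fockVec hω, smul_smul, smul_smul, ← h5,
    ← Complex.ofReal_pow, ← Complex.ofReal_mul, ← Complex.ofReal_mul, ← Complex.ofReal_mul,
    ← Complex.ofReal_mul, ← Complex.ofReal_mul, qNorm_succ]
  congr 2
  field_simp

theorem w_fockBasis (b c a : ℕ) (ω : E) : w (fockBasis q x y w b c a ω) =
    (q ^ b * √(1 - q ^ (2 * (a + 1))) : ℂ) • fockBasis q x y w b c (a + 1) ω := by
  rw [← h.fockBasis_swap, ← h.fockBasis_swap, h.symm.y_fockBasis hq]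

omit hq in
theorem r_fockBasis (hω : IsVacuum x y w p r ω) (b c a : ℕ) :
    r (fockBasis q x y w b c a ω) = (q : ℂ) ^ (b + a) • fockBasis q x y w b c a ω := by
  rw [← h.fockBasis_swap, h.symm.p_fockBasis hω.symm]

omit hq in
theorem star_w_fockBasis_zero (hω : IsVacuum x y w p r ω) (b c : ℕ) :
    star w (fockBasis q x y w b c 0 ω) = 0 := by
  rw [← h.fockBasis_swap, h.symm.star_y_fockBasis_zero hω.symm]

theorem star_w_fockBasis (hω : IsVacuum x y w p r ω) (b c a : ℕ) :
    star w (fockBasis q x y w b c (a + 1) ω) =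
      (q ^ b * √(1 - q ^ (2 * (a + 1))) : ℂ) • fockBasis q x y w b c a ω := by
  rw [← h.fockBasis_swap, ← h.fockBasis_swap, h.symm.star_y_fockBasis hq hω.symm]

end BraidRel

/-- Two sequences of vectors on which `u` acts as the same weighted shift, and whose first terms
are annihilated by the adjoint of `u`. -/
theorem inner_of_weightedShift {u : E →L[ℂ] E} {s : ℕ → ℝ} (hs : ∀ b, s b ≠ 0) {f g : ℕ → E}
    (hf : ∀ b, u (f b) = (s b : ℂ) • f (b + 1)) (hg : ∀ b, u (g b) = (s b : ℂ) • g (b + 1))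
    (hf0 : star u (f 0) = 0) (hg0 : star u (g 0) = 0)
    (hg1 : ∀ b, star u (g (b + 1)) = (s b : ℂ) • g b) (b b' : ℕ) :
    inner ℂ (f b) (g b') = if b = b' then inner ℂ (f 0) (g 0) else 0 := by
  have e1 : ∀ b (η : E), (s b : ℂ) * inner ℂ (f (b + 1)) η = inner ℂ (f b) (star u η) :=
    fun b η => by
      rw [ContinuousLinearMap.star_eq_adjoint, ContinuousLinearMap.adjoint_inner_right, hf,
        inner_smul_left, Complex.conj_ofReal]
  have e2 : ∀ b (η : E), (s b : ℂ) * inner ℂ η (g (b + 1)) = inner ℂ (star u η) (g b) :=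
    fun b η => by
      rw [ContinuousLinearMap.star_eq_adjoint, ContinuousLinearMap.adjoint_inner_left, hg,
        inner_smul_right]
  have hs' : ∀ b, (s b : ℂ) ≠ 0 := fun b => by exact_mod_cast hs b
  induction b generalizing b' with
  | zero =>
    cases b' with
    | zero => simp
    | succ b' =>
      have := e2 b' (f 0)
      rw [hf0, inner_zero_left] at this
      simpa [hs' b'] using this
  | succ b ih =>
    cases b' with
    | zero =>
      have := e1 b (g 0)
      rw [hg0, inner_zero_right] at this
      simpa [hs' b] using this
    | succ b' =>
      by_cases hb : b = b'
      · subst hb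
        have := e1 b (g (b + 1))
        rw [hg1, inner_smul_right, ih] at this
        simpa using mul_left_cancel₀ (hs' b) this
      · have := e1 b (g (b' + 1))
        rw [hg1, inner_smul_right, ih, if_neg hb, mul_zero] at this
        rw [if_neg (by omega)]
        exact (mul_eq_zero.1 this).resolve_left (hs' b)

/-- The relations and the vacuum conditions determine the inner products of the basis vectors. -/
theorem BraidRel.inner_fockBasis (h : BraidRel (q : ℂ) x y w p r) (hq : q ∈ Set.Ico (0 : ℝ) 1)
    {ω' : E} (hω : IsVacuum x y w p r ω) (hω' : IsVacuum x y w p r ω') (b c a b' c' a' : ℕ) :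
    inner ℂ (fockBasis q x y w b c a ω) (fockBasis q x y w b' c' a' ω') =
      if b = b' ∧ c = c' ∧ a = a' then inner ℂ ω ω' else 0 := by
  have hs : ∀ b, √(1 - q ^ (2 * (b + 1))) ≠ 0 := fun b => (sqrt_pos_of_mem hq b).ne'
  rw [inner_of_weightedShift (u := x) hs (f := fun b => fockBasis q x y w b c a ω)
    (g := fun b => fockBasis q x y w b c' a' ω') (fun b => x_fockBasis hq b c a ω)
    (fun b => x_fockBasis hq b c' a' ω') (h.star_x_fockBasis_zero hω c a)
    (h.star_x_fockBasis_zero hω' c' a') (fun b => h.star_x_fockBasis hq hω' b c' a'),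
    inner_of_weightedShift (u := y) hs (f := fun c => fockBasis q x y w 0 c a ω)
    (g := fun c => fockBasis q x y w 0 c a' ω') (fun c => by simpa using h.y_fockBasis hq 0 c a ω)
    (fun c => by simpa using h.y_fockBasis hq 0 c a' ω') (h.star_y_fockBasis_zero hω 0 a)
    (h.star_y_fockBasis_zero hω' 0 a') (fun c => by simpa using h.star_y_fockBasis hq hω' 0 c a'),
    inner_of_weightedShift (u := w) hs (f := fun a => fockBasis q x y w 0 0 a ω)
    (g := fun a => fockBasis q x y w 0 0 a ω') (fun a => by simpa using h.w_fockBasis hq 0 0 a ω)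
    (fun a => by simpa using h.w_fockBasis hq 0 0 a ω') (h.star_w_fockBasis_zero hω 0 0)
    (h.star_w_fockBasis_zero hω' 0 0) (fun a => by simpa using h.star_w_fockBasis hq hω' 0 0 a)]
  have e : ∀ ω : E, fockBasis q x y w 0 0 0 ω = ω := fun ω => by
    simp [fockBasis, fockVec, qNorm]
  rw [e, e]
  split_ifs <;> simp_all

end Fock

end QSU

namespace QSU

/-! ### Three `q`-oscillators -/

section Oscillators

variable {A : Type*} [Ring A] [StarRing A] [Algebra ℂ A] [StarModule ℂ A]

/-- Three commuting `q`-oscillators with annihilation operators `a i` and self-adjoint operators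
`k i = q^N`. -/
structure OscFamily (q : ℝ) (a k : Fin 3 → A) : Prop where
  star_k : ∀ i, star (k i) = k i
  ak : ∀ i, a i * k i = (q : ℂ) • (k i * a i)
  as : ∀ i, a i * star (a i) = 1 - (q : ℂ) ^ 2 • (k i * k i)
  sa : ∀ i, star (a i) * a i = 1 - k i * k i
  aa : ∀ i j, i ≠ j → Commute (a i) (a j)
  asc : ∀ i j, i ≠ j → Commute (a i) (star (a j))
  akc : ∀ i j, i ≠ j → Commute (a i) (k j)
  kk : ∀ i j, Commute (k i) (k j)

variable {q : ℝ} {a k : Fin 3 → A}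

namespace OscFamily

/-- The entry `z_{3,3}` for the word `s_2 s_1 s_2`. -/
def entryX (q : ℝ) (a k : Fin 3 → A) : A :=
  star (a 0) * star (a 2) - (q : ℂ) • (k 0 * (star (a 1) * k 2))

/-- The entry `z_{3,2}` for the word `s_2 s_1 s_2`. -/
def entryY (a k : Fin 3 → A) : A := k 0 * (star (a 1) * a 2) + star (a 0) * k 2

/-- The entry `-q⁻¹ z_{2,3}` for the word `s_2 s_1 s_2`. -/
def entryW (a k : Fin 3 → A) : A := a 0 * (star (a 1) * k 2) + k 0 * star (a 2)

variable (h : OscFamily q a k)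
include h

theorem ka (i : Fin 3) : k i * star (a i) = (q : ℂ) • (star (a i) * k i) := by
  have := congrArg star (h.ak i)
  simpa [h.star_k] using this

/-- The commutation rules that bring a product of oscillator operators into normal order. -/
theorem normalOrder :
    (∀ i j, j < i → a i * a j = a j * a i) ∧
    (∀ i j, j < i → ∀ t, a i * (a j * t) = a j * (a i * t)) ∧
    (∀ i j, j < i → star (a i) * star (a j) = star (a j) * star (a i)) ∧
    (∀ i j, j < i → ∀ t, star (a i) * (star (a j) * t) = star (a j) * (star (a i) * t)) ∧
    (∀ i j, j < i → star (a i) * a j = a j * star (a i)) ∧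
    (∀ i j, j < i → ∀ t, star (a i) * (a j * t) = a j * (star (a i) * t)) ∧
    (∀ i j, j < i → a i * star (a j) = star (a j) * a i) ∧
    (∀ i j, j < i → ∀ t, a i * (star (a j) * t) = star (a j) * (a i * t)) ∧
    (∀ i j, j < i → a i * k j = k j * a i) ∧
    (∀ i j, j < i → ∀ t, a i * (k j * t) = k j * (a i * t)) ∧
    (∀ i j, j < i → k i * a j = a j * k i) ∧
    (∀ i j, j < i → ∀ t, k i * (a j * t) = a j * (k i * t)) ∧
    (∀ i j, j < i → star (a i) * k j = k j * star (a i)) ∧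
    (∀ i j, j < i → ∀ t, star (a i) * (k j * t) = k j * (star (a i) * t)) ∧
    (∀ i j, j < i → k i * star (a j) = star (a j) * k i) ∧
    (∀ i j, j < i → ∀ t, k i * (star (a j) * t) = star (a j) * (k i * t)) ∧
    (∀ i j, j < i → k i * k j = k j * k i) ∧
    (∀ i j, j < i → ∀ t, k i * (k j * t) = k j * (k i * t)) ∧
    (∀ i, ∀ t, a i * (k i * t) = (q : ℂ) • (k i * (a i * t))) ∧
    (∀ i, ∀ t, k i * (star (a i) * t) = (q : ℂ) • (star (a i) * (k i * t))) ∧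
    (∀ i, ∀ t, a i * (star (a i) * t) = t - (q : ℂ) ^ 2 • (k i * (k i * t))) ∧
    (∀ i, ∀ t, star (a i) * (a i * t) = t - k i * (k i * t)) := by
  have ks : ∀ i j, i ≠ j → Commute (star (a i)) (k j) := fun i j hij => by
    simpa [h.star_k] using (h.akc i j hij).star_star
  refine ⟨fun i j l => h.aa _ _ l.ne', fun i j l => (h.aa _ _ l.ne').left_comm,
    fun i j l => (h.aa _ _ l.ne').star_star, fun i j l => (h.aa _ _ l.ne').star_star.left_comm,
    fun i j l => (h.asc _ _ l.ne).symm, fun i j l => (h.asc _ _ l.ne).symm.left_comm,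
    fun i j l => h.asc _ _ l.ne', fun i j l => (h.asc _ _ l.ne').left_comm,
    fun i j l => h.akc _ _ l.ne', fun i j l => (h.akc _ _ l.ne').left_comm,
    fun i j l => (h.akc _ _ l.ne).symm, fun i j l => (h.akc _ _ l.ne).symm.left_comm,
    fun i j l => ks _ _ l.ne', fun i j l => (ks _ _ l.ne').left_comm,
    fun i j l => (ks _ _ l.ne).symm, fun i j l => (ks _ _ l.ne).symm.left_comm,
    fun i j l => h.kk _ _, fun i j l => (h.kk _ _).left_comm,
    fun i t => ?_, fun i t => ?_, fun i t => ?_, fun i t => ?_⟩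
  · rw [← mul_assoc, h.ak, smul_mul_assoc, mul_assoc]
  · rw [← mul_assoc, h.ka, smul_mul_assoc, mul_assoc]
  · rw [← mul_assoc, h.as, sub_mul, one_mul, smul_mul_assoc, mul_assoc]
  · rw [← mul_assoc, h.sa, sub_mul, one_mul, mul_assoc]

/-- The relations in the representation of the word `s_2 s_1 s_2`. -/
theorem braidRel : BraidRel (q : ℂ) (entryX q a k) (entryY a k) (entryW a k) (k 0 * k 1)
    (k 1 * k 2) := by
  have l10 : (0 : Fin 3) < 1 := by decide
  have l20 : (0 : Fin 3) < 2 := by decide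
  have l21 : (1 : Fin 3) < 2 := by decide
  have hs : star (q : ℂ) = q := Complex.conj_ofReal q
  constructor
  all_goals
    simp only [entryX, entryY, entryW, star_add, star_sub, star_mul, star_smul, star_star, h.star_k,
      hs, mul_add, add_mul, mul_sub, sub_mul, smul_mul_assoc, mul_smul_comm, mul_assoc, smul_sub,
      smul_add, smul_smul, h.ak, h.ka, h.as, h.sa, h.normalOrder, l10, l20, l21, mul_one]
    try module

end OscFamily

end Oscillators

end QSU

namespace QSU

/-! ### The isometry of a braid move -/

section BraidIsometry

variable {m : ℕ} (q : Set.Ico (0 : ℝ) 1)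

theorem qPow_ket (k : Fin m) (α : Fin m → ℕ) :
    qPow q k (ket α) = ((q : ℝ) : ℂ) ^ α k • ket α := by
  refine lp.ext (funext fun x => ?_)
  rw [qPow_apply, lp.coeFn_smul, Pi.smul_apply, ket_apply, smul_eq_mul]
  split_ifs with h
  · rw [h]
  · simp

theorem sqrtOp_ket (k : Fin m) (α : Fin m → ℕ) :
    sqrtOp q k (ket α) = (√(1 - (q : ℝ) ^ (2 * α k)) : ℂ) • ket α := by
  refine lp.ext (funext fun x => ?_)
  rw [sqrtOp_apply, lp.coeFn_smul, Pi.smul_apply, ket_apply, smul_eq_mul]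
  split_ifs with h
  · rw [h]
  · simp

theorem shift_ket_add (k : Fin m) (α : Fin m → ℕ) :
    shift k (ket (α + Pi.single k 1)) = ket α := by
  rw [shift_ket, if_neg (by simp), add_tsub_cancel_right]

theorem ann_ket_of_eq_zero {k : Fin m} {α : Fin m → ℕ} (h : α k = 0) :
    ann q k (ket α) = 0 := by
  rw [ann, mul_apply_eq_comp, sqrtOp_ket, map_smul, shift_ket, if_pos h, smul_zero]

theorem ann_ket_add (k : Fin m) (α : Fin m → ℕ) : ann q k (ket (α + Pi.single k 1)) =
    (√(1 - (q : ℝ) ^ (2 * (α k + 1))) : ℂ) • ket α := by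
  rw [ann, mul_apply_eq_comp, sqrtOp_ket, map_smul, shift_ket_add]
  simp

theorem star_ann_ket (k : Fin m) (α : Fin m → ℕ) : star (ann q k) (ket α) =
    (√(1 - (q : ℝ) ^ (2 * (α k + 1))) : ℂ) • ket (α + Pi.single k 1) := by
  rw [star_ann, mul_apply_eq_comp, star_shift_ket, sqrtOp_ket]
  simp

theorem exists_eq_add_single {k : Fin m} {α : Fin m → ℕ} (h : α k ≠ 0) :
    ∃ β : Fin m → ℕ, α = β + Pi.single k 1 :=
  ⟨α - Pi.single k 1, (sub_single_add_single h).symm⟩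

theorem oscFamily {e : Fin 3 → Fin m} (he : Function.Injective e) :
    OscFamily (q : ℝ) (fun i => ann q (e i)) (fun i => qPow q (e i)) where
  star_k _ := star_qPow q _
  ak _ := ann_mul_qPow q _
  as _ := ann_mul_star_ann q _
  sa _ := star_ann_mul_ann q _
  aa i j hij := by
    have h := he.ne hij
    exact ((commuteFactor_shift q h).shift.mul_left (commuteFactor_shift q h).sqrtOp).mul_right
      ((commuteFactor_sqrtOp q h).shift.mul_left (commuteFactor_sqrtOp q h).sqrtOp)
  asc i j hij := by
    have h := he.ne hij
    rw [star_ann]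
    exact ((commuteFactor_sqrtOp q h).shift.mul_left (commuteFactor_sqrtOp q h).sqrtOp).mul_right
      ((commuteFactor_shift q h).star.shift.mul_left (commuteFactor_shift q h).star.sqrtOp)
  akc i j hij := by
    have h := he.ne hij
    exact (commuteFactor_qPow q h).shift.mul_left (commuteFactor_qPow q h).sqrtOp
  kk i j := commute_of_diagonal (qPow_apply q _) (qPow_apply q _)

variable (e : Fin 3 → Fin m)

/-- The lattice point `α` with the coordinates at the three positions `e i` replaced by `0`. -/
noncomputable def outer (α : Fin m → ℕ) : Fin m → ℕ :=
  open Classical in fun l => if l ∈ Set.range e then 0 else α l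

theorem outer_apply_self (α : Fin m → ℕ) (i : Fin 3) : outer e α (e i) = 0 := by
  simp [outer]

theorem outer_apply_of_notMem (α : Fin m → ℕ) {l : Fin m} (h : l ∉ Set.range e) :
    outer e α l = α l := by
  rw [outer, if_neg h]

theorem outer_add_self (α : Fin m → ℕ) (i : Fin 3) :
    outer e (α + Pi.single (e i) 1) = outer e α := by
  classical
  funext l
  unfold outer
  split_ifs with h
  · rfl
  · have : l ≠ e i := fun h' => h ⟨i, h'.symm⟩
    simp [this]

theorem outer_add_of_notMem (α : Fin m → ℕ) {l : Fin m} (hl : l ∉ Set.range e) :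
    outer e (α + Pi.single l 1) = outer e α + Pi.single l 1 := by
  classical
  funext l'
  simp only [outer, Pi.add_apply]
  split_ifs with h
  · have : l' ≠ l := fun h' => hl (h' ▸ h)
    simp [this]
  · rfl

theorem outer_injOn {α β : Fin m → ℕ} (h : outer e α = outer e β) (h' : ∀ i, α (e i) = β (e i)) :
    α = β := by
  funext l
  by_cases hl : l ∈ Set.range e
  · obtain ⟨i, rfl⟩ := hl
    exact h' i
  · rw [← outer_apply_of_notMem e α hl, h, outer_apply_of_notMem e β hl]

/-- The operator `z_{3,3}` for the word `s_2 s_1 s_2` on the factors `e 0`, `e 1`, `e 2`. -/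
noncomputable def braidX : Op m :=
  OscFamily.entryX q (fun i => ann q (e i)) (fun i => qPow q (e i))

/-- The operator `z_{3,2}` for the word `s_2 s_1 s_2` on the factors `e 0`, `e 1`, `e 2`. -/
noncomputable def braidY : Op m :=
  OscFamily.entryY (fun i => ann q (e i)) (fun i => qPow q (e i))

/-- The operator `-q⁻¹ z_{2,3}` for the word `s_2 s_1 s_2` on the factors `e 0`, `e 1`, `e 2`. -/
noncomputable def braidW : Op m :=
  OscFamily.entryW (fun i => ann q (e i)) (fun i => qPow q (e i))

/-- The orthonormal basis vectors generated from the vacuum by the entries of the matrix of the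
word `s_2 s_1 s_2`. -/
noncomputable def braidBasis (α : Fin m → ℕ) : H m :=
  fockBasis (q : ℝ) (braidX q e) (braidY q e) (braidW q e) (α (e 1)) (α (e 2)) (α (e 0))
    (ket (outer e α))

variable {e} (he : Function.Injective e)
include he

theorem braidRel_braid : BraidRel ((q : ℝ) : ℂ) (braidX q e) (braidY q e) (braidW q e)
    (qPow q (e 0) * qPow q (e 1)) (qPow q (e 1) * qPow q (e 2)) :=
  (oscFamily q he).braidRel

theorem isVacuum_braid (α : Fin m → ℕ) : IsVacuum (braidX q e) (braidY q e) (braidW q e)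
    (qPow q (e 0) * qPow q (e 1)) (qPow q (e 1) * qPow q (e 2)) (ket (outer e α)) := by
  have ha : ∀ i, ann q (e i) (ket (outer e α)) = 0 := fun i =>
    ann_ket_of_eq_zero q (outer_apply_self e α i)
  have hk : ∀ i, qPow q (e i) (ket (outer e α)) = ket (outer e α) := fun i => by
    rw [qPow_ket, outer_apply_self, pow_zero, one_smul]
  have hc : ann q (e 1) (star (ann q (e 0)) (ket (outer e α))) = 0 := by
    have := congrArg (fun A : Op m => A (ket (outer e α)))
      ((oscFamily q he).asc 1 0 (by decide)).eq
    simp only [mul_apply_eq_comp, ha, map_zero] at this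
    exact this
  constructor
  · simp only [braidX, OscFamily.entryX, star_sub, star_smul, star_mul, star_star, star_qPow,
      sub_apply, smul_apply, mul_apply_eq_comp, ha, hk, map_zero, smul_zero, sub_zero]
  · simp only [braidY, OscFamily.entryY, star_add, star_mul, star_star, star_qPow,
      add_apply, mul_apply_eq_comp, ha, hk, map_zero, add_zero]
  · simp only [braidW, OscFamily.entryW, star_add, star_mul, star_star, star_qPow,
      add_apply, mul_apply_eq_comp, ha, hk, hc, map_zero, add_zero]
  · simp only [mul_apply_eq_comp, hk]
  · simp only [mul_apply_eq_comp, hk]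

theorem orthonormal_braidBasis : Orthonormal ℂ (braidBasis q e) := by
  rw [orthonormal_iff_ite]
  intro α β
  rw [braidBasis, braidBasis, (braidRel_braid q he).inner_fockBasis q.2 (isVacuum_braid q he α)
    (isVacuum_braid q he β), inner_ket, ket_apply]
  by_cases h : α = β
  · subst h
    simp
  · rw [if_neg h]
    split_ifs with h1 h2
    · refine absurd (outer_injOn e h2 fun i => ?_) h
      fin_cases i
      exacts [h1.2.2, h1.1, h1.2.1]
    · rfl
    · rfl

/-- The isometry that carries the standard basis into the one generated by the matrix entries for the
word `s_2 s_1 s_2`. -/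
theorem exists_isometry_of_orthonormal : ∃ V : Op m, star V * V = 1 ∧
    ∀ α, V (ket α) = braidBasis q e α := by
  have ho := (orthonormal_braidBasis q he).orthogonalFamily
  refine ⟨ho.linearIsometry.toContinuousLinearMap, ?_, fun α => ?_⟩
  · rw [ContinuousLinearMap.star_eq_adjoint]
    exact (ContinuousLinearMap.norm_map_iff_adjoint_comp_self _).1
      ho.linearIsometry.norm_map
  · have := ho.linearIsometry_apply_single (i := α) (1 : ℂ)
    simp only [LinearIsometry.toSpanSingleton_apply, one_smul] at this
    exact this

/-- `V` intertwines `A` with `B`, and the adjoint of `A` with the adjoint of `B`. -/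
structure Inter (V A B : Op m) : Prop where
  eq : V * A = B * V
  star_eq : V * star A = star B * V

/-- The isometry that identifies the basis vectors with those generated by the matrix entries for
the word `s_2 s_1 s_2` intertwines five entries of the matrices of `s_1 s_2 s_1` and `s_2 s_1 s_2`,
and commutes with the operators on the other tensor factors. -/
theorem exists_isometry : ∃ V : Op m, star V * V = 1 ∧
    Inter V (star (ann q (e 1))) (braidX q e) ∧
    Inter V (qPow q (e 1) * star (ann q (e 2))) (braidY q e) ∧
    Inter V (star (ann q (e 0)) * qPow q (e 1)) (braidW q e) ∧
    V * (qPow q (e 1) * qPow q (e 2)) = qPow q (e 0) * qPow q (e 1) * V ∧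
    V * (qPow q (e 0) * qPow q (e 1)) = qPow q (e 1) * qPow q (e 2) * V ∧
    ∀ l, l ∉ Set.range e → CommuteFactor q l V := by
  obtain ⟨V, hV, hk⟩ := exists_isometry_of_orthonormal q he
  have hB := braidRel_braid q he
  have hω := isVacuum_braid q he
  have n01 : e 0 ≠ e 1 := he.ne (by decide)
  have n02 : e 0 ≠ e 2 := he.ne (by decide)
  have n12 : e 1 ≠ e 2 := he.ne (by decide)
  have b0 : ∀ α, braidBasis q e (α + Pi.single (e 0) 1) = fockBasis (q : ℝ) (braidX q e)
      (braidY q e) (braidW q e) (α (e 1)) (α (e 2)) (α (e 0) + 1) (ket (outer e α)) := fun α => by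
    rw [braidBasis, outer_add_self]
    simp [n01.symm, n02.symm]
  have b1 : ∀ α, braidBasis q e (α + Pi.single (e 1) 1) = fockBasis (q : ℝ) (braidX q e)
      (braidY q e) (braidW q e) (α (e 1) + 1) (α (e 2)) (α (e 0)) (ket (outer e α)) := fun α => by
    rw [braidBasis, outer_add_self]
    simp [n01, n12.symm]
  have b2 : ∀ α, braidBasis q e (α + Pi.single (e 2) 1) = fockBasis (q : ℝ) (braidX q e)
      (braidY q e) (braidW q e) (α (e 1)) (α (e 2) + 1) (α (e 0)) (ket (outer e α)) := fun α => by
    rw [braidBasis, outer_add_self]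
    simp [n02, n12]
  refine ⟨V, hV, ⟨ext_ket fun α => ?_, ext_ket fun α => ?_⟩,
    ⟨ext_ket fun α => ?_, ext_ket fun α => ?_⟩, ⟨ext_ket fun α => ?_, ext_ket fun α => ?_⟩,
    ext_ket fun α => ?_, ext_ket fun α => ?_, ?_⟩
  · rw [mul_apply_eq_comp, mul_apply_eq_comp, star_ann_ket, map_smul, hk, hk, b1, braidBasis,
      BraidRel.x_fockBasis q.2]
  · rw [mul_apply_eq_comp, mul_apply_eq_comp, star_star, hk]
    by_cases h : α (e 1) = 0
    · rw [ann_ket_of_eq_zero q h, map_zero, braidBasis, h, hB.star_x_fockBasis_zero (hω α)]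
    · obtain ⟨β, rfl⟩ := exists_eq_add_single h
      rw [ann_ket_add, map_smul, hk, b1, hB.star_x_fockBasis q.2 (hω β), braidBasis]
  · rw [mul_apply_eq_comp, mul_apply_eq_comp, mul_apply_eq_comp, star_ann_ket, map_smul, qPow_ket,
      map_smul, map_smul, hk, hk, b2, braidBasis, hB.y_fockBasis q.2, smul_smul, mul_comm]
    simp [n12]
  · rw [mul_apply_eq_comp, mul_apply_eq_comp, star_mul, star_star, star_qPow, mul_apply_eq_comp,
      qPow_ket, map_smul, map_smul, hk]
    by_cases h : α (e 2) = 0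
    · rw [ann_ket_of_eq_zero q h, map_zero, smul_zero, braidBasis, h,
        hB.star_y_fockBasis_zero (hω α)]
    · obtain ⟨β, rfl⟩ := exists_eq_add_single h
      rw [ann_ket_add, map_smul, hk, b2, hB.star_y_fockBasis q.2 (hω β), braidBasis, smul_smul]
      simp [n12]
  · rw [mul_apply_eq_comp, mul_apply_eq_comp, mul_apply_eq_comp, qPow_ket, map_smul, map_smul,
      star_ann_ket, map_smul, hk, hk, b0, braidBasis, hB.w_fockBasis q.2, smul_smul]
  · rw [mul_apply_eq_comp, mul_apply_eq_comp, star_mul, star_star, star_qPow, mul_apply_eq_comp, hk]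
    by_cases h : α (e 0) = 0
    · rw [ann_ket_of_eq_zero q h, map_zero, map_zero, braidBasis, h,
        hB.star_w_fockBasis_zero (hω α)]
    · obtain ⟨β, rfl⟩ := exists_eq_add_single h
      rw [ann_ket_add, map_smul, map_smul, qPow_ket, map_smul, hk, b0,
        hB.star_w_fockBasis q.2 (hω β), braidBasis, smul_smul, mul_comm]
  · rw [mul_apply_eq_comp, mul_apply_eq_comp, mul_apply_eq_comp, qPow_ket, map_smul, qPow_ket,
      map_smul, map_smul, hk, smul_smul, braidBasis, hB.p_fockBasis (hω α), pow_add, mul_comm]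
  · rw [mul_apply_eq_comp, mul_apply_eq_comp, mul_apply_eq_comp, qPow_ket, map_smul, qPow_ket,
      map_smul, map_smul, hk, smul_smul, braidBasis, hB.r_fockBasis (hω α), pow_add]
  · intro l hl
    have hle : ∀ i, e i ≠ l := fun i h => hl ⟨i, h⟩
    -- An operator on another factor moves the vacuum vectors like the basis vectors.
    have key : ∀ Z : Op m, (∀ i, CommuteFactor q (e i) Z) →
        (∀ α, ∃ (c : ℂ) (β : Fin m → ℕ), Z (ket α) = c • ket β ∧
          Z (ket (outer e α)) = c • ket (outer e β) ∧ ∀ i, β (e i) = α (e i)) → Commute Z V := by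
      intro Z hZ hα
      have ha : ∀ i, Commute (ann q (e i)) Z := fun i => (hZ i).shift.mul_left (hZ i).sqrtOp
      have hs : ∀ i, Commute (star (ann q (e i))) Z := fun i => by
        rw [star_ann]
        exact (hZ i).sqrtOp.mul_left (hZ i).star_shift
      have hX : Commute Z (braidX q e) :=
        (((hs 0).mul_left (hs 2)).sub_left (((hZ 0).qPow.mul_left
          ((hs 1).mul_left (hZ 2).qPow)).smul_left _)).symm
      have hY : Commute Z (braidY q e) :=
        (((hZ 0).qPow.mul_left ((hs 1).mul_left (ha 2))).add_left
          ((hs 0).mul_left (hZ 2).qPow)).symm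
      have hW : Commute Z (braidW q e) :=
        (((ha 0).mul_left ((hs 1).mul_left (hZ 2).qPow)).add_left
          ((hZ 0).qPow.mul_left (hs 2))).symm
      refine ext_ket fun α => ?_
      obtain ⟨c, β, h1, h2, h3⟩ := hα α
      rw [mul_apply_eq_comp, mul_apply_eq_comp, h1, map_smul, hk, hk, braidBasis, braidBasis, h3,
        h3, h3, fockBasis, fockBasis, map_smul, fockVec, fockVec,
        apply_pow_apply_of_commute hX.eq, apply_pow_apply_of_commute hY.eq,
        apply_pow_apply_of_commute hW.eq, h2]
      simp only [map_smul]
      rw [smul_comm]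
    have hS : Commute (shift l) V := key _ (fun i => commuteFactor_shift q (hle i)) fun α => by
      by_cases h : α l = 0
      · exact ⟨0, α, by rw [shift_ket, if_pos h, zero_smul], by
          rw [shift_ket, if_pos (by rw [outer_apply_of_notMem e α hl, h]), zero_smul], fun i => rfl⟩
      · obtain ⟨β, rfl⟩ := exists_eq_add_single h
        exact ⟨1, β, by rw [shift_ket_add, one_smul], by
          rw [outer_add_of_notMem e β hl, shift_ket_add, one_smul], fun i => by simp [hle i]⟩
    refine ⟨hS, ?_, ?_, ?_⟩
    · refine key _ (fun i => (commuteFactor_shift q (hle i)).star) fun α =>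
        ⟨1, α + Pi.single l 1, by rw [star_shift_ket, one_smul], by
          rw [star_shift_ket, one_smul, outer_add_of_notMem e α hl], fun i => by simp [hle i]⟩
    · exact key _ (fun i => commuteFactor_sqrtOp q (hle i)) fun α => ⟨_, α, sqrtOp_ket q l α, by
        rw [sqrtOp_ket, outer_apply_of_notMem e α hl], fun i => rfl⟩
    · exact key _ (fun i => commuteFactor_qPow q (hle i)) fun α => ⟨_, α, qPow_ket q l α, by
        rw [qPow_ket, outer_apply_of_notMem e α hl], fun i => rfl⟩

end BraidIsometry

end QSU

namespace QSU

/-! ### Reconstruction of a quantum `3 × 3` matrix from its last row and column -/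

section ThreeByThree

section Adjoint

variable {B : Type*} [Ring B] [StarRing B] [Algebra ℂ B] {q : ℝ} {z : Matrix (Fin 3) (Fin 3) B}

/-- The adjoints of the entries of a quantum `3 × 3` matrix are `2 × 2` quantum minors. -/
theorem QuantumRel.adj_three (h : QuantumRel q z) (r s : Fin 3) :
    (-(q : ℂ)) ^ (r : ℕ) • star (z r s) = (-(q : ℂ)) ^ (s : ℕ) •
      (z (r.succAbove 0) (s.succAbove 0) * z (r.succAbove 1) (s.succAbove 1) -
        (q : ℂ) • (z (r.succAbove 0) (s.succAbove 1) * z (r.succAbove 1) (s.succAbove 0))) := by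
  have hu : (Finset.univ : Finset (Equiv.Perm (Fin 2))) = {1, Equiv.swap 0 1} := by decide
  have h0 : invCount (1 : Equiv.Perm (Fin 2)) = 0 := by decide
  have h1 : invCount (Equiv.swap 0 1 : Equiv.Perm (Fin 2)) = 1 := by decide
  rw [h.adj, hu, Finset.sum_pair (by decide), h0, h1]
  simp only [List.ofFn_succ, List.ofFn_zero, List.prod_cons, List.prod_nil, pow_zero, one_smul,
    pow_one, mul_one, Equiv.Perm.one_apply, Equiv.swap_apply_left, Fin.succ_zero_eq_one,
    Equiv.swap_apply_right, neg_smul, ← sub_eq_add_neg]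

variable (h : QuantumRel q z) (hf : FRT (q : ℂ) z) (hq : q ≠ 0)
include h

theorem QuantumRel.star_00 : star (z 0 0) = z 1 1 * z 2 2 - (q : ℂ) • (z 1 2 * z 2 1) := by
  simpa using h.adj_three 0 0

theorem QuantumRel.star_01 : star (z 0 1) =
    (-(q : ℂ)) • (z 1 0 * z 2 2 - (q : ℂ) • (z 1 2 * z 2 0)) := by
  simpa using h.adj_three 0 1

include hf hq

/-- The middle entry is determined by the last row and column up to the factor `1 - z₂₂* z₂₂`. -/
theorem QuantumRel.one_sub_mul_11 : (1 - star (z 2 2) * z 2 2) * z 1 1 =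
    -((q : ℂ)⁻¹ • (star (z 2 2) * z 2 1 * z 1 2)) - (q : ℂ) • (star (z 0 2) * star (z 2 0)) := by
  have hq' : (q : ℂ) ≠ 0 := by exact_mod_cast hq
  have c := h.col 2 2
  have c' := h.col 2 1
  rw [Fin.sum_univ_three] at c c'
  have e1 : 1 - star (z 2 2) * z 2 2 = star (z 0 2) * z 0 2 + star (z 1 2) * z 1 2 := by
    rw [if_pos rfl] at c
    rw [← c]
    abel
  have e2 : star (z 0 2) * z 0 1 + star (z 1 2) * z 1 1 = -(star (z 2 2) * z 2 1) := by
    rw [if_neg (by decide)] at c'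
    exact eq_neg_of_add_eq_zero_left c'
  have e3 : z 0 2 * z 1 1 = (q : ℂ)⁻¹ • (z 0 1 * z 1 2) - (q : ℂ) • star (z 2 0) := by
    have := h.adj_three 2 0
    simp only [Fin.isValue, Fin.succAbove, Fin.val_two, Fin.val_zero, pow_zero, one_smul] at this
    replace this : (-(q : ℂ)) ^ 2 • star (z 2 0) = z 0 1 * z 1 2 - (q : ℂ) • (z 0 2 * z 1 1) := this
    rw [eq_sub_iff_add_eq, ← eq_sub_iff_add_eq'] at this
    have h2 := congrArg (fun t => (q : ℂ)⁻¹ • t) this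
    simp only [smul_smul, smul_sub, inv_mul_cancel₀ hq', one_smul] at h2
    rw [h2]
    congr 2
    field_simp
  have e4 : z 1 2 * z 1 1 = (q : ℂ)⁻¹ • (z 1 1 * z 1 2) := by
    rw [hf.row 1 (show (1 : Fin 3) < 2 by decide), smul_smul, inv_mul_cancel₀ hq', one_smul]
  have e5 : -((q : ℂ)⁻¹ • (star (z 2 2) * z 2 1 * z 1 2)) =
      (q : ℂ)⁻¹ • (-(star (z 2 2) * z 2 1) * z 1 2) := by
    rw [neg_mul, smul_neg]
  rw [e1, add_mul, mul_assoc, e3, mul_assoc, e4, e5, ← e2]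
  simp only [mul_sub, mul_smul_comm, add_mul, smul_add, mul_assoc]
  abel

/-- The analogous formula for `z₁₀`. -/
theorem QuantumRel.one_sub_mul_10 : (1 - star (z 2 2) * z 2 2) * z 1 0 =
    star (z 0 2) * star (z 2 1) - (q : ℂ)⁻¹ • (star (z 2 2) * z 2 0 * z 1 2) := by
  have hq' : (q : ℂ) ≠ 0 := by exact_mod_cast hq
  have c := h.col 2 2
  have c' := h.col 2 0
  rw [Fin.sum_univ_three] at c c'
  have e1 : 1 - star (z 2 2) * z 2 2 = star (z 0 2) * z 0 2 + star (z 1 2) * z 1 2 := by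
    rw [if_pos rfl] at c
    rw [← c]
    abel
  have e2 : star (z 0 2) * z 0 0 + star (z 1 2) * z 1 0 = -(star (z 2 2) * z 2 0) := by
    rw [if_neg (by decide)] at c'
    exact eq_neg_of_add_eq_zero_left c'
  have e3 : z 0 2 * z 1 0 = star (z 2 1) + (q : ℂ)⁻¹ • (z 0 0 * z 1 2) := by
    have := h.adj_three 2 1
    replace this : (-(q : ℂ)) ^ 2 • star (z 2 1) =
      (-(q : ℂ)) ^ 1 • (z 0 0 * z 1 2 - (q : ℂ) • (z 0 2 * z 1 0)) := this
    have h2 := congrArg (fun t => ((q : ℂ) ^ 2)⁻¹ • t) this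
    simp only [neg_sq, smul_smul, inv_mul_cancel₀ (pow_ne_zero 2 hq'), one_smul, smul_sub] at h2
    rw [h2]
    have h3 : ((q : ℂ) ^ 2)⁻¹ * (-(q : ℂ)) ^ 1 = -(q : ℂ)⁻¹ := by field_simp
    have h4 : ((q : ℂ) ^ 2)⁻¹ * ((-(q : ℂ)) ^ 1 * q) = -1 := by field_simp
    simp only [h3, h4, neg_smul, one_smul]
    abel
  have e4 : z 1 2 * z 1 0 = (q : ℂ)⁻¹ • (z 1 0 * z 1 2) := by
    rw [hf.row 1 (show (0 : Fin 3) < 2 by decide), smul_smul, inv_mul_cancel₀ hq', one_smul]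
  have e5 : (q : ℂ)⁻¹ • (star (z 2 2) * z 2 0 * z 1 2) =
      -((q : ℂ)⁻¹ • (-(star (z 2 2) * z 2 0) * z 1 2)) := by
    rw [neg_mul, smul_neg, neg_neg]
  rw [e1, add_mul, mul_assoc, e3, mul_assoc, e4, e5, ← e2]
  simp only [mul_add, mul_smul_comm, add_mul, smul_add, mul_assoc]
  abel

end Adjoint

namespace Inter

variable {m : ℕ} {V A B A' B' : Op m}

protected theorem star (h : Inter V A B) : Inter V (star A) (star B) :=
  ⟨h.star_eq, by rw [star_star, star_star]; exact h.eq⟩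

theorem mul (h : Inter V A B) (h' : Inter V A' B') : Inter V (A * A') (B * B') where
  eq := by rw [← mul_assoc, h.eq, mul_assoc, h'.eq, mul_assoc]
  star_eq := by
    rw [star_mul, star_mul, ← mul_assoc, h'.star_eq, mul_assoc, h.star_eq, mul_assoc]

theorem sub (h : Inter V A B) (h' : Inter V A' B') : Inter V (A - A') (B - B') where
  eq := by rw [mul_sub, sub_mul, h.eq, h'.eq]
  star_eq := by rw [star_sub, star_sub, mul_sub, sub_mul, h.star_eq, h'.star_eq]

theorem smul (c : ℂ) (h : Inter V A B) : Inter V (c • A) (c • B) where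
  eq := by rw [mul_smul_comm, smul_mul_assoc, h.eq]
  star_eq := by
    rw [star_smul, star_smul, mul_smul_comm, smul_mul_assoc, h.star_eq]

theorem neg (h : Inter V A B) : Inter V (-A) (-B) := by
  simpa using h.smul (-1)

theorem one : Inter V 1 1 := ⟨by simp, by simp⟩

theorem of_star (h : Inter V (Star.star A) (Star.star B)) : Inter V A B := by
  simpa using h.star

/-- Cancellation of a self-adjoint factor. -/
theorem of_mul_left {D D' : Op m} (h : Inter V (D * A) (D' * B)) (hD : Inter V D D')
    (h1 : Star.star D = D) (h1' : Star.star D' = D') (h2 : ∀ C, D * C = 0 → C = 0)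
    (h2' : ∀ C, D' * C = 0 → C = 0) : Inter V A B where
  eq := by
    rw [← sub_eq_zero]
    refine h2' _ ?_
    rw [mul_sub, ← mul_assoc, ← hD.eq, ← mul_assoc, ← h.eq, mul_assoc, sub_self]
  star_eq := by
    have e := h.star_eq
    rw [star_mul, star_mul, h1, h1', mul_assoc, ← hD.eq, ← mul_assoc, ← mul_assoc, ← sub_eq_zero,
      ← sub_mul] at e
    have e' := h2 _ (by simpa [h1] using congrArg Star.star e)
    have e'' := congrArg Star.star e'
    simp only [star_sub, star_mul, star_star, star_zero] at e''
    exact sub_eq_zero.1 e''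

end Inter

/-- By unitarity `1 - z₂₂* z₂₂ = z₀₂* z₀₂ + z₁₂* z₁₂`, which is injective if `z₀₂` is. -/
theorem eq_zero_of_one_sub_mul {m : ℕ} {q : ℝ} {z : Matrix (Fin 3) (Fin 3) (Op m)}
    (h : QuantumRel q z) (hz : ∀ C, z 0 2 * C = 0 → C = 0) (C : Op m)
    (hC : (1 - star (z 2 2) * z 2 2) * C = 0) : C = 0 := by
  refine hz C ?_
  have c := h.col 2 2
  rw [Fin.sum_univ_three, if_pos rfl] at c
  have e1 : 1 - star (z 2 2) * z 2 2 = star (z 0 2) * z 0 2 + star (z 1 2) * z 1 2 := by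
    rw [← c]
    abel
  rw [e1] at hC
  refine ContinuousLinearMap.ext fun ξ => ?_
  have h1 : inner ℂ (C ξ) ((star (z 0 2) * z 0 2 + star (z 1 2) * z 1 2) (C ξ)) = 0 := by
    rw [← mul_apply_eq_comp, hC, zero_apply, inner_zero_right]
  rw [add_apply, inner_add_right, mul_apply_eq_comp, mul_apply_eq_comp,
    ContinuousLinearMap.star_eq_adjoint, ContinuousLinearMap.star_eq_adjoint,
    ContinuousLinearMap.adjoint_inner_right, ContinuousLinearMap.adjoint_inner_right,
    inner_self_eq_norm_sq_to_K, inner_self_eq_norm_sq_to_K] at h1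
  have h2 : ‖z 0 2 (C ξ)‖ ^ 2 + ‖z 1 2 (C ξ)‖ ^ 2 = 0 := by
    simpa only [← RCLike.ofReal_pow, ← RCLike.ofReal_add, RCLike.ofReal_eq_zero] using h1
  have h3 : ‖z 0 2 (C ξ)‖ = 0 := by nlinarith [sq_nonneg ‖z 0 2 (C ξ)‖, sq_nonneg ‖z 1 2 (C ξ)‖]
  exact norm_eq_zero.1 h3

/-- An operator that intertwines the entries in the last row and the last column of two quantum
`3 × 3` matrices intertwines all entries, if the upper right entries are injective. -/
theorem inter_of_corner {m : ℕ} {q : ℝ} (hq : q ≠ 0) {S T : Matrix (Fin 3) (Fin 3) (Op m)}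
    (hS : QuantumRel q S) (hT : QuantumRel q T) (hS' : FRT (q : ℂ) S) (hT' : FRT (q : ℂ) T)
    {V : Op m} (h22 : Inter V (S 2 2) (T 2 2)) (h21 : Inter V (S 2 1) (T 2 1))
    (h12 : Inter V (S 1 2) (T 1 2)) (h20 : Inter V (S 2 0) (T 2 0)) (h02 : Inter V (S 0 2) (T 0 2))
    (iS : ∀ C, S 0 2 * C = 0 → C = 0) (iT : ∀ C, T 0 2 * C = 0 → C = 0) (i j : Fin 3) :
    Inter V (S i j) (T i j) := by
  have hD : Inter V (1 - star (S 2 2) * S 2 2) (1 - star (T 2 2) * T 2 2) :=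
    Inter.one.sub (h22.star.mul h22)
  have sD : ∀ Z : Op m, star (1 - star Z * Z) = 1 - star Z * Z := fun Z => by
    rw [star_sub, star_one, star_mul, star_star]
  have h11 : Inter V (S 1 1) (T 1 1) := by
    refine Inter.of_mul_left ?_ hD (sD _) (sD _) (eq_zero_of_one_sub_mul hS iS)
      (eq_zero_of_one_sub_mul hT iT)
    rw [hS.one_sub_mul_11 hS' hq, hT.one_sub_mul_11 hT' hq]
    exact (((h22.star.mul h21).mul h12).smul _).neg.sub ((h02.star.mul h20.star).smul _)
  have h10 : Inter V (S 1 0) (T 1 0) := by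
    refine Inter.of_mul_left ?_ hD (sD _) (sD _) (eq_zero_of_one_sub_mul hS iS)
      (eq_zero_of_one_sub_mul hT iT)
    rw [hS.one_sub_mul_10 hS' hq, hT.one_sub_mul_10 hT' hq]
    exact (h02.star.mul h21.star).sub (((h22.star.mul h20).mul h12).smul _)
  have h00 : Inter V (S 0 0) (T 0 0) := by
    refine Inter.of_star ?_
    rw [hS.star_00, hT.star_00]
    exact (h11.mul h22).sub ((h12.mul h21).smul _)
  have h01 : Inter V (S 0 1) (T 0 1) := by
    refine Inter.of_star ?_
    rw [hS.star_01, hT.star_01]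
    exact ((h10.mul h22).sub ((h12.mul h20).smul _)).smul _
  fin_cases i <;> fin_cases j
  exacts [h00, h01, h02, h10, h11, h12, h20, h21, h22]

end ThreeByThree

end QSU

namespace QSU

/-! ### Intertwiners for braid moves -/

section BraidMove

variable {m n : ℕ}

/-- The matrix of operators for the word `s_r s_s s_r` acting on the factors `e 0`, `e 1`, `e 2`. -/
noncomputable def braidMat (q : Set.Ico (0 : ℝ) 1) (r s : Fin n) (e : Fin 3 → Fin m) :
    Matrix (Fin (n + 1)) (Fin (n + 1)) (Op m) :=
  simpleMat q r (e 0) * simpleMat q s (e 1) * simpleMat q r (e 2)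

theorem qPow_mul_eq_zero {q : Set.Ico (0 : ℝ) 1} (hq : (q : ℝ) ≠ 0) (k : Fin m) (C : Op m)
    (h : qPow q k * C = 0) : C = 0 := by
  refine Op.ext_apply fun ξ x => ?_
  have h1 := congrArg (fun A : Op m => A ξ x) h
  simp only [mul_apply_eq_comp, qPow_apply, zero_apply, lp.coeFn_zero, Pi.zero_apply,
    mul_eq_zero] at h1
  exact h1.resolve_left (pow_ne_zero _ (by exact_mod_cast hq))

theorem quantumRel_braidMat {q : Set.Ico (0 : ℝ) 1} (hq : (q : ℝ) ≠ 0) (r s : Fin n)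
    {e : Fin 3 → Fin m} (he : Function.Injective e) :
    QuantumRel q (braidMat q r s e) ∧ FRT ((q : ℝ) : ℂ) (braidMat q r s e) := by
  have h := quantumRel_posEntry hq (L := [(r, e 0), (s, e 1), (r, e 2)]) (by
    simp [he.eq_iff])
  rw [posEntry_of_ne_zero hq] at h
  simp only [List.map_cons, List.map_nil, List.prod_cons, List.prod_nil, mul_one, ← mul_assoc] at h
  exact h

section Entries

variable {B : Type*} [Ring B] (a b c d a' b' c' d' a'' b'' c'' d'' : B)

/-- The entries in the last row and column for the word `s_1 s_2 s_1`. -/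
theorem blockMat_sts : ∀ M : Matrix (Fin 3) (Fin 3) B, M = blockMat (0 : Fin 2) a b c d *
    blockMat (1 : Fin 2) a' b' c' d' * blockMat (0 : Fin 2) a'' b'' c'' d'' →
    M 2 2 = d' ∧ M 2 1 = c' * d'' ∧ M 1 2 = d * b' ∧ M 2 0 = c' * c'' ∧ M 0 2 = b * b' := by
  rintro _ rfl
  refine ⟨?_, ?_, ?_, ?_, ?_⟩ <;> simp [Matrix.mul_apply, Fin.sum_univ_three, blockMat]

/-- The entries in the last row and column for the word `s_2 s_1 s_2`. -/
theorem blockMat_tst : ∀ M : Matrix (Fin 3) (Fin 3) B, M = blockMat (1 : Fin 2) a b c d *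
    blockMat (0 : Fin 2) a' b' c' d' * blockMat (1 : Fin 2) a'' b'' c'' d'' →
    M 2 2 = c * d' * b'' + d * d'' ∧ M 2 1 = c * d' * a'' + d * c'' ∧
      M 1 2 = a * d' * b'' + b * d'' ∧ M 2 0 = c * c' ∧ M 0 2 = b' * b'' := by
  rintro _ rfl
  refine ⟨?_, ?_, ?_, ?_, ?_⟩ <;> simp [Matrix.mul_apply, Fin.sum_univ_three, blockMat]

end Entries

/-- The isometry of `exists_isometry` intertwines the last rows and columns, hence all entries. -/
theorem exists_isometry_braidMat {q : Set.Ico (0 : ℝ) 1} (hq : (q : ℝ) ≠ 0) {e : Fin 3 → Fin m}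
    (he : Function.Injective e) : ∃ V : Op m, star V * V = 1 ∧
      (∀ l, l ∉ Set.range e → CommuteFactor q l V) ∧
      ∀ i j, Inter V (braidMat (n := 2) q 0 1 e i j) (braidMat (n := 2) q 1 0 e i j) := by
  obtain ⟨V, hV, hx, hy, hw, hp, hr, hc⟩ := exists_isometry q he
  refine ⟨V, hV, hc, ?_⟩
  have hp' : Inter V (qPow q (e 1) * qPow q (e 2)) (qPow q (e 0) * qPow q (e 1)) := by
    refine ⟨hp, ?_⟩
    have c1 := (oscFamily q he).kk 1 2
    have c2 := (oscFamily q he).kk 0 1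
    rw [star_mul, star_mul, star_qPow, star_qPow, star_qPow, ← c1.eq, ← c2.eq, hp]
  have hr' : Inter V (qPow q (e 0) * qPow q (e 1)) (qPow q (e 1) * qPow q (e 2)) := by
    refine ⟨hr, ?_⟩
    have c1 := (oscFamily q he).kk 1 2
    have c2 := (oscFamily q he).kk 0 1
    rw [star_mul, star_mul, star_qPow, star_qPow, star_qPow, ← c1.eq, ← c2.eq, hr]
  obtain ⟨S22, S21, S12, S20, S02⟩ := blockMat_sts _ _ _ _ _ _ _ _ _ _ _ _
    (braidMat (n := 2) q 0 1 e) (by rw [braidMat, simpleEntry_eq_blockMat hq,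
      simpleEntry_eq_blockMat hq, simpleEntry_eq_blockMat hq])
  obtain ⟨T22, T21, T12, T20, T02⟩ := blockMat_tst _ _ _ _ _ _ _ _ _ _ _ _
    (braidMat (n := 2) q 1 0 e) (by rw [braidMat, simpleEntry_eq_blockMat hq,
      simpleEntry_eq_blockMat hq, simpleEntry_eq_blockMat hq])
  replace S12 : braidMat (n := 2) q 0 1 e 1 2 =
      (-((q : ℝ) : ℂ)) • (star (ann q (e 0)) * qPow q (e 1)) := by
    rw [S12, mul_smul_comm]
  replace S02 : braidMat (n := 2) q 0 1 e 0 2 =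
      (((q : ℝ) : ℂ) * q) • (qPow q (e 0) * qPow q (e 1)) := by
    rw [S02, mul_smul_comm, smul_mul_assoc, smul_smul, neg_mul_neg]
  replace T02 : braidMat (n := 2) q 1 0 e 0 2 =
      (((q : ℝ) : ℂ) * q) • (qPow q (e 1) * qPow q (e 2)) := by
    rw [T02, mul_smul_comm, smul_mul_assoc, smul_smul, neg_mul_neg]
  replace T22 : braidMat (n := 2) q 1 0 e 2 2 = braidX q e := by
    rw [T22, braidX, OscFamily.entryX, mul_smul_comm, neg_smul, neg_add_eq_sub, mul_assoc]
  replace T21 : braidMat (n := 2) q 1 0 e 2 1 = braidY q e := by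
    rw [T21, braidY, OscFamily.entryY, mul_assoc]
  replace T12 : braidMat (n := 2) q 1 0 e 1 2 = (-((q : ℝ) : ℂ)) • braidW q e := by
    rw [T12, braidW, OscFamily.entryW, mul_smul_comm, smul_mul_assoc, ← smul_add, mul_assoc]
  have hi : ∀ (k l : Fin m) (C : Op m),
      (((q : ℝ) : ℂ) * q) • (qPow q k * qPow q l) * C = 0 → C = 0 := fun k l C h => by
    rw [smul_mul_assoc, smul_eq_zero, mul_assoc] at h
    have hq' : ((q : ℝ) : ℂ) ≠ 0 := by exact_mod_cast hq
    exact qPow_mul_eq_zero hq l C (qPow_mul_eq_zero hq k _ (h.resolve_left (mul_ne_zero hq' hq')))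
  refine inter_of_corner hq (quantumRel_braidMat hq 0 1 he).1 (quantumRel_braidMat hq 1 0 he).1
    (quantumRel_braidMat hq 0 1 he).2 (quantumRel_braidMat hq 1 0 he).2 ?_ ?_ ?_ ?_ ?_ ?_ ?_
  · rwa [S22, T22]
  · rwa [S21, T21]
  · rw [S12, T12]
    exact hw.smul _
  · rwa [S20, T20]
  · rw [S02, T02]
    exact hr'.smul _
  · rw [S02]
    exact hi _ _
  · rw [T02]
    exact hi _ _

open Matrix in
/-- Reflection of the matrix indices together with the adjoint exchanges the matrices of the two
simple reflections of `S_3`. -/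
theorem conjTranspose_simpleMat_rev {q : Set.Ico (0 : ℝ) 1} (hq : (q : ℝ) ≠ 0) (k : Fin m)
    (r : Fin 2) : (simpleMat (n := 2) q r k)ᴴ.submatrix Fin.revPerm Fin.revPerm =
      simpleMat (n := 2) q (Fin.rev r) k := by
  rw [simpleEntry_eq_blockMat hq, simpleEntry_eq_blockMat hq]
  ext1 i j
  rw [submatrix_apply, conjTranspose_apply]
  fin_cases r <;> fin_cases i <;> fin_cases j <;> simp [blockMat, star_qPow, Fin.rev]

open Matrix in
theorem conjTranspose_braidMat_rev {q : Set.Ico (0 : ℝ) 1} (hq : (q : ℝ) ≠ 0) (r s : Fin 2)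
    (e : Fin 3 → Fin m) :
    (braidMat (n := 2) q r s (e ∘ Fin.rev))ᴴ.submatrix Fin.revPerm Fin.revPerm =
      braidMat (n := 2) q (Fin.rev r) (Fin.rev s) e := by
  rw [braidMat, conjTranspose_mul, conjTranspose_mul, ← submatrix_mul_equiv _ _ _ Fin.revPerm,
    ← submatrix_mul_equiv _ _ _ Fin.revPerm, conjTranspose_simpleMat_rev hq,
    conjTranspose_simpleMat_rev hq, conjTranspose_simpleMat_rev hq, ← mul_assoc]
  rfl

/-- The isometry in the opposite direction, obtained from the symmetry that reverses the indices and
the order of the factors and takes adjoints. -/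
theorem exists_isometry_braidMat' {q : Set.Ico (0 : ℝ) 1} (hq : (q : ℝ) ≠ 0) {e : Fin 3 → Fin m}
    (he : Function.Injective e) : ∃ V : Op m, star V * V = 1 ∧
      (∀ l, l ∉ Set.range e → CommuteFactor q l V) ∧
      ∀ i j, Inter V (braidMat (n := 2) q 1 0 e i j) (braidMat (n := 2) q 0 1 e i j) := by
  obtain ⟨V, hV, hc, hi⟩ := exists_isometry_braidMat hq (he.comp Fin.rev_injective)
  refine ⟨V, hV, fun l hl => hc l fun h => hl ?_, fun i j => ?_⟩
  · obtain ⟨k, rfl⟩ := h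
    exact ⟨_, rfl⟩
  · have h1 := congrFun (congrFun (conjTranspose_braidMat_rev hq 0 1 e) i) j
    have h2 := congrFun (congrFun (conjTranspose_braidMat_rev hq 1 0 e) i) j
    have := (hi (Fin.rev j) (Fin.rev i)).star
    exact Eq.mp (congrArg₂ (Inter V) h1 h2) this

/-- The extension of a `3 × 3` matrix by an identity matrix along an injection of the index set. -/
noncomputable def embed {B : Type*} [Ring B] (f : Fin 3 ↪ Fin (n + 1))
    (Z : Matrix (Fin 3) (Fin 3) B) : Matrix (Fin (n + 1)) (Fin (n + 1)) B :=
  open Classical in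
  (Matrix.fromBlocks Z 0 0 1).submatrix
    ((Equiv.Set.sumCompl (Set.range f)).symm.trans
      (Equiv.sumCongr (Equiv.ofInjective f f.injective).symm (Equiv.refl _)))
    ((Equiv.Set.sumCompl (Set.range f)).symm.trans
      (Equiv.sumCongr (Equiv.ofInjective f f.injective).symm (Equiv.refl _)))

section Embed

variable {B : Type*} [Ring B] (f : Fin 3 ↪ Fin (n + 1))

theorem embed_mul (Z W : Matrix (Fin 3) (Fin 3) B) : embed f (Z * W) = embed f Z * embed f W := by
  classical
  rw [embed, embed, embed, Matrix.submatrix_mul_equiv, Matrix.fromBlocks_multiply]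
  simp

theorem embed_apply_range (Z : Matrix (Fin 3) (Fin 3) B) (i j : Fin 3) :
    embed f Z (f i) (f j) = Z i j := by
  classical
  have h : ∀ i, (Equiv.Set.sumCompl (Set.range f)).symm (f i) = Sum.inl ⟨f i, i, rfl⟩ := fun i =>
    Equiv.Set.sumCompl_symm_apply_of_mem _
  have h' : ∀ i, (Equiv.ofInjective f f.injective).symm ⟨f i, i, rfl⟩ = i := fun i =>
    (Equiv.symm_apply_eq _).2 rfl
  simp [embed, h, h']

theorem embed_apply_left (Z : Matrix (Fin 3) (Fin 3) B) {i : Fin (n + 1)} (hi : i ∉ Set.range f)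
    (j : Fin (n + 1)) : embed f Z i j = if i = j then 1 else 0 := by
  classical
  have h : ∀ {i} (hi : i ∉ Set.range f), (Equiv.Set.sumCompl (Set.range f)).symm i =
      Sum.inr ⟨i, hi⟩ := fun hi => Equiv.Set.sumCompl_symm_apply_of_notMem hi
  by_cases hj : j ∈ Set.range f
  · rw [if_neg (by rintro rfl; exact hi hj)]
    simp [embed, h hi, Equiv.Set.sumCompl_symm_apply_of_mem hj]
  · simp [embed, h hi, h hj, Matrix.one_apply]

theorem embed_apply_right (Z : Matrix (Fin 3) (Fin 3) B) {j : Fin (n + 1)} (hj : j ∉ Set.range f)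
    (i : Fin (n + 1)) : embed f Z i j = if i = j then 1 else 0 := by
  classical
  have h : ∀ {i} (hi : i ∉ Set.range f), (Equiv.Set.sumCompl (Set.range f)).symm i =
      Sum.inr ⟨i, hi⟩ := fun hi => Equiv.Set.sumCompl_symm_apply_of_notMem hi
  by_cases hi : i ∈ Set.range f
  · rw [if_neg (by rintro rfl; exact hj hi)]
    simp [embed, h hj, Equiv.Set.sumCompl_symm_apply_of_mem hi]
  · simp [embed, h hi, h hj, Matrix.one_apply]

theorem embed_blockMat [Algebra ℂ B] {r : Fin n} {r' : Fin 2} (h0 : f r'.castSucc = r.castSucc)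
    (h1 : f r'.succ = r.succ) (a b c d : B) :
    embed f (blockMat r' a b c d) = blockMat r a b c d := by
  have hr : ∀ {i}, i ∉ Set.range f → i ≠ r.castSucc ∧ i ≠ r.succ := fun hi =>
    ⟨fun h => hi ⟨_, h0.trans h.symm⟩, fun h => hi ⟨_, h1.trans h.symm⟩⟩
  ext1 i j
  by_cases hi : i ∈ Set.range f
  · by_cases hj : j ∈ Set.range f
    · obtain ⟨i, rfl⟩ := hi
      obtain ⟨j, rfl⟩ := hj
      rw [embed_apply_range]
      simp only [blockMat, ← h0, ← h1, f.injective.eq_iff]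
    · rw [embed_apply_right f _ hj, blockMat_right (hr hj).1 (hr hj).2]
  · rw [embed_apply_left f _ hi, blockMat_left (hr hi).1 (hr hi).2]

end Embed

/-- The indices `s`, `s + 1`, `s + 2` that occur in the two blocks of a braid move. -/
def braidIndex (s : Fin n) (hs : (s : ℕ) + 1 < n) : Fin 3 ↪ Fin (n + 1) where
  toFun i := ⟨s + i, by omega⟩
  inj' i j h := by
    rw [Fin.mk.injEq] at h
    exact Fin.ext (by omega)

theorem braidIndex_val (s : Fin n) (hs : (s : ℕ) + 1 < n) (i : Fin 3) :
    (braidIndex s hs i : ℕ) = s + i := rfl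

theorem braidMat_eq_embed {q : Set.Ico (0 : ℝ) 1} (hq : (q : ℝ) ≠ 0) {s t : Fin n}
    (hst : (s : ℕ) + 1 = t) (e : Fin 3 → Fin m) :
    braidMat q s t e = embed (braidIndex s (by omega)) (braidMat (n := 2) q 0 1 e) ∧
    braidMat q t s e = embed (braidIndex s (by omega)) (braidMat (n := 2) q 1 0 e) := by
  have h0 : ∀ k : Fin m, embed (braidIndex s (by omega)) (simpleMat (n := 2) q 0 k) =
      simpleMat q s k := fun k => by
    rw [simpleEntry_eq_blockMat hq, simpleEntry_eq_blockMat hq]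
    exact embed_blockMat _ (Fin.ext (by simp [braidIndex_val]))
      (Fin.ext (by simp [braidIndex_val])) _ _ _ _
  have h1 : ∀ k : Fin m, embed (braidIndex s (by omega)) (simpleMat (n := 2) q 1 k) =
      simpleMat q t k := fun k => by
    rw [simpleEntry_eq_blockMat hq, simpleEntry_eq_blockMat hq]
    exact embed_blockMat _ (Fin.ext (by simp [braidIndex_val, hst]))
      (Fin.ext (by simp [braidIndex_val, ← hst, add_assoc])) _ _ _ _
  constructor
  · rw [braidMat, braidMat, embed_mul, embed_mul, h0, h1, h0]
  · rw [braidMat, braidMat, embed_mul, embed_mul, h0, h1, h1]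

theorem inter_embed {V : Op m} {S T : Matrix (Fin 3) (Fin 3) (Op m)}
    (h : ∀ i j, V * S i j = T i j * V) (f : Fin 3 ↪ Fin (n + 1)) (i j : Fin (n + 1)) :
    V * embed f S i j = embed f T i j * V := by
  by_cases hi : i ∈ Set.range f
  · by_cases hj : j ∈ Set.range f
    · obtain ⟨i, rfl⟩ := hi
      obtain ⟨j, rfl⟩ := hj
      rw [embed_apply_range, embed_apply_range, h]
    · rw [embed_apply_right f _ hj, embed_apply_right f _ hj]
      split_ifs <;> simp
  · rw [embed_apply_left f _ hi, embed_apply_left f _ hi]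
    split_ifs <;> simp

/-- The matrices of operators for the two sides of a braid move are related by isometries in both
directions, which commute with the operators on the other tensor factors. -/
theorem exists_isometry_braid {q : Set.Ico (0 : ℝ) 1} (hq : (q : ℝ) ≠ 0) {s t : Fin n}
    (hst : (s : ℕ) + 1 = t ∨ (t : ℕ) + 1 = s) {e : Fin 3 → Fin m} (he : Function.Injective e) :
    ∃ V : Op m, star V * V = 1 ∧ (∀ l, l ∉ Set.range e → CommuteFactor q l V) ∧
      ∀ i j, V * braidMat q s t e i j = braidMat q t s e i j * V := by
  rcases hst with hst | hst
  · obtain ⟨V, hV, hc, hi⟩ := exists_isometry_braidMat hq he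
    obtain ⟨h1, h2⟩ := braidMat_eq_embed hq hst e
    rw [h1, h2]
    exact ⟨V, hV, hc, inter_embed (fun i j => (hi i j).eq) _⟩
  · obtain ⟨V, hV, hc, hi⟩ := exists_isometry_braidMat' hq he
    obtain ⟨h1, h2⟩ := braidMat_eq_embed hq hst e
    rw [h1, h2]
    exact ⟨V, hV, hc, inter_embed (fun i j => (hi i j).eq) _⟩

end BraidMove

end QSU

namespace QSU

/-! ### Intertwiners between the representations of words -/

section WordIntertwiners

variable {m n : ℕ} {q : Set.Ico (0 : ℝ) 1}

/-- The unitary that permutes the tensor factors by `σ`. -/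
noncomputable def permOp (σ : Equiv.Perm (Fin m)) : Op m :=
  weightedComp (fun _ => 1) (by simp) (fun x => x ∘ σ) σ.surjective.injective_comp_right

theorem permOp_apply (σ : Equiv.Perm (Fin m)) (ξ : H m) (x : Fin m → ℕ) :
    permOp σ ξ x = ξ (x ∘ σ) :=
  (congrArg (· * ξ (x ∘ σ)) Complex.ofReal_one).trans (one_mul _)

theorem permOp_ket (σ : Equiv.Perm (Fin m)) (x : Fin m → ℕ) :
    permOp σ (ket x) = ket (x ∘ σ.symm) := by
  ext y
  rw [permOp_apply, ket_apply, ket_apply]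
  refine if_congr ⟨fun h => ?_, fun h => ?_⟩ rfl rfl
  · rw [← h, Function.comp_assoc, Equiv.self_comp_symm, Function.comp_id]
  · rw [h, Function.comp_assoc, Equiv.symm_comp_self, Function.comp_id]

theorem star_permOp_mul_permOp (σ : Equiv.Perm (Fin m)) : star (permOp σ) * permOp σ = 1 := by
  refine Op.ext_apply fun ξ x => ?_
  change star (permOp σ) (permOp σ ξ) x = ξ x
  rw [star_apply_eq_inner, permOp_ket, inner_ket, permOp_apply, Function.comp_assoc,
    Equiv.symm_comp_self, Function.comp_id]

theorem add_single_comp (σ : Equiv.Perm (Fin m)) (x : Fin m → ℕ) (k : Fin m) :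
    (x + Pi.single (σ k) 1) ∘ σ = x ∘ σ + Pi.single k 1 := by
  funext l
  simp only [Function.comp_apply, Pi.add_apply, Pi.single_apply, σ.injective.eq_iff]

theorem sub_single_comp (σ : Equiv.Perm (Fin m)) (x : Fin m → ℕ) (k : Fin m) :
    (x - Pi.single (σ k) 1) ∘ σ = x ∘ σ - Pi.single k 1 := by
  funext l
  simp only [Function.comp_apply, Pi.sub_apply, Pi.single_apply, σ.injective.eq_iff]

section Perm

variable (σ : Equiv.Perm (Fin m)) (k : Fin m)

theorem permOp_mul_shift : permOp σ * shift k = shift (σ k) * permOp σ := by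
  refine Op.ext_apply fun ξ x => ?_
  change permOp σ (shift k ξ) x = shift (σ k) (permOp σ ξ) x
  rw [permOp_apply, shift_apply, shift_apply, permOp_apply, add_single_comp]

theorem permOp_mul_star_shift : permOp σ * star (shift k) = star (shift (σ k)) * permOp σ := by
  refine Op.ext_apply fun ξ x => ?_
  change permOp σ (star (shift k) ξ) x = star (shift (σ k)) (permOp σ ξ) x
  rw [permOp_apply, star_shift_apply, star_shift_apply, permOp_apply, sub_single_comp]
  rfl

theorem permOp_mul_qPow (q : Set.Ico (0 : ℝ) 1) :
    permOp σ * qPow q k = qPow q (σ k) * permOp σ := by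
  refine Op.ext_apply fun ξ x => ?_
  change permOp σ (qPow q k ξ) x = qPow q (σ k) (permOp σ ξ) x
  rw [permOp_apply, qPow_apply, qPow_apply, permOp_apply]
  rfl

theorem permOp_mul_sqrtOp (q : Set.Ico (0 : ℝ) 1) :
    permOp σ * sqrtOp q k = sqrtOp q (σ k) * permOp σ := by
  refine Op.ext_apply fun ξ x => ?_
  change permOp σ (sqrtOp q k ξ) x = sqrtOp q (σ k) (permOp σ ξ) x
  rw [permOp_apply, sqrtOp_apply, sqrtOp_apply, permOp_apply]
  rfl

variable {σ k} in
theorem commuteFactor_permOp (q : Set.Ico (0 : ℝ) 1) (h : σ k = k) :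
    CommuteFactor q k (permOp σ) where
  shift := by have := permOp_mul_shift σ k; rw [h] at this; exact this.symm
  star_shift := by have := permOp_mul_star_shift σ k; rw [h] at this; exact this.symm
  sqrtOp := by have := permOp_mul_sqrtOp σ k q; rw [h] at this; exact this.symm
  qPow := by have := permOp_mul_qPow σ k q; rw [h] at this; exact this.symm

theorem permOp_mul_simpleEntry (hq : (q : ℝ) ≠ 0) (r : Fin n) (i j : Fin (n + 1)) :
    permOp σ * simpleEntry q r k i j = simpleEntry q r (σ k) i j * permOp σ := by
  unfold simpleEntry
  simp only [if_neg hq]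
  split_ifs
  · rw [← mul_assoc, permOp_mul_shift, mul_assoc, permOp_mul_sqrtOp, mul_assoc]
  · rw [← mul_assoc, permOp_mul_sqrtOp, mul_assoc, permOp_mul_star_shift, mul_assoc]
  · rw [mul_smul_comm, permOp_mul_qPow, smul_mul_assoc]
  · exact permOp_mul_qPow σ k q
  · rw [mul_one, one_mul]
  · rw [mul_zero, zero_mul]

end Perm

section BlockCommute

variable {B : Type*} [Ring B] [Algebra ℂ B]

omit [Algebra ℂ B] in
/-- Matrices that differ from the identity in disjoint blocks only; their entries need not commute. -/
theorem blockMat_sub_one_mul {r r' : Fin n} (h : (r : ℕ) + 1 < r' ∨ (r' : ℕ) + 1 < r)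
    (a b c d a' b' c' d' : B) :
    (blockMat r a b c d - 1) * (blockMat r' a' b' c' d' - 1) = 0 := by
  ext i j
  rw [Matrix.mul_apply]
  refine Finset.sum_eq_zero fun k _ => ?_
  by_cases hk : k = r.castSucc ∨ k = r.succ
  · have : k ≠ r'.castSucc ∧ k ≠ r'.succ := by
      constructor <;> rintro rfl <;> rcases hk with hk | hk <;>
        simp [Fin.ext_iff] at hk <;> omega
    rw [Matrix.sub_apply (blockMat r' a' b' c' d'), blockMat_left this.1 this.2, Matrix.one_apply,
      sub_self, mul_zero]
  · rw [not_or] at hk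
    rw [Matrix.sub_apply (blockMat r a b c d), blockMat_right hk.1 hk.2, Matrix.one_apply,
      sub_self, zero_mul]

omit [Algebra ℂ B] in
theorem blockMat_mul_comm {r r' : Fin n} (h : (r : ℕ) + 1 < r' ∨ (r' : ℕ) + 1 < r)
    (a b c d a' b' c' d' : B) :
    blockMat r a b c d * blockMat r' a' b' c' d' = blockMat r' a' b' c' d' * blockMat r a b c d := by
  have h1 := blockMat_sub_one_mul h a b c d a' b' c' d'
  have h2 := blockMat_sub_one_mul h.symm a' b' c' d' a b c d
  rw [sub_mul, mul_sub, mul_sub, mul_one, mul_one, one_mul] at h1 h2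
  have h3 := h1.trans h2.symm
  have e : ∀ X Y Z W : Matrix (Fin (n + 1)) (Fin (n + 1)) B,
      X - Y - (Z - 1) = W - Z - (Y - 1) → X = W := fun X Y Z W h => by
    have h' : X = (X - Y - (Z - 1)) + Y + (Z - 1) := by abel
    rw [h', h]
    abel
  exact e _ _ _ _ h3

end BlockCommute

/-- The matrix of `π_a` is carried into the one of `π_b` by an isometry. -/
def WordInter (q : Set.Ico (0 : ℝ) 1) (a b : List (Fin n)) : Prop :=
  ∃ V : H a.length →ₗᵢ[ℂ] H b.length,
    ∀ i j ξ, V (wordEntry q a i j ξ) = wordEntry q b i j (V ξ)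

theorem WordInter.refl (q : Set.Ico (0 : ℝ) 1) (a : List (Fin n)) : WordInter q a a :=
  ⟨LinearIsometry.id, fun _ _ _ => rfl⟩

theorem WordInter.trans {a b c : List (Fin n)} (h : WordInter q a b) (h' : WordInter q b c) :
    WordInter q a c := by
  obtain ⟨V, hV⟩ := h
  obtain ⟨W, hW⟩ := h'
  exact ⟨W.comp V, fun i j ξ => (congrArg W (hV i j ξ)).trans (hW i j _)⟩

/-- The space of `π_a` identified with `ℓ²(ℕ)^{⊗ m}` along an equation `a.length = m`. -/
theorem exists_equiv_posEntry (q : Set.Ico (0 : ℝ) 1) (a : List (Fin n)) (h : a.length = m) :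
    ∃ W : H a.length ≃ₗᵢ[ℂ] H m, ∀ i j ξ,
      W (wordEntry q a i j ξ) = posEntry q (a.zip (List.finRange m)) i j (W ξ) := by
  subst h
  have e : (List.ofFn fun k => (a.get k, k)) = a.zip (List.finRange a.length) := by
    refine List.ext_getElem (by simp) fun k h1 h2 => ?_
    simp
  refine ⟨LinearIsometryEquiv.refl ℂ _, fun i j ξ => ?_⟩
  rw [wordEntry_eq_posEntry, e]
  rfl

theorem wordInter_of_posEntry {a b : List (Fin n)} (ha : a.length = m) (hb : b.length = m)
    {V : Op m} (hV : star V * V = 1) (h : ∀ i j, V * posEntry q (a.zip (List.finRange m)) i j =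
      posEntry q (b.zip (List.finRange m)) i j * V) : WordInter q a b := by
  obtain ⟨W, hW⟩ := exists_equiv_posEntry q a ha
  obtain ⟨W', hW'⟩ := exists_equiv_posEntry q b hb
  let V' : H m →ₗᵢ[ℂ] H m :=
    ⟨V, (ContinuousLinearMap.norm_map_iff_adjoint_comp_self V).2 hV⟩
  refine ⟨(W'.symm.toLinearIsometry.comp V').comp W.toLinearIsometry, fun i j ξ => ?_⟩
  refine W'.injective ?_
  change W' (W'.symm (V (W _))) = W' (wordEntry q b i j (W'.symm (V (W ξ))))
  rw [W'.apply_symm_apply, hW', W'.apply_symm_apply, hW]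
  exact DFunLike.congr_fun (h i j) (W ξ)

/-- A local move: an intertwiner for a part of a word that acts on the corresponding factors only is
one for the whole word. -/
theorem wordInter_of_move (hq : (q : ℝ) ≠ 0) {x x' : List (Fin n)} (hx : x.length = x'.length)
    (h : ∀ (m : ℕ) (F : List (Fin m)), F.Nodup → F.length = x.length → ∃ V : Op m,
      star V * V = 1 ∧ (∀ l, l ∉ F → CommuteFactor q l V) ∧
      ∀ i j, V * posEntry q (x.zip F) i j = posEntry q (x'.zip F) i j * V)
    (c y : List (Fin n)) : WordInter q (c ++ x ++ y) (c ++ x' ++ y) := by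
  obtain ⟨m, hm⟩ : ∃ m, m = (c ++ x ++ y).length := ⟨_, rfl⟩
  obtain ⟨F, F₃, hF, hF₁₂, h₃⟩ : ∃ F F₃ : List (Fin m), List.finRange m = F ++ F₃ ∧
      F.length = (c ++ x).length ∧ F₃.length = y.length := by
    refine ⟨(List.finRange m).take (c ++ x).length, (List.finRange m).drop (c ++ x).length,
      (List.take_append_drop _ _).symm, ?_, ?_⟩
    · simp [hm]
    · simp [hm]
      omega
  obtain ⟨F₁, F₂, rfl, h₁, h₂⟩ : ∃ F₁ F₂ : List (Fin m), F = F₁ ++ F₂ ∧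
      F₁.length = c.length ∧ F₂.length = x.length := by
    rw [List.length_append] at hF₁₂
    exact ⟨F.take c.length, F.drop c.length, (List.take_append_drop _ _).symm,
      by simp; omega, by simp; omega⟩
  have hn := List.nodup_finRange m
  rw [hF] at hn
  have hd₃ := List.nodup_append.1 hn
  have hd₁ := List.nodup_append.1 hd₃.1
  obtain ⟨V, hV, hc, hi⟩ := h m F₂ hd₁.2.1 h₂
  refine wordInter_of_posEntry hm.symm (by simp [hm, hx]) hV fun i j => ?_
  have e : ∀ x : List (Fin n), x.length = F₂.length →
      (posEntry q ((c ++ x ++ y).zip (List.finRange m)) : Matrix _ _ (Op m)) =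
        posEntry q (c.zip F₁) * posEntry q (x.zip F₂) * posEntry q (y.zip F₃) := fun x hx => by
    rw [hF, List.zip_append (by simp [h₁, hx]), List.zip_append h₁.symm,
      posEntry_of_ne_zero hq, posEntry_of_ne_zero hq (c.zip F₁), posEntry_of_ne_zero hq (x.zip F₂),
      posEntry_of_ne_zero hq (y.zip F₃), List.map_append, List.map_append, List.prod_append,
      List.prod_append]
  have hmul : ∀ {X Y X' Y' : Matrix (Fin (n + 1)) (Fin (n + 1)) (Op m)},
      (∀ i j, V * X i j = Y i j * V) → (∀ i j, V * X' i j = Y' i j * V) →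
      ∀ i j, V * (X * X') i j = (Y * Y') i j * V := fun h h' i j => by
    rw [Matrix.mul_apply, Matrix.mul_apply, Finset.mul_sum, Finset.sum_mul]
    exact Finset.sum_congr rfl fun k _ => by
      rw [← mul_assoc, h, mul_assoc, h', mul_assoc]
  have hout : ∀ (z : List (Fin n)) (G : List (Fin m)), (∀ l ∈ G, l ∉ F₂) →
      ∀ i j, V * posEntry q (z.zip G) i j = posEntry q (z.zip G) i j * V := fun z G hG i j =>
    (CommuteFactor.posEntry_commute _ (fun p hp => hc _ (hG _ (List.of_mem_zip hp).2)) i j).symm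
  rw [e x h₂.symm, e x' (hx.symm.trans h₂.symm)]
  refine hmul (hmul (hout c F₁ fun l hl hl' => hd₁.2.2 l hl l hl' rfl) hi)
    (hout y F₃ fun l hl hl' => hd₃.2.2 l (List.mem_append_right _ hl') l hl rfl) i j

theorem wordInter_braid (hq : (q : ℝ) ≠ 0) {s t : Fin n} (hst : (s : ℕ) + 1 = t ∨ (t : ℕ) + 1 = s)
    (c y : List (Fin n)) : WordInter q (c ++ [s, t, s] ++ y) (c ++ [t, s, t] ++ y) := by
  refine wordInter_of_move hq (x := [s, t, s]) (x' := [t, s, t]) rfl (fun m F hF hl => ?_) c y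
  obtain ⟨k₀, k₁, k₂, rfl⟩ := List.length_eq_three.1 hl
  have he : Function.Injective ![k₀, k₁, k₂] := by
    refine List.nodup_ofFn.1 ?_
    simpa [List.ofFn_succ] using hF
  obtain ⟨V, hV, hc, hi⟩ := exists_isometry_braid hq hst he
  have e : ∀ s t : Fin n, (posEntry q ([s, t, s].zip [k₀, k₁, k₂]) : Matrix _ _ (Op m)) =
      braidMat q s t ![k₀, k₁, k₂] := fun s t => by
    rw [posEntry_of_ne_zero hq]
    simp [braidMat, mul_assoc]
  refine ⟨V, hV, fun l hl => hc l ?_, fun i j => ?_⟩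
  · rintro ⟨i, rfl⟩
    fin_cases i <;> simp at hl
  · rw [e, e]
    exact hi i j

/-- The commutation moves are implemented by the flip of two tensor factors. -/
theorem wordInter_comm (hq : (q : ℝ) ≠ 0) {s t : Fin n} (hst : (s : ℕ) + 1 < t ∨ (t : ℕ) + 1 < s)
    (c y : List (Fin n)) : WordInter q (c ++ [s, t] ++ y) (c ++ [t, s] ++ y) := by
  refine wordInter_of_move hq (x := [s, t]) (x' := [t, s]) rfl (fun m F hF hl => ?_) c y
  obtain ⟨k, l, rfl⟩ := List.length_eq_two.1 hl
  refine ⟨permOp (Equiv.swap k l), star_permOp_mul_permOp _, fun p hp =>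
    commuteFactor_permOp q ?_, fun i j => ?_⟩
  · simp only [List.mem_cons, List.not_mem_nil, or_false, not_or] at hp
    exact Equiv.swap_apply_of_ne_of_ne hp.1 hp.2
  · have e : ∀ (s t : Fin n) (k l : Fin m),
        (posEntry q ([s, t].zip [k, l]) : Matrix _ _ (Op m)) =
          simpleMat q s k * simpleMat q t l := fun s t k l => by
      rw [posEntry_of_ne_zero hq]
      simp
    have e' : (simpleMat q t k * simpleMat q s l : Matrix _ _ (Op m)) =
        simpleMat q s l * simpleMat q t k := by
      rw [simpleEntry_eq_blockMat hq, simpleEntry_eq_blockMat hq]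
      exact blockMat_mul_comm hst.symm _ _ _ _ _ _ _ _
    rw [e, e, e', Matrix.mul_apply, Matrix.mul_apply, Finset.mul_sum, Finset.sum_mul]
    refine Finset.sum_congr rfl fun p _ => ?_
    rw [← mul_assoc, permOp_mul_simpleEntry _ _ hq, mul_assoc, permOp_mul_simpleEntry _ _ hq,
      Equiv.swap_apply_left, Equiv.swap_apply_right, mul_assoc]

/-- For `q ≠ 0` the representations for two reduced words of the same permutation are contained in
each other. -/
theorem wordInter_of_isReducedWord {a b : List (Fin n)} {w : Equiv.Perm (Fin (n + 1))}
    (ha : IsReducedWord a w) (hb : IsReducedWord b w) (hq : (q : ℝ) ≠ 0) : WordInter q a b := by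
  have := matsumoto
    (fun a b => ∀ y, WordInter q (a ++ y) (b ++ y) ∧ WordInter q (b ++ y) (a ++ y))
    (fun a y => ⟨.refl _ _, .refl _ _⟩) (fun a b h y => (h y).symm)
    (fun a b c h h' y => ⟨(h y).1.trans (h' y).1, (h' y).2.trans (h y).2⟩)
    (fun a b s h y => by
      rw [List.append_assoc, List.append_assoc]
      exact h ([s] ++ y))
    (fun c s t hst y => ⟨wordInter_comm hq (.inl hst) c y, wordInter_comm hq (.inr hst) c y⟩)
    (fun c s t hst y => ⟨wordInter_braid hq (.inl hst) c y, wordInter_braid hq (.inr hst) c y⟩)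
    ha hb []
  rw [List.append_nil, List.append_nil] at this
  exact this.1

end WordIntertwiners

/-! ### Independence of the reduced word -/

section NormEquality

open Filter Topology

namespace AsympInter

variable {E F : Type*} [NormedAddCommGroup E] [NormedSpace ℂ E] [NormedAddCommGroup F]
  [NormedSpace ℂ F] {W : ℕ → E →ₗᵢ[ℂ] F} {X : F →L[ℂ] F} {Y : E →L[ℂ] E}

theorem smul (c : ℂ) (h : AsympInter W X Y) : AsympInter W (c • X) (c • Y) := by
  have := (AsympInter.scalar W c).mul h
  rwa [← Algebra.smul_def, ← Algebra.smul_def] at this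

theorem sum {ι : Type*} (s : Finset ι) {X : ι → F →L[ℂ] F} {Y : ι → E →L[ℂ] E}
    (h : ∀ i, AsympInter W (X i) (Y i)) : AsympInter W (∑ i ∈ s, X i) (∑ i ∈ s, Y i) := by
  classical
  induction s using Finset.induction_on with
  | empty => simpa using AsympInter.scalar W 0
  | insert i s hi ih =>
    rw [Finset.sum_insert hi, Finset.sum_insert hi]
    exact (h i).add ih

theorem prod_ofFn {p : ℕ} {X : Fin p → F →L[ℂ] F} {Y : Fin p → E →L[ℂ] E}
    (h : ∀ i, AsympInter W (X i) (Y i)) : AsympInter W (List.ofFn X).prod (List.ofFn Y).prod := by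
  induction p with
  | zero => simpa using AsympInter.scalar W 1
  | succ p ih =>
    rw [List.ofFn_succ, List.ofFn_succ, List.prod_cons, List.prod_cons]
    exact (h 0).mul (ih fun i => h i.succ)

/-- If `W N` intertwines exactly operators that converge to `X` and `Y`, then `X` and `Y` are
intertwined asymptotically. -/
theorem of_exact {x : ℕ → F →L[ℂ] F} {y : ℕ → E →L[ℂ] E}
    (h : ∀ N, x N ∘L (W N).toContinuousLinearMap = (W N).toContinuousLinearMap ∘L y N)
    (hx : Tendsto x atTop (𝓝 X)) (hy : Tendsto y atTop (𝓝 Y)) : AsympInter W X Y := by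
  refine tendsto_zero_iff_norm_tendsto_zero.2 ?_
  have l := ((tendsto_const_nhds (x := X)).sub hx).norm.add
    ((tendsto_const_nhds (x := Y)).sub hy).norm
  rw [sub_self, sub_self, norm_zero, norm_zero, add_zero] at l
  refine squeeze_zero (fun _ => norm_nonneg _) (fun N => ?_) l
  have h1 := norm_comp_le (W N) (X - x N)
  have h2 := LinearIsometry.norm_toContinuousLinearMap_comp (f := W N) (g := Y - y N)
  have h3 := h N
  set V := (W N).toContinuousLinearMap
  have e : X ∘L V - V ∘L Y = (X - x N) ∘L V - V ∘L (Y - y N) := by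
    rw [ContinuousLinearMap.comp_sub, ContinuousLinearMap.sub_comp, h3]
    abel
  rw [e]
  exact (norm_sub_le _ _).trans (by linarith)

end AsympInter

variable {n : ℕ}

/-- The adjoints of the generators are polynomials in the generators, for all `q`. -/
theorem asympInter_star_repEntry {q : Set.Ico (0 : ℝ) 1} {t : Fin n → Circle} {a b : List (Fin n)}
    {W : ℕ → H a.length →ₗᵢ[ℂ] H b.length}
    (h : ∀ i j, AsympInter W (repEntry q t b i j) (repEntry q t a i j)) (i j : Fin (n + 1)) :
    AsympInter W (star (repEntry q t b i j)) (star (repEntry q t a i j)) := by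
  rcases rel_repEntry q t a with ⟨hq, ha⟩ | ⟨hq, ha⟩
  · rcases rel_repEntry q t b with ⟨-, hb⟩ | ⟨hq', -⟩
    · rw [ha.adj, hb.adj]
      exact AsympInter.prod_ofFn fun k => h _ _
    · exact absurd hq hq'
  · rcases rel_repEntry q t b with ⟨hq', -⟩ | ⟨-, hb⟩
    · exact absurd hq' hq
    · have h0 : (-((q : ℝ) : ℂ)) ^ (i : ℕ) ≠ 0 :=
        pow_ne_zero _ (neg_ne_zero.2 (Complex.ofReal_ne_zero.2 hq))
      have e : AsympInter W ((-((q : ℝ) : ℂ)) ^ (i : ℕ) • star (repEntry q t b i j))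
          ((-((q : ℝ) : ℂ)) ^ (i : ℕ) • star (repEntry q t a i j)) := by
        rw [ha.adj, hb.adj]
        exact (AsympInter.sum _ fun σ => (AsympInter.prod_ofFn fun k => h _ _).smul _).smul _
      have := e.smul ((-((q : ℝ) : ℂ)) ^ (i : ℕ))⁻¹
      rwa [inv_smul_smul₀ h0, inv_smul_smul₀ h0] at this

theorem norm_rep_le_of_asympInter {q : Set.Ico (0 : ℝ) 1} {t : Fin n → Circle}
    {a b : List (Fin n)} {W : ℕ → H a.length →ₗᵢ[ℂ] H b.length}
    (h : ∀ i j, AsympInter W (repEntry q t b i j) (repEntry q t a i j)) (x : Aq q n) :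
    ‖rep q t a x‖ ≤ ‖rep q t b x‖ := by
  refine AsympInter.norm_le (W := W) (And.left (b := AsympInter W (star (rep q t b x))
    (star (rep q t a x))) ?_)
  refine Aq.induction_closed (p := fun x => AsympInter W (rep q t b x) (rep q t a x) ∧
    AsympInter W (star (rep q t b x)) (star (rep q t a x)))
    (fun i j => ⟨h i j, asympInter_star_repEntry h i j⟩) ?_ ?_ ?_ ?_ ?_ x
  · intro x y hx hy
    simp only [map_mul, star_mul]
    exact ⟨hx.1.mul hy.1, hy.2.mul hx.2⟩
  · intro x y hx hy
    simp only [map_add, star_add]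
    exact ⟨hx.1.add hy.1, hx.2.add hy.2⟩
  · intro x hx
    simp only [map_star, star_star]
    exact hx.symm
  · intro c
    simp only [AlgHomClass.commutes, ← algebraMap_star_comm]
    exact ⟨AsympInter.scalar W c, AsympInter.scalar W _⟩
  · refine IsSeqClosed.isClosed fun x X hx hX => ?_
    have ha := (continuous_starAlgHom (rep q t a)).continuousAt.tendsto.comp hX
    have hb := (continuous_starAlgHom (rep q t b)).continuousAt.tendsto.comp hX
    exact ⟨AsympInter.of_tendsto (fun i => (hx i).1) hb ha,
      AsympInter.of_tendsto (fun i => (hx i).2) hb.star ha.star⟩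

theorem conv_charEntry {B : Type*} [Ring B] [Algebra ℂ B] (q : ℝ) (t : Fin n → Circle)
    (Y : Fin (n + 1) → Fin (n + 1) → B) (i j : Fin (n + 1)) :
    conv q (charEntry B t) Y i j = torusEntry t i • Y i j := by
  rw [Algebra.smul_def]
  unfold conv charEntry
  split_ifs
  · rw [Finset.sum_eq_single_of_mem i (Finset.mem_Icc.2 ⟨min_le_left _ _, le_max_left _ _⟩)
      fun k _ hk => by rw [if_neg hk.symm, zero_mul], if_pos rfl]
  · rw [Finset.sum_eq_single_of_mem i (Finset.mem_univ i)
      fun k _ hk => by rw [if_neg hk.symm, zero_mul], if_pos rfl]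

/-- For `q = 0` the intertwining isometries for parameters that tend to `0` are used; they need not
converge, but intertwine asymptotically. -/
theorem norm_rep_le {a b : List (Fin n)}
    (h : ∀ q : Set.Ico (0 : ℝ) 1, (q : ℝ) ≠ 0 → WordInter q a b) (q : Set.Ico (0 : ℝ) 1)
    (t : Fin n → Circle) (x : Aq q n) : ‖rep q t a x‖ ≤ ‖rep q t b x‖ := by
  choose V hV using h
  have key : ∀ (q : Set.Ico (0 : ℝ) 1) (hq : (q : ℝ) ≠ 0) i j,
      repEntry q t b i j ∘L (V q hq).toContinuousLinearMap =
        (V q hq).toContinuousLinearMap ∘L repEntry q t a i j := fun q hq i j => by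
    refine ContinuousLinearMap.ext fun ξ => ?_
    change repEntry q t b i j (V q hq ξ) = V q hq (repEntry q t a i j ξ)
    rw [repEntry, repEntry, conv_charEntry, conv_charEntry, smul_apply,
      smul_apply, map_smul, hV]
  by_cases hq : (q : ℝ) = 0
  · obtain rfl := eq_qZero hq
    refine norm_rep_le_of_asympInter (W := fun N => V (qSeq N) (qSeq_ne_zero N)) (fun i j => ?_) x
    refine AsympInter.of_exact (fun N => ?_) (crystalLimit_repMat t b i j)
      (crystalLimit_repMat t a i j)
    rw [crystal, crystal, ContinuousLinearMap.smul_comp, ContinuousLinearMap.comp_smul]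
    exact congrArg _ (key (qSeq N) (qSeq_ne_zero N) i j)
  · exact norm_rep_le_of_asympInter (W := fun _ => V q hq)
      (fun i j => AsympInter.of_eq fun _ => key q hq i j) x

/-- The norms `‖π_{t,a}(x)‖` depend only on the permutation that the reduced word `a` expresses. -/
theorem norm_rep_eq {a b : List (Fin n)} {w : Equiv.Perm (Fin (n + 1))} (ha : IsReducedWord a w)
    (hb : IsReducedWord b w) (q : Set.Ico (0 : ℝ) 1) (t : Fin n → Circle) (x : Aq q n) :
    ‖rep q t a x‖ = ‖rep q t b x‖ :=
  le_antisymm (norm_rep_le (fun _ => wordInter_of_isReducedWord ha hb) q t x)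
    (norm_rep_le (fun _ => wordInter_of_isReducedWord hb ha) q t x)

end NormEquality

end QSU

namespace QSU

/-! ### Subwords and factorization -/

variable {n : ℕ}

/-- Every reduced word of `w` contains one of `u`; evaluation of the deleted factors at `1` carries the
representations into each other. -/
theorem exists_subword_eval {u w : Equiv.Perm (Fin (n + 1))} (huw : BruhatLE u w)
    (a : List (Fin n)) (ha : IsReducedWord a w) :
    ∃ (b : List (Fin n)) (e : Fin b.length ↪o Fin a.length),
      IsReducedWord b u ∧ (∀ k, b.get k = a.get (e k)) ∧
      ∃ ev : toeplitzPow a.length →⋆ₐ[ℂ] toeplitzPow b.length,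
        (∀ k, ev (toeplitzShift (e k)) = toeplitzShift k) ∧
        (∀ k, k ∉ Set.range e → ev (toeplitzShift k) = 1) ∧
        ∀ q t x, EvTo ev (rep q t a x) (rep q t b x) := by
  obtain ⟨b, hs, hb⟩ := huw.exists_sublist a ha
  obtain ⟨e, he⟩ := List.sublist_iff_exists_fin_orderEmbedding_get_eq.1 hs
  obtain ⟨ev, h1, h2⟩ := exists_eval e
  exact ⟨b, e, hb, he, ev, h1, h2, fun q t x =>
    EvTo.rep q t (fun i j => EvTo.repEntry q t e he h1 h2 i j) x⟩

theorem norm_map_toeplitzPow_le {m m' : ℕ} (ev : toeplitzPow m →⋆ₐ[ℂ] toeplitzPow m')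
    (x : toeplitzPow m) : ‖(ev x : Op m')‖ ≤ ‖(x : Op m)‖ := by
  let _ := StarSubalgebra.cstarAlgebra (toeplitzPow m) (h_closed := isClosed_toeplitzPow m)
  let _ := StarSubalgebra.cstarAlgebra (toeplitzPow m') (h_closed := isClosed_toeplitzPow m')
  have := NonUnitalStarAlgHom.norm_apply_le ev x
  exact this

theorem norm_le_of_evTo {m m' : ℕ} {ev : toeplitzPow m →⋆ₐ[ℂ] toeplitzPow m'} {X : Op m}
    {Y : Op m'} (h : EvTo ev X Y) : ‖Y‖ ≤ ‖X‖ := by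
  obtain ⟨hX, rfl⟩ := h
  exact norm_map_toeplitzPow_le ev ⟨X, hX⟩

/-- An inequality of norms is an inclusion of kernels, so that the map on the image is well defined. -/
theorem factorsThrough_of_norm_le {A B₁ B₂ : Type*} [Ring A] [StarRing A] [Algebra ℂ A]
    [CStarAlgebra B₁] [CStarAlgebra B₂] {ρ₁ : A →⋆ₐ[ℂ] B₁} {ρ₂ : A →⋆ₐ[ℂ] B₂}
    (h : ∀ x, ‖ρ₁ x‖ ≤ ‖ρ₂ x‖) : FactorsThrough ρ₁ ρ₂ := by
  have hk : ∀ x y, ρ₂ x = ρ₂ y → ρ₁.rangeRestrict x = ρ₁.rangeRestrict y := fun x y e => by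
    refine Subtype.ext ?_
    change ρ₁ x = ρ₁ y
    have := h (x - y)
    rw [map_sub, map_sub, e, sub_self, norm_zero] at this
    exact sub_eq_zero.1 (norm_le_zero_iff.1 this)
  choose f hf using fun y : ρ₂.range => (show ∃ x, ρ₂ x = y from y.2)
  have hf' : ∀ x, ρ₁.rangeRestrict (f (ρ₂.rangeRestrict x)) = ρ₁.rangeRestrict x := fun x =>
    hk _ _ (hf _)
  have key : ∀ x y, ρ₂.rangeRestrict x = y → ρ₁.rangeRestrict (f y) = ρ₁.rangeRestrict x := by
    rintro x _ rfl
    exact hf' x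
  have hs : ∀ y, ρ₂.rangeRestrict (f y) = y := fun y => Subtype.ext (hf y)
  refine ⟨
    { toFun := fun y => ρ₁.rangeRestrict (f y)
      map_one' := by rw [key 1 1 (map_one _), map_one]
      map_mul' := fun y y' => by rw [key (f y * f y') _ (by rw [map_mul, hs, hs]), map_mul]
      map_zero' := by rw [key 0 0 (map_zero _), map_zero]
      map_add' := fun y y' => by rw [key (f y + f y') _ (by rw [map_add, hs, hs]), map_add]
      commutes' := fun c => by
        rw [key (algebraMap ℂ A c) _ (AlgHomClass.commutes _ c), AlgHomClass.commutes]
      map_star' := fun y => by rw [key (star (f y)) _ (by rw [map_star, hs]), map_star] },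
    hf'⟩

end QSU

/-- If `u ≤ w` in the Bruhat order, then `π_{t,u}` factors through `π_{t,w}` for all `t` and all
`q ∈ [0, 1)`. Here `π` is the family of representations `π_{t,a}` of `A_q(n)`, indexed by words `a`,
that is determined by its values on the generators. The second part holds for all reduced words of
`w` and `u`; the third describes the homomorphism between Toeplitz tensor powers, which does not
depend on `q` and `t`. -/
theorem mainTheorem7 (n : ℕ) (u w : Equiv.Perm (Fin (n + 1))) (huw : BruhatLE u w) :
    ∃ π : ∀ (q : Set.Ico (0 : ℝ) 1) (_ : Fin n → Circle) (a : List (Fin n)),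
        Aq q n →⋆ₐ[ℂ] Op a.length,
      (∀ q t a i j, π q t a (Aq.z q n i j) = repEntry q t a i j) ∧
      (∀ a b : List (Fin n), IsReducedWord a w → IsReducedWord b u →
        ∀ q t, FactorsThrough (π q t b) (π q t a)) ∧
      (∀ a : List (Fin n), IsReducedWord a w →
        ∃ (b : List (Fin n)) (e : Fin b.length ↪o Fin a.length),
          IsReducedWord b u ∧ (∀ k, b.get k = a.get (e k)) ∧
          ∃ ev : toeplitzPow a.length →⋆ₐ[ℂ] toeplitzPow b.length,
            (∀ k, ev (toeplitzShift (e k)) = toeplitzShift k) ∧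
            (∀ k, k ∉ Set.range e → ev (toeplitzShift k) = 1) ∧
            ∀ q t x, ∃ hx : π q t a x ∈ toeplitzPow a.length,
              (ev ⟨π q t a x, hx⟩ : Op b.length) = π q t b x) := by
  refine ⟨rep, rep_z, fun a b ha hb q t => ?_, fun a ha => ?_⟩
  · obtain ⟨b', e, hb', he, ev, h1, h2, h3⟩ := exists_subword_eval huw a ha
    exact factorsThrough_of_norm_le fun x => (norm_rep_eq hb hb' q t x).trans_le
      (norm_le_of_evTo (h3 q t x))
  · exact exists_subword_eval huw a ha
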